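/- **Notation.** $\dagger$ denotes the conjugate transpose, $*$ complex conjugation, $\sigma_1,\sigma_2,\sigma_3$ are the Pauli matrices and $\boldsymbol m\cdot\boldsymbol\sigma=m_1\sigma_1+m_2\sigma_2+m_3\sigma_3$. The Heisenberg ferromagnet (HF) equation is $\boldsymbol m_t=\boldsymbol m\wedge\boldsymbol m_{zz}$ for $\boldsymbol m(z,t)\in\mathbb R^3$ with $\|\boldsymbol m(z,t)\|=1$ and $\boldsymbol m(z,t)\to\boldsymbol e_3=(0,0,1)^T$ as $z\to\pm\infty$. A *triplet* $(A,B,C)$ of order $q\ge 0$ consists of complex matrices of sizes $q\times q$, $q\times 1$, $1\times q$ such that all eigenvalues of $A$ have positive real part; it represents the scalar kernel $\omega(w)=Ce^{-wA}B$, $w\in\mathbb R$, and it is *minimal* if no triplet of smaller order represents the same kernel. Given a triplet, put $$\Omega(w)=\begin{pmatrix}0&\omega(w)\\-\omega(w)^*&0\end{pmatrix},\quad \mathcal A=\begin{pmatrix}A&0\\0&A^\dagger\end{pmatrix},\quad \mathcal B=\begin{pmatrix}0&B\\-C^\dagger&0\end{pmatrix},\quad \mathcal C=\begin{pmatrix}C&0\\0&B^\dagger\end{pmatrix},$$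 $$\mathcal P=\int_0^\infty e^{-x\mathcal A}\mathcal B\mathcal C e^{-x\mathcal A}\,dx,\quad N=\int_0^\infty e^{-xA}BB^\dagger e^{-xA^\dagger}dx,\quad Q=\int_0^\infty e^{-xA^\dagger}C^\dagger Ce^{-xA}dx.$$ **(1) Kernels.** Let $a_1,\dots,a_M\in\mathbb C$ with $\operatorname{Re}a_j>0$, $n_j\ge 0$ integers, and $N_{js}\in\mathbb C$. Then the reflectionless kernel $\omega(w)=\sum_{j=1}^M\sum_{s=0}^{n_j-1}N_{js}\frac{w^s}{s!}e^{-a_jw}$ is represented by some minimal triplet $(A,B,C)$, and then $\Omega(w)=\mathcal Ce^{-w\mathcal A}\mathcal B$ for all $w\in\mathbb R$. **(2) Marchenko equation.** Let $(A,B,C)$ be a minimal triplet. Then $\Omega(w)=\mathcal Ce^{-w\mathcal A}\mathcal B$ for all real $w$; the integrals defining $\mathcal P,N,Q$ converge absolutely; $\mathcal P=\begin{pmatrix}0&N\\-Q&0\end{pmatrix}$ is the unique solution of the Sylvester equation $\mathcal A\mathcal P+\mathcal P\mathcal A=\mathcal B\mathcal C$; $N$ and $Q$ are positive definite, and $\mathcal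 P$ is invertible with $\mathcal P^{-1}=\begin{pmatrix}0&-Q^{-1}\\N^{-1}&0\end{pmatrix}$. For every $z\in\mathbb R$ the matrix $I_{2q}+e^{-z\mathcal A}\mathcal Pe^{-z\mathcal A}$ is invertible, and $$L(z,y)=-\mathcal Ce^{-z\mathcal A}\left[I_{2q}+e^{-z\mathcal A}\mathcal Pe^{-z\mathcal A}\right]^{-1}e^{-y\mathcal A}\mathcal B$$ is the unique solution $L(z,\cdot)\in L^1(z,+\infty)^{2\times2}$ of the Marchenko equation $$L(z,y)+\Omega(z+y)+\int_z^\infty L(z,u)\Omega(u+y)\,du=0_{2\times 2},\qquad y>z .$$ Moreover $\tilde L(z):=\int_z^\infty L(z,y)\,dy=-\mathcal Ce^{-z\mathcal A}\left[I_{2q}+e^{-z\mathcal A}\mathcal Pe^{-z\mathcal A}\right]^{-1}e^{-z\mathcal A}\mathcal A^{-1}\mathcal B$. **(3) Time dependence and solution of the HF equation.** Let $(A,B,C)$ be a minimal triplet and put $C(t)=Ce^{-4itA^2}$, $t\in\mathbb R$. Then $(A,B,C(t))$ is again a minimal triplet, with kernel $\omega(w;t)=Ce^{-wA}e^{-4itA^2}B$;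 if $\omega(w;0)=\sum_jN_je^{-a_jw}$, then $\omega(w;t)=\sum_je^{-4ia_j^2t}N_je^{-a_jw}$. Let $\mathcal B(t),\mathcal C(t),Q(t)$ be $\mathcal B,\mathcal C,Q$ with $C$ replaced by $C(t)$, let $\mathcal P(t)=\begin{pmatrix}0&N\\-Q(t)&0\end{pmatrix}$, and let $\tilde L(z;t)$ be the function $\tilde L(z)$ of (2) for the triplet $(A,B,C(t))$. Then $$\tilde L(z;t)=-\mathcal C(t)e^{-z\mathcal A}\left[I_{2q}+e^{-z\mathcal A}\mathcal P(t)e^{-z\mathcal A}\right]^{-1}e^{-z\mathcal A}\mathcal A^{-1}\mathcal B(t),$$ the matrix $I_2+\tilde L(z;t)$ is invertible for all $z,t\in\mathbb R$, and there is $\boldsymbol m:\mathbb R\times\mathbb R\to\mathbb R^3$ with $$\boldsymbol m(z,t)\cdot\boldsymbol\sigma=\left[I_2+\tilde L(z;t)\right]^{-1}\sigma_3\left[I_2+\tilde L(z;t)\right],$$ which is of class $C^2$ on $\mathbb R^2$, satisfies $\|\boldsymbol m(z,t)\|=1$, $\boldsymbol m(z,t)\to\boldsymbol e_3$ as $z\to\pm\infty$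 for each $t$, and solves $\boldsymbol m_t=\boldsymbol m\wedge\boldsymbol m_{zz}$. It is a multi-soliton solution in the following sense: for every $t$ and every $\lambda\in\mathbb R$ the spectral problem $X_z=i\lambda(\boldsymbol m(z,t)\cdot\boldsymbol\sigma)X$ has $2\times2$ matrix solutions $\Psi,\Phi$ with $\Psi=e^{i\lambda z\sigma_3}[I_2+o(1)]$ as $z\to+\infty$, $\Phi=e^{i\lambda z\sigma_3}[I_2+o(1)]$ as $z\to-\infty$ and $\Psi=\Phi\begin{pmatrix}a(\lambda)&-b(\lambda)\\b(\lambda)^*&a(\lambda)^*\end{pmatrix}$, where $$b(\lambda)=0,\qquad a(\lambda)=\frac{\chi(\lambda)}{\chi(0)},\qquad \chi(\lambda)=\frac{\det(\lambda I_q-iA)}{\det(\lambda I_q+iA^\dagger)} .$$ **(4) One-soliton solution.** Let $a,c\in\mathbb C$ with $p=\operatorname{Re}a>0$ and $c\ne0$. Then $A=(a)$, $B=(1)$, $C=(c)$ is a minimal triplet with $Q=(|c|^2/2p)$, $N=(1/2p)$, and, with $c_t=ce^{-4ita^2}$, $E=e^{-4pz}$, $D=1+\frac{|c_t|^2}{4p^2}E$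 and $z_0=\frac1{2p}\log\frac{|c_t|}{2p}$, the function $\boldsymbol m(z,t)$ of (3) is given by $$m_3=1-2\frac{|c_t|^2}{|a|^2}\frac{E}{D^2}=1-\frac{2p^2/|a|^2}{\cosh^2[2p(z-z_0)]},$$ $$m_1+im_2=-2\frac{c_t^*}{a^*}\frac{e^{-2a^*z}}{D}\left[1-\frac{|c_t|^2}{2pa^*}\frac{E}{D}\right],\qquad m_1-im_2=-2\frac{c_t}{a}\frac{e^{-2az}}{D}\left[1-\frac{|c_t|^2}{2pa}\frac{E}{D}\right].$$ -/

import Mathlib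

open MeasureTheory Set Filter Topology
open scoped Matrix ComplexConjugate ComplexOrder

noncomputable section

namespace HeisenbergChain

/-! ### Matrix-valued functions of a real variable -/

/-- Every entry of the matrix function `F` is Lebesgue integrable on `s`. -/
def EntriesIntegrableOn {m n : Type*} (F : ℝ → Matrix m n ℂ) (s : Set ℝ) : Prop :=
  ∀ i j, IntegrableOn (fun x => F x i j) s

/-- The entrywise integral of the matrix function `F` over `s`. -/
def matIntegral {m n : Type*} (s : Set ℝ) (F : ℝ → Matrix m n ℂ) : Matrix m n ℂ :=
  Matrix.of fun i j => ∫ x in s, F x i j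

/-- The matrix exponential `e^{-wA}`. -/
def expNeg {n : Type*} [Fintype n] [DecidableEq n] (A : Matrix n n ℂ) (w : ℝ) : Matrix n n ℂ :=
  NormedSpace.exp (-(w : ℂ) • A)

/-! ### Triplets and kernels -/

/-- The scalar kernel `ω(w) = C e^{-wA} B`. -/
def scalarKernel {q : ℕ} (A : Matrix (Fin q) (Fin q) ℂ) (B : Matrix (Fin q) (Fin 1) ℂ)
    (C : Matrix (Fin 1) (Fin q) ℂ) (w : ℝ) : ℂ :=
  (C * expNeg A w * B) 0 0

/-- All eigenvalues of `A` have positive real part. -/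
def EigenvaluesInRightHalfPlane {q : ℕ} (A : Matrix (Fin q) (Fin q) ℂ) : Prop :=
  ∀ μ ∈ spectrum ℂ A, 0 < μ.re

/-- `(A, B, C)` is a minimal triplet: the eigenvalues of `A` have positive real part, and the order
of `A` is minimal among all such triplets that represent the same kernel. -/
structure IsMinimalTriplet {q : ℕ} (A : Matrix (Fin q) (Fin q) ℂ) (B : Matrix (Fin q) (Fin 1) ℂ)
    (C : Matrix (Fin 1) (Fin q) ℂ) : Prop where
  eigenvalues : EigenvaluesInRightHalfPlane A
  minimal : ∀ (r : ℕ) (A' : Matrix (Fin r) (Fin r) ℂ) (B' : Matrix (Fin r) (Fin 1) ℂ)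
    (C' : Matrix (Fin 1) (Fin r) ℂ), EigenvaluesInRightHalfPlane A' →
    (∀ w : ℝ, scalarKernel A' B' C' w = scalarKernel A B C w) → q ≤ r

/-- The reflectionless scalar kernel
`ω(w) = ∑_{j} ∑_{s < n_j} N_{js} (w^s / s!) e^{-a_j w}` built from the discrete eigenvalues `i a_j`
and the norming constants `N_{js}`. -/
def reflectionlessKernel {N : ℕ} (a : Fin N → ℂ) (n : Fin N → ℕ) (c : Fin N → ℕ → ℂ) (w : ℝ) : ℂ :=
  ∑ j, ∑ s ∈ Finset.range (n j), c j s * ((w : ℂ) ^ s / (s.factorial : ℂ)) * Complex.exp (-a j * w)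

/-- The matrix kernel `Ω(w) = (0, ω(w); -ω(w)^*, 0)`. -/
def matrixKernel (ω : ℝ → ℂ) (w : ℝ) : Matrix (Fin 2) (Fin 2) ℂ :=
  !![0, ω w; -conj (ω w), 0]

/-- `𝒜 = (A, 0; 0, A†)`. -/
def calA {q : ℕ} (A : Matrix (Fin q) (Fin q) ℂ) : Matrix (Fin q ⊕ Fin q) (Fin q ⊕ Fin q) ℂ :=
  Matrix.fromBlocks A 0 0 Aᴴ

/-- The `2q × 2` matrix `ℬ = (0, B; -C†, 0)`. -/
def calB {q : ℕ} (B : Matrix (Fin q) (Fin 1) ℂ) (C : Matrix (Fin 1) (Fin q) ℂ) :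
    Matrix (Fin q ⊕ Fin q) (Fin 2) ℂ :=
  Matrix.of (Sum.elim (fun i => ![0, B i 0]) (fun i => ![-Cᴴ i 0, 0]))

/-- The `2 × 2q` matrix `𝒞 = (C, 0; 0, B†)`. -/
def calC {q : ℕ} (B : Matrix (Fin q) (Fin 1) ℂ) (C : Matrix (Fin 1) (Fin q) ℂ) :
    Matrix (Fin 2) (Fin q ⊕ Fin q) ℂ :=
  Matrix.of ![Sum.elim (fun i => C 0 i) (fun _ => 0), Sum.elim (fun _ => 0) (fun i => Bᴴ 0 i)]

/-- The integrand `e^{-x𝒜} ℬ 𝒞 e^{-x𝒜}` of `𝒫`. -/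
def integrandP {q : ℕ} (A : Matrix (Fin q) (Fin q) ℂ) (B : Matrix (Fin q) (Fin 1) ℂ)
    (C : Matrix (Fin 1) (Fin q) ℂ) (x : ℝ) : Matrix (Fin q ⊕ Fin q) (Fin q ⊕ Fin q) ℂ :=
  expNeg (calA A) x * calB B C * calC B C * expNeg (calA A) x

/-- `𝒫 = ∫_0^∞ e^{-x𝒜} ℬ 𝒞 e^{-x𝒜} dx`. -/
def calP {q : ℕ} (A : Matrix (Fin q) (Fin q) ℂ) (B : Matrix (Fin q) (Fin 1) ℂ)
    (C : Matrix (Fin 1) (Fin q) ℂ) : Matrix (Fin q ⊕ Fin q) (Fin q ⊕ Fin q) ℂ :=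
  matIntegral (Ioi 0) (integrandP A B C)

/-- The integrand `e^{-xA} B B† e^{-xA†}` of `N`. -/
def integrandN {q : ℕ} (A : Matrix (Fin q) (Fin q) ℂ) (B : Matrix (Fin q) (Fin 1) ℂ) (x : ℝ) :
    Matrix (Fin q) (Fin q) ℂ :=
  expNeg A x * B * Bᴴ * expNeg Aᴴ x

/-- The integrand `e^{-xA†} C† C e^{-xA}` of `Q`. -/
def integrandQ {q : ℕ} (A : Matrix (Fin q) (Fin q) ℂ) (C : Matrix (Fin 1) (Fin q) ℂ) (x : ℝ) :
    Matrix (Fin q) (Fin q) ℂ :=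
  expNeg Aᴴ x * Cᴴ * C * expNeg A x

/-- `N = ∫_0^∞ e^{-xA} B B† e^{-xA†} dx`. -/
def gramN {q : ℕ} (A : Matrix (Fin q) (Fin q) ℂ) (B : Matrix (Fin q) (Fin 1) ℂ) :
    Matrix (Fin q) (Fin q) ℂ :=
  matIntegral (Ioi 0) (integrandN A B)

/-- `Q = ∫_0^∞ e^{-xA†} C† C e^{-xA} dx`. -/
def gramQ {q : ℕ} (A : Matrix (Fin q) (Fin q) ℂ) (C : Matrix (Fin 1) (Fin q) ℂ) :
    Matrix (Fin q) (Fin q) ℂ :=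
  matIntegral (Ioi 0) (integrandQ A C)

/-- The matrix `I + e^{-z𝒜} 𝒫 e^{-z𝒜}`. -/
def gammaMatrix {q : ℕ} (A : Matrix (Fin q) (Fin q) ℂ) (B : Matrix (Fin q) (Fin 1) ℂ)
    (C : Matrix (Fin 1) (Fin q) ℂ) (z : ℝ) : Matrix (Fin q ⊕ Fin q) (Fin q ⊕ Fin q) ℂ :=
  1 + expNeg (calA A) z * calP A B C * expNeg (calA A) z

/-! ### The Marchenko equation -/

/-- `L(z,y) + Ω(z+y) + ∫_z^∞ L(z,u) Ω(u+y) du = 0` at the points `z`, `y`, for `L(z,·) = ℓ`. -/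
def MarchenkoAt (Ω : ℝ → Matrix (Fin 2) (Fin 2) ℂ) (z : ℝ) (ℓ : ℝ → Matrix (Fin 2) (Fin 2) ℂ)
    (y : ℝ) : Prop :=
  ℓ y + Ω (z + y) + matIntegral (Ioi z) (fun u => ℓ u * Ω (u + y)) = 0

/-- The explicit kernel
`L(z,y) = -𝒞 e^{-z𝒜} [I + e^{-z𝒜} 𝒫 e^{-z𝒜}]⁻¹ e^{-y𝒜} ℬ`. -/
def kernelL {q : ℕ} (A : Matrix (Fin q) (Fin q) ℂ) (B : Matrix (Fin q) (Fin 1) ℂ)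
    (C : Matrix (Fin 1) (Fin q) ℂ) (z y : ℝ) : Matrix (Fin 2) (Fin 2) ℂ :=
  -(calC B C * expNeg (calA A) z * (gammaMatrix A B C z)⁻¹ * expNeg (calA A) y * calB B C)

/-- `L̃(z) = ∫_z^∞ L(z,y) dy`. -/
def tildeL {q : ℕ} (A : Matrix (Fin q) (Fin q) ℂ) (B : Matrix (Fin q) (Fin 1) ℂ)
    (C : Matrix (Fin 1) (Fin q) ℂ) (z : ℝ) : Matrix (Fin 2) (Fin 2) ℂ :=
  matIntegral (Ioi z) (kernelL A B C z)

/-- The time-evolved row `C(t) = C e^{-4itA²}`. -/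
def evolvedC {q : ℕ} (A : Matrix (Fin q) (Fin q) ℂ) (C : Matrix (Fin 1) (Fin q) ℂ) (t : ℝ) :
    Matrix (Fin 1) (Fin q) ℂ :=
  C * NormedSpace.exp ((-4 * Complex.I * (t : ℂ)) • A ^ 2)

/-! ### The Heisenberg ferromagnet equation -/

/-- `σ₃`. -/
def pauli3 : Matrix (Fin 2) (Fin 2) ℂ := !![1, 0; 0, -1]

/-- `m · σ = m₁ σ₁ + m₂ σ₂ + m₃ σ₃`. -/
def pauliDot (m : Fin 3 → ℝ) : Matrix (Fin 2) (Fin 2) ℂ :=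
  (m 0 : ℂ) • !![0, 1; 1, 0] + (m 1 : ℂ) • !![0, -Complex.I; Complex.I, 0] + (m 2 : ℂ) • pauli3

/-- `m` is a classical solution of `m_t = m ∧ m_zz` on `ℝ × ℝ`, of unit length, with
`m(z,t) → e₃` as `z → ±∞`. -/
structure IsHFSolution (m : ℝ → ℝ → Fin 3 → ℝ) : Prop where
  regular : ContDiff ℝ 2 (fun p : ℝ × ℝ => m p.1 p.2)
  unit : ∀ z t, m z t 0 ^ 2 + m z t 1 ^ 2 + m z t 2 ^ 2 = 1
  equation : ∀ z t, deriv (fun s => m z s) t =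
    crossProduct (m z t) (iteratedDeriv 2 (fun x => m x t) z)
  tendsto_atTop : ∀ t, Tendsto (fun z => m z t) atTop (𝓝 ![0, 0, 1])
  tendsto_atBot : ∀ t, Tendsto (fun z => m z t) atBot (𝓝 ![0, 0, 1])

/-- `e^{iκzσ₃}`. -/
def planeWave (κ z : ℝ) : Matrix (Fin 2) (Fin 2) ℂ :=
  Matrix.diagonal ![Complex.exp (Complex.I * κ * z), Complex.exp (-(Complex.I * κ * z))]

/-- `X` is the Jost matrix of the spectral problem `X_z = iκ (m·σ) X` at the end `l` of the real
line: `X = e^{iκzσ₃} [I + o(1)]` along `l` (`l = atTop` for `Ψ`, `l = atBot` for `Φ`). -/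
structure IsJostMatrix (m : ℝ → Fin 3 → ℝ) (κ : ℝ) (l : Filter ℝ)
    (X : ℝ → Matrix (Fin 2) (Fin 2) ℂ) : Prop where
  equation : ∀ z i j,
    HasDerivAt (fun x => X x i j) (Complex.I * κ * (pauliDot (m z) * X z) i j) z
  asymptotics : Tendsto (fun z => planeWave (-κ) z * X z) l (𝓝 1)

/-- `a` and `b` are the scattering coefficients of the potential `m`: the Jost matrices are related
by `Ψ(z,κ) = Φ(z,κ) (a(κ), -b(κ); b(κ)^*, a(κ)^*)` for all real `κ`. -/
def HasScatteringCoefficients (m : ℝ → Fin 3 → ℝ) (a b : ℝ → ℂ) : Prop :=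
  ∀ κ : ℝ, ∃ Ψ Φ : ℝ → Matrix (Fin 2) (Fin 2) ℂ,
    IsJostMatrix m κ atTop Ψ ∧ IsJostMatrix m κ atBot Φ ∧
    ∀ z, Ψ z = Φ z * !![a κ, -b κ; conj (b κ), conj (a κ)]

/-- `det(κI - iA) / det(κI + iA†)`. -/
def blaschke {q : ℕ} (A : Matrix (Fin q) (Fin q) ℂ) (κ : ℝ) : ℂ :=
  ((κ : ℂ) • 1 - Complex.I • A).det / ((κ : ℂ) • 1 + Complex.I • Aᴴ).det

end HeisenbergChain

end

open HeisenbergChain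

/-! The kernel separates, `Ω(u+y) = 𝒞e^{-u𝒜} · e^{-y𝒜}ℬ`, so the Marchenko equation is a finite
linear system for the single matrix `∫_z^∞ L(z,u) 𝒞e^{-u𝒜} du`, with coefficient matrix `I +
e^{-z𝒜}𝒫e^{-z𝒜}`. Its invertibility is a positivity statement. In a minimal triplet no nonzero
vector is unobservable (otherwise the quotient by such vectors would represent the same kernel in
lower order), so the Gram matrix `Q` is positive definite, and by duality so is `N`. A Schur
complement then has the form `1 + KH` with `K > 0` and `H ≥ 0`, which is invertible.

The Heisenberg equation is a matter of algebra. Moving the time factors out of `𝒞(t)`, `ℬ(t)`,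
`𝒫(t)` gives `I + L̃ = W₀`, where `W_κ = I - 𝒞R(𝒜+κS)⁻¹ℬ`, `R = (E+𝒫)⁻¹`, `S = diag(I,-I)`. Here `ℬ,
𝒞, 𝒫` are constant and `E = e^{2z𝒜}e^{4itS𝒜²}` carries all dependence on `z` and `t`. Since `S`
commutes with `𝒜` and `E` and anticommutes with `𝒫`, the Sylvester equation takes the form `ℬ𝒞 =
(𝒜+κS)(E+𝒫) - (E-𝒫)(𝒜+κS)` for every `κ` (`IsDressing.bc_eq`). It yields the inverse of `W_κ` and a
Lax pair: with `R' = (E-𝒫)⁻¹` and `V = 𝒞(R+R')ℬ`, one has `∂_z W_κ = V W_κ + κ[σ₃,W_κ]`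
(`lax_space`) and `∂_t W₀ = 4iT W₀` (`lax_time`), where `V` anticommutes with `σ₃` and `2[σ₃,T] =
-V_z` (`commutator_lax_time`).

For `M = W₀⁻¹σ₃W₀` this gives `[M,M_zz] = 4W₀⁻¹V_zW₀` and `M_t = 4iW₀⁻¹[σ₃,T]W₀ = -(i/2)[M,M_zz]`,
which is `m_t = m ∧ m_zz` in Pauli form. A symplectic symmetry makes `W₀` unitary
(`waveW_conjTranspose_mul`), so `M` is Hermitian, traceless and squares to one: `m` is real of unit
length.

For the scattering data, `W₀⁻¹W_{iλ}e^{iλzσ₃}` solves the spectral problem. As `z → +∞`, `R → 0` and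
`W_{iλ} → I`. As `z → -∞`, `E → 0` and `R → 𝒫⁻¹`; since `𝒫` is block antidiagonal the limit of
`W_{iλ}` is diagonal, whence `b = 0`, and a rank-one determinant formula (`one_sub_row_mul_col`)
evaluates its entries as `χ(λ)` and `χ(λ)^*`. -/

namespace HeisenbergChain

/-! ### Entrywise calculus of matrix functions -/

section Calculus

variable {l m n : Type*}

/-- The matrix function `F` has entrywise derivative `F'` at `x`. -/
def MatHasDerivAt (F : ℝ → Matrix m n ℂ) (F' : Matrix m n ℂ) (x : ℝ) : Prop :=
  ∀ i j, HasDerivAt (fun y => F y i j) (F' i j) x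

/-- Every entry of the matrix function `F` is smooth. -/
def MatSmooth {E : Type*} [NormedAddCommGroup E] [NormedSpace ℝ E] (F : E → Matrix m n ℂ) : Prop :=
  ∀ i j, ContDiff ℝ (⊤ : ℕ∞) (fun y => F y i j)

theorem MatHasDerivAt.const (M : Matrix m n ℂ) (x : ℝ) : MatHasDerivAt (fun _ => M) 0 x :=
  fun _ _ => hasDerivAt_const _ _

theorem MatHasDerivAt.add {F G : ℝ → Matrix m n ℂ} {F' G' : Matrix m n ℂ} {x : ℝ}
    (hF : MatHasDerivAt F F' x) (hG : MatHasDerivAt G G' x) :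
    MatHasDerivAt (fun y => F y + G y) (F' + G') x :=
  fun i j => (hF i j).add (hG i j)

theorem MatHasDerivAt.sub {F G : ℝ → Matrix m n ℂ} {F' G' : Matrix m n ℂ} {x : ℝ}
    (hF : MatHasDerivAt F F' x) (hG : MatHasDerivAt G G' x) :
    MatHasDerivAt (fun y => F y - G y) (F' - G') x :=
  fun i j => (hF i j).sub (hG i j)

theorem MatHasDerivAt.neg {F : ℝ → Matrix m n ℂ} {F' : Matrix m n ℂ} {x : ℝ}
    (hF : MatHasDerivAt F F' x) : MatHasDerivAt (fun y => -F y) (-F') x :=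
  fun i j => (hF i j).neg

theorem MatHasDerivAt.mul [Fintype m] {F : ℝ → Matrix l m ℂ} {G : ℝ → Matrix m n ℂ}
    {F' : Matrix l m ℂ} {G' : Matrix m n ℂ} {x : ℝ}
    (hF : MatHasDerivAt F F' x) (hG : MatHasDerivAt G G' x) :
    MatHasDerivAt (fun y => F y * G y) (F' * G x + F x * G') x := by
  intro i j
  have h : HasDerivAt (fun y => ∑ k, F y i k * G y k j)
      (∑ k, (F' i k * G x k j + F x i k * G' k j)) x :=
    HasDerivAt.fun_sum fun k _ => (hF i k).mul (hG k j)
  simpa only [Matrix.mul_apply, Matrix.add_apply, Finset.sum_add_distrib] using h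

theorem MatHasDerivAt.const_mul [Fintype m] (M : Matrix l m ℂ) {G : ℝ → Matrix m n ℂ}
    {G' : Matrix m n ℂ} {x : ℝ} (hG : MatHasDerivAt G G' x) :
    MatHasDerivAt (fun y => M * G y) (M * G') x := by
  simpa using (MatHasDerivAt.const M x).mul hG

theorem MatHasDerivAt.mul_const [Fintype m] {F : ℝ → Matrix l m ℂ} {F' : Matrix l m ℂ} {x : ℝ}
    (hF : MatHasDerivAt F F' x) (M : Matrix m n ℂ) :
    MatHasDerivAt (fun y => F y * M) (F' * M) x := by
  simpa using hF.mul (MatHasDerivAt.const M x)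

theorem MatHasDerivAt.unique {F : ℝ → Matrix m n ℂ} {F' F'' : Matrix m n ℂ} {x : ℝ}
    (h : MatHasDerivAt F F' x) (h' : MatHasDerivAt F F'' x) : F' = F'' :=
  Matrix.ext fun i j => (h i j).unique (h' i j)

theorem MatHasDerivAt.scomp {F : ℝ → Matrix m n ℂ} {F' : Matrix m n ℂ} {g : ℝ → ℝ} {g' x : ℝ}
    (hF : MatHasDerivAt F F' (g x)) (hg : HasDerivAt g g' x) :
    MatHasDerivAt (fun y => F (g y)) ((g' : ℂ) • F') x := by
  intro i j
  have h := HasDerivAt.scomp x (hF i j) hg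
  rw [Complex.real_smul] at h
  exact h

theorem MatHasDerivAt.congr_deriv {F : ℝ → Matrix m n ℂ} {F' F'' : Matrix m n ℂ} {x : ℝ}
    (h : MatHasDerivAt F F' x) (h' : F' = F'') : MatHasDerivAt F F'' x := h' ▸ h

variable {E : Type*} [NormedAddCommGroup E] [NormedSpace ℝ E]

theorem MatSmooth.const (M : Matrix m n ℂ) : MatSmooth (fun _ : E => M) :=
  fun _ _ => contDiff_const

theorem MatSmooth.add {F G : E → Matrix m n ℂ} (hF : MatSmooth F) (hG : MatSmooth G) :
    MatSmooth (fun y => F y + G y) :=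
  fun i j => (hF i j).add (hG i j)

theorem MatSmooth.sub {F G : E → Matrix m n ℂ} (hF : MatSmooth F) (hG : MatSmooth G) :
    MatSmooth (fun y => F y - G y) :=
  fun i j => (hF i j).sub (hG i j)

theorem MatSmooth.mul [Fintype m] {F : E → Matrix l m ℂ} {G : E → Matrix m n ℂ}
    (hF : MatSmooth F) (hG : MatSmooth G) : MatSmooth (fun y => F y * G y) := by
  intro i j
  simp only [Matrix.mul_apply]
  exact ContDiff.sum fun k _ => (hF i k).mul (hG k j)

theorem MatSmooth.comp {E' : Type*} [NormedAddCommGroup E'] [NormedSpace ℝ E']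
    {F : E → Matrix m n ℂ} (hF : MatSmooth F) {g : E' → E} (hg : ContDiff ℝ (⊤ : ℕ∞) g) :
    MatSmooth (fun y => F (g y)) :=
  fun i j => (hF i j).comp hg

theorem MatSmooth.det [Fintype n] [DecidableEq n] {F : E → Matrix n n ℂ} (hF : MatSmooth F) :
    ContDiff ℝ (⊤ : ℕ∞) (fun y => (F y).det) := by
  simp only [Matrix.det_apply]
  exact ContDiff.sum fun σ _ => (contDiff_prod fun i _ => hF _ i).const_smul _

/-- Cramer's rule: the inverse is the adjugate over the determinant, and an adjugate entry is the
determinant of the matrix with one row replaced by a constant one. -/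
theorem MatSmooth.inv [Fintype n] [DecidableEq n] {F : E → Matrix n n ℂ} (hF : MatSmooth F)
    (h : ∀ y, IsUnit (F y).det) : MatSmooth (fun y => (F y)⁻¹) := by
  intro i j
  have hadj : ContDiff ℝ (⊤ : ℕ∞) (fun y => (F y).adjugate i j) := by
    simp only [Matrix.adjugate_apply]
    apply MatSmooth.det
    intro k k'
    by_cases hk : k = j
    · subst hk
      simpa using contDiff_const
    · simpa [Matrix.updateRow_ne hk] using hF k k'
  have heq : (fun y => (F y)⁻¹ i j) = fun y => ((F y).det)⁻¹ * (F y).adjugate i j := by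
    funext y
    rw [Matrix.inv_def, Matrix.smul_apply, Ring.inverse_eq_inv', smul_eq_mul]
  rw [heq]
  exact (hF.det.inv fun y => (h y).ne_zero).mul hadj

theorem MatSmooth.hasDerivAt {F : ℝ → Matrix m n ℂ} (hF : MatSmooth F) (x : ℝ) :
    MatHasDerivAt F (Matrix.of fun i j => deriv (fun y => F y i j) x) x :=
  fun i j => ((hF i j).differentiable (by simp)).differentiableAt.hasDerivAt

/-- Smoothness supplies some derivative of the inverse; differentiating `F⁻¹F = 1` then identifies
it. -/
theorem MatHasDerivAt.inv [Fintype n] [DecidableEq n] {F : ℝ → Matrix n n ℂ} {F' : Matrix n n ℂ}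
    {x : ℝ} (hF : MatSmooth F) (hF' : MatHasDerivAt F F' x) (h : ∀ y, IsUnit (F y).det) :
    MatHasDerivAt (fun y => (F y)⁻¹) (-((F x)⁻¹ * F' * (F x)⁻¹)) x := by
  have hinv := (hF.inv h).hasDerivAt x
  set D := Matrix.of fun i j => deriv (fun y => (F y)⁻¹ i j) x
  have h1 := hinv.mul hF'
  have h2 : (fun y => (F y)⁻¹ * F y) = fun _ => 1 :=
    funext fun y => Matrix.nonsing_inv_mul _ (h y)
  rw [h2] at h1
  have h3 := h1.unique (MatHasDerivAt.const 1 x)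
  have h4 : D = -((F x)⁻¹ * F' * (F x)⁻¹) := by
    have := congrArg (· * (F x)⁻¹) h3
    simp only [add_mul, zero_mul, mul_assoc, Matrix.mul_nonsing_inv _ (h x), mul_one] at this
    rw [mul_assoc]
    exact eq_neg_of_add_eq_zero_left this
  exact h4 ▸ hinv

end Calculus

/-! ### The matrix exponential -/

section Exponential

variable {m n : Type*} [Fintype m] [DecidableEq m] [Fintype n] [DecidableEq n]

-- The entrywise power series needs a matrix norm only inside this proof. Later identities for
-- exponentials follow by comparing scalar series.
open scoped Matrix.Norms.Operator in
theorem hasSum_expNeg (A : Matrix n n ℂ) (w : ℝ) (i j : n) :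
    HasSum (fun k : ℕ => ((k.factorial : ℂ)⁻¹ * (-(w : ℂ)) ^ k) * (A ^ k) i j)
      (expNeg A w i j) := by
  have h := NormedSpace.exp_series_hasSum_exp' (𝕂 := ℂ) (-(w : ℂ) • A)
  let φ : Matrix n n ℂ →ₗ[ℂ] ℂ := Matrix.entryLinearMap ℂ ℂ i j
  have h1 := h.map φ φ.continuous_of_finiteDimensional
  have h2 : φ (NormedSpace.exp (-(w : ℂ) • A)) = expNeg A w i j := rfl
  have h3 : HasSum
      (fun k : ℕ => Matrix.entryLinearMap ℂ ℂ i j ((k.factorial : ℂ)⁻¹ • (-(w : ℂ) • A) ^ k))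
      (expNeg A w i j) := h1
  convert h3 using 2 with k
  rw [smul_pow, smul_smul]
  rfl

theorem expNeg_zero (A : Matrix n n ℂ) : expNeg A 0 = 1 := by
  simp [expNeg]

theorem expNeg_add (A : Matrix n n ℂ) (x y : ℝ) :
    expNeg A (x + y) = expNeg A x * expNeg A y := by
  unfold expNeg
  rw [← Matrix.exp_add_of_commute _ _ (((Commute.refl A).smul_left _).smul_right _), ← add_smul]
  push_cast
  congr 2
  ring

theorem expNeg_mul_neg (A : Matrix n n ℂ) (x : ℝ) : expNeg A x * expNeg A (-x) = 1 := by
  rw [← expNeg_add, add_neg_cancel, expNeg_zero]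

theorem expNeg_neg_mul (A : Matrix n n ℂ) (x : ℝ) : expNeg A (-x) * expNeg A x = 1 := by
  rw [← expNeg_add, neg_add_cancel, expNeg_zero]

/-- An intertwiner of two matrices intertwines their exponentials. -/
theorem intertwine_expNeg {A : Matrix n n ℂ} {A' : Matrix m m ℂ} {T : Matrix m n ℂ}
    (h : T * A = A' * T) (w : ℝ) : T * expNeg A w = expNeg A' w * T := by
  have hp : ∀ k : ℕ, T * A ^ k = A' ^ k * T := by
    intro k
    induction k with
    | zero => simp
    | succ k ih =>
      rw [pow_succ, ← Matrix.mul_assoc, ih, Matrix.mul_assoc, h, ← Matrix.mul_assoc, ← pow_succ]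
  ext i j
  have h1 : HasSum (fun k : ℕ => ((k.factorial : ℂ)⁻¹ * (-(w : ℂ)) ^ k) * (T * A ^ k) i j)
      ((T * expNeg A w) i j) := by
    simp only [Matrix.mul_apply, Finset.mul_sum]
    refine hasSum_sum fun l _ => ?_
    simpa only [mul_left_comm] using (hasSum_expNeg A w l j).mul_left (T i l)
  have h2 : HasSum (fun k : ℕ => ((k.factorial : ℂ)⁻¹ * (-(w : ℂ)) ^ k) * (A' ^ k * T) i j)
      ((expNeg A' w * T) i j) := by
    simp only [Matrix.mul_apply, Finset.mul_sum]
    refine hasSum_sum fun l _ => ?_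
    simpa only [mul_assoc] using (hasSum_expNeg A' w i l).mul_right (T l j)
  simp only [hp] at h1
  exact h1.unique h2

theorem commute_expNeg {A M : Matrix n n ℂ} (h : Commute M A) (w : ℝ) :
    Commute M (expNeg A w) := intertwine_expNeg h w

theorem expNeg_conjTranspose (A : Matrix n n ℂ) (w : ℝ) : expNeg Aᴴ w = (expNeg A w)ᴴ := by
  unfold expNeg
  rw [← Matrix.exp_conjTranspose, Matrix.conjTranspose_smul]
  simp

theorem expNeg_neg (A : Matrix n n ℂ) (w : ℝ) : expNeg (-A) w = expNeg A (-w) := by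
  simp [expNeg]

theorem expNeg_fromBlocks (A : Matrix m m ℂ) (D : Matrix n n ℂ) (w : ℝ) :
    expNeg (Matrix.fromBlocks A 0 0 D) w =
      Matrix.fromBlocks (expNeg A w) 0 0 (expNeg D w) := by
  have hp : ∀ k : ℕ, (Matrix.fromBlocks A 0 0 D) ^ k = Matrix.fromBlocks (A ^ k) 0 0 (D ^ k) := by
    intro k
    induction k with
    | zero => simp
    | succ k ih => simp [pow_succ, ih, Matrix.fromBlocks_multiply]
  ext i j
  have h := hasSum_expNeg (Matrix.fromBlocks A 0 0 D) w i j
  simp only [hp] at h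
  refine h.unique ?_
  rcases i with i | i <;> rcases j with j | j
  · exact hasSum_expNeg A w i j
  · simp
  · simp
  · exact hasSum_expNeg D w i j

open scoped Matrix.Norms.Operator in
theorem matHasDerivAt_expNeg (A : Matrix n n ℂ) (x : ℝ) :
    MatHasDerivAt (expNeg A) (-(A * expNeg A x)) x := by
  intro i j
  have h := (hasDerivAt_exp_smul_const' (𝕂 := ℝ) (-A) x)
  let φ : Matrix n n ℂ →ₗ[ℝ] ℂ := (Matrix.entryLinearMap ℂ ℂ i j).restrictScalars ℝ
  let φ' : Matrix n n ℂ →L[ℝ] ℂ := ⟨φ, φ.continuous_of_finiteDimensional⟩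
  have h1 := φ'.hasFDerivAt.comp_hasDerivAt x h
  have he : ∀ u : ℝ, u • -A = -(u : ℂ) • A := fun u => by ext; simp
  have h2 : φ' ∘ (fun u : ℝ => NormedSpace.exp (u • -A)) = fun u => expNeg A u i j := by
    funext u
    simp only [Function.comp, he]
    rfl
  have h3 : φ' (-A * NormedSpace.exp (x • -A)) = (-(A * expNeg A x)) i j := by
    rw [he, neg_mul]
    rfl
  exact (h1.congr_deriv h3).congr_of_eventuallyEq
    (Eventually.of_forall fun u => (congrFun h2 u).symm)

theorem matHasDerivAt_expNeg' (A : Matrix n n ℂ) (x : ℝ) :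
    MatHasDerivAt (expNeg A) (-(expNeg A x * A)) x := by
  rw [← (commute_expNeg (Commute.refl A) x).eq]
  exact matHasDerivAt_expNeg A x

/-- Bootstrapping on the equation `F' = -AF`: the derivative of each entry is a linear combination
of entries, so each order of differentiability gives the next. -/
theorem matSmooth_expNeg (A : Matrix n n ℂ) : MatSmooth (expNeg A) := by
  have h : ∀ k : ℕ, ∀ i j, ContDiff ℝ k (fun y => expNeg A y i j) := by
    intro k
    induction k with
    | zero =>
      intro i j
      exact contDiff_zero.2 (continuous_iff_continuousAt.2 fun x =>
        (matHasDerivAt_expNeg A x i j).continuousAt)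
    | succ k ih =>
      intro i j
      have hd : deriv (fun y => expNeg A y i j) = fun y => -∑ l, A i l * expNeg A y l j := by
        funext x
        rw [(matHasDerivAt_expNeg A x i j).deriv]
        simp [Matrix.mul_apply]
      push_cast
      rw [contDiff_succ_iff_deriv]
      refine ⟨fun x => (matHasDerivAt_expNeg A x i j).differentiableAt, by simp, ?_⟩
      rw [hd]
      exact (ContDiff.sum fun l _ => contDiff_const.mul (ih l j)).neg
  exact fun i j => contDiff_infty.2 fun k => h k i j

theorem continuous_expNeg (A : Matrix n n ℂ) : Continuous (expNeg A) :=
  continuous_pi fun i => continuous_pi fun j => (matSmooth_expNeg A i j).continuous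

end Exponential

/-! ### Exponential decay and integrals -/

section Decay

variable {l m n : Type*}

/-- `f` decays exponentially at `+∞`. -/
def ExpDecay (f : ℝ → ℂ) : Prop :=
  ∃ δ : ℝ, 0 < δ ∧ f =O[atTop] fun x => Real.exp (-δ * x)

theorem ExpDecay.zero : ExpDecay (fun _ => 0) := ⟨1, one_pos, Asymptotics.isBigO_zero _ _⟩

theorem exp_isBigO_exp {a b : ℝ} (h : b ≤ a) :
    (fun x : ℝ => Real.exp (-a * x)) =O[atTop] fun x => Real.exp (-b * x) := by
  refine Asymptotics.IsBigO.of_bound 1 ?_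
  filter_upwards [eventually_ge_atTop 0] with x hx
  rw [Real.norm_eq_abs, Real.norm_eq_abs, Real.abs_exp, Real.abs_exp, one_mul]
  exact Real.exp_le_exp.2 (by nlinarith)

theorem ExpDecay.add {f g : ℝ → ℂ} (hf : ExpDecay f) (hg : ExpDecay g) :
    ExpDecay (fun x => f x + g x) := by
  obtain ⟨a, ha, hf⟩ := hf
  obtain ⟨b, hb, hg⟩ := hg
  exact ⟨min a b, lt_min ha hb, (hf.trans (exp_isBigO_exp (min_le_left a b))).add
    (hg.trans (exp_isBigO_exp (min_le_right a b)))⟩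

theorem ExpDecay.sum {ι : Type*} (s : Finset ι) {f : ι → ℝ → ℂ} (hf : ∀ i ∈ s, ExpDecay (f i)) :
    ExpDecay (fun x => ∑ i ∈ s, f i x) := by
  classical
  induction s using Finset.induction_on with
  | empty => simpa using ExpDecay.zero
  | insert a s ha ih =>
    simp only [Finset.sum_insert ha]
    exact (hf a (Finset.mem_insert_self a s)).add
      (ih fun i hi => hf i (Finset.mem_insert_of_mem hi))

theorem ExpDecay.const_mul {f : ℝ → ℂ} (hf : ExpDecay f) (c : ℂ) : ExpDecay (fun x => c * f x) := by
  obtain ⟨a, ha, hf⟩ := hf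
  exact ⟨a, ha, hf.const_mul_left c⟩

theorem ExpDecay.mul_const {f : ℝ → ℂ} (hf : ExpDecay f) (c : ℂ) : ExpDecay (fun x => f x * c) := by
  simpa only [mul_comm] using hf.const_mul c

theorem ExpDecay.mul {f g : ℝ → ℂ} (hf : ExpDecay f) (hg : ExpDecay g) :
    ExpDecay (fun x => f x * g x) := by
  obtain ⟨a, ha, hf⟩ := hf
  obtain ⟨b, hb, hg⟩ := hg
  refine ⟨a + b, add_pos ha hb, ?_⟩
  have := hf.mul hg
  simpa only [← Real.exp_add, ← add_mul, ← neg_add] using this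

theorem ExpDecay.tendsto {f : ℝ → ℂ} (hf : ExpDecay f) : Tendsto f atTop (𝓝 0) := by
  obtain ⟨a, ha, hf⟩ := hf
  refine hf.trans_tendsto ?_
  refine Real.tendsto_exp_atBot.comp ?_
  exact tendsto_id.const_mul_atTop_of_neg (neg_neg_of_pos ha)

theorem ExpDecay.integrableOn {f : ℝ → ℂ} (hf : ExpDecay f) (hc : Continuous f) (z : ℝ) :
    IntegrableOn f (Ioi z) := by
  obtain ⟨a, ha, hf⟩ := hf
  have h := integrable_of_isBigO_exp_neg (a := z) ha (hc.norm.continuousOn) hf.norm_left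
  exact (integrable_norm_iff (hc.aestronglyMeasurable)).1 h

/-- Every entry of `F` decays exponentially at `+∞`. -/
def MatDecay (F : ℝ → Matrix m n ℂ) : Prop := ∀ i j, ExpDecay (fun x => F x i j)

theorem MatDecay.mul [Fintype m] {F : ℝ → Matrix l m ℂ} {G : ℝ → Matrix m n ℂ}
    (hF : MatDecay F) (hG : MatDecay G) : MatDecay (fun x => F x * G x) := by
  intro i j
  simp only [Matrix.mul_apply]
  exact ExpDecay.sum _ fun k _ => (hF i k).mul (hG k j)

theorem MatDecay.const_mul [Fintype m] (M : Matrix l m ℂ) {G : ℝ → Matrix m n ℂ}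
    (hG : MatDecay G) : MatDecay (fun x => M * G x) := by
  intro i j
  simp only [Matrix.mul_apply]
  exact ExpDecay.sum _ fun k _ => (hG k j).const_mul _

theorem MatDecay.mul_const [Fintype m] {F : ℝ → Matrix l m ℂ} (hF : MatDecay F)
    (M : Matrix m n ℂ) : MatDecay (fun x => F x * M) := by
  intro i j
  simp only [Matrix.mul_apply]
  exact ExpDecay.sum _ fun k _ => (hF i k).mul_const _

theorem MatDecay.add {F G : ℝ → Matrix m n ℂ} (hF : MatDecay F) (hG : MatDecay G) :
    MatDecay (fun x => F x + G x) :=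
  fun i j => (hF i j).add (hG i j)

theorem MatDecay.neg {F : ℝ → Matrix m n ℂ} (hF : MatDecay F) : MatDecay (fun x => -F x) := by
  intro i j
  simpa using (hF i j).const_mul (-1)

theorem MatDecay.tendsto {F : ℝ → Matrix m n ℂ} (hF : MatDecay F) : Tendsto F atTop (𝓝 0) :=
  tendsto_pi_nhds.2 fun i => tendsto_pi_nhds.2 fun j => (hF i j).tendsto

theorem MatDecay.entriesIntegrableOn {F : ℝ → Matrix m n ℂ} (hF : MatDecay F) (hc : Continuous F)
    (z : ℝ) : EntriesIntegrableOn F (Ioi z) :=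
  fun i j => (hF i j).integrableOn
    ((continuous_apply j).comp ((continuous_apply i).comp hc)) z

theorem MatDecay.fromBlocks {F : ℝ → Matrix l l ℂ} {G : ℝ → Matrix n n ℂ} (hF : MatDecay F)
    (hG : MatDecay G) : MatDecay (fun x => Matrix.fromBlocks (F x) 0 0 (G x)) := by
  rintro (i | i) (j | j)
  · exact hF i j
  · exact ExpDecay.zero
  · exact ExpDecay.zero
  · exact hG i j

theorem matIntegral_const_mul [Fintype m] {s : Set ℝ} (M : Matrix l m ℂ) {F : ℝ → Matrix m n ℂ}
    (hF : EntriesIntegrableOn F s) :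
    matIntegral s (fun x => M * F x) = M * matIntegral s F := by
  ext i j
  simp only [matIntegral, Matrix.of_apply, Matrix.mul_apply]
  rw [integral_finsetSum _ fun k _ => (hF k j).const_mul _]
  simp only [integral_const_mul]

theorem matIntegral_mul_const [Fintype m] {s : Set ℝ} {F : ℝ → Matrix l m ℂ}
    (hF : EntriesIntegrableOn F s) (M : Matrix m n ℂ) :
    matIntegral s (fun x => F x * M) = matIntegral s F * M := by
  ext i j
  simp only [matIntegral, Matrix.of_apply, Matrix.mul_apply]
  rw [integral_finsetSum _ fun k _ => (hF i k).mul_const _]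
  simp only [integral_mul_const]

theorem matIntegral_add {s : Set ℝ} {F G : ℝ → Matrix m n ℂ}
    (hF : EntriesIntegrableOn F s) (hG : EntriesIntegrableOn G s) :
    matIntegral s (fun x => F x + G x) = matIntegral s F + matIntegral s G := by
  ext i j
  exact integral_add (hF i j) (hG i j)

theorem matIntegral_Ioi_of_deriv {F F' : ℝ → Matrix m n ℂ} (hF : MatDecay F) (hF' : MatDecay F')
    (hd : ∀ x, MatHasDerivAt F (F' x) x) (hc : Continuous F') (z : ℝ) :
    matIntegral (Ioi z) F' = -F z := by
  ext i j
  have := integral_Ioi_of_hasDerivAt_of_tendsto' (fun x (_ : x ∈ Ici z) => hd x i j)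
    (hF'.entriesIntegrableOn hc z i j) (hF i j).tendsto
  simpa [matIntegral] using this

end Decay

/-! ### Decay of `e^{-xA}` and the Sylvester equation. -/

section ExpDecay

variable {m n : Type*} [Fintype m] [DecidableEq m] [Fintype n] [DecidableEq n]

theorem expNeg_add_smul_one (A : Matrix n n ℂ) (μ : ℂ) (x : ℝ) :
    expNeg (A + μ • 1) x = Complex.exp (-μ * x) • expNeg A x := by
  ext i j
  have hc : Commute (-(x : ℂ) • A) (-(x : ℂ) • μ • (1 : Matrix n n ℂ)) := by
    rw [smul_smul]
    exact (Commute.one_right _).smul_right _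
  have hd : NormedSpace.exp (-(x : ℂ) • μ • (1 : Matrix n n ℂ)) =
      Complex.exp (-μ * x) • (1 : Matrix n n ℂ) := by
    rw [smul_smul, Matrix.smul_one_eq_diagonal, Matrix.exp_diagonal,
      Matrix.smul_one_eq_diagonal]
    congr 1
    funext k
    rw [Pi.coe_exp, Complex.exp_eq_exp_ℂ]
    congr 1
    ring
  unfold expNeg
  rw [smul_add, Matrix.exp_add_of_commute _ _ hc, hd]
  simp

/-- A vector annihilated by a power of `B` sees only finitely many terms of the exponential. -/
theorem expNeg_mulVec_of_pow {B : Matrix n n ℂ} {k : ℕ} {v : n → ℂ} (h : B ^ k *ᵥ v = 0)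
    (x : ℝ) (i : n) :
    (expNeg B x *ᵥ v) i = ∑ s ∈ Finset.range k,
      ((s.factorial : ℂ)⁻¹ * (-(x : ℂ)) ^ s) * (B ^ s *ᵥ v) i := by
  have h1 : HasSum (fun s : ℕ => ((s.factorial : ℂ)⁻¹ * (-(x : ℂ)) ^ s) * (B ^ s *ᵥ v) i)
      ((expNeg B x *ᵥ v) i) := by
    simp only [Matrix.mulVec, dotProduct, Finset.mul_sum]
    refine hasSum_sum fun l _ => ?_
    simpa only [mul_assoc] using (hasSum_expNeg B x i l).mul_right (v l)
  refine h1.unique (hasSum_sum_of_ne_finset_zero fun s hs => ?_)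
  have hs' : k ≤ s := by simpa using hs
  have h0 : B ^ s *ᵥ v = 0 := by
    rw [← Nat.sub_add_cancel hs', pow_add, ← Matrix.mulVec_mulVec, h, Matrix.mulVec_zero]
  simp [h0]

theorem expDecay_pow_mul_exp (s : ℕ) {μ : ℂ} (hμ : 0 < μ.re) :
    ExpDecay (fun x => (x : ℂ) ^ s * Complex.exp (-μ * x)) := by
  refine ⟨μ.re / 2, half_pos hμ, ?_⟩
  have h1 := (isLittleO_pow_exp_pos_mul_atTop (k := s) (half_pos hμ)).isBigO
  have h2 := h1.mul (Asymptotics.isBigO_refl (fun x : ℝ => Real.exp (-μ.re * x)) atTop)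
  have h3 : (fun x : ℝ => Real.exp (μ.re / 2 * x) * Real.exp (-μ.re * x)) =
      fun x => Real.exp (-(μ.re / 2) * x) := by
    funext x
    rw [← Real.exp_add]
    congr 1
    ring
  rw [h3] at h2
  refine Asymptotics.IsBigO.trans (Asymptotics.isBigO_of_le _ fun x => ?_) h2
  simp [Complex.norm_exp]

/-- If the spectrum of `A` lies in the open right half-plane, then `e^{-xA}` decays. -/
theorem matDecay_expNeg {A : Matrix n n ℂ} (hA : ∀ μ ∈ spectrum ℂ A, 0 < μ.re) :
    MatDecay (expNeg A) := by
  -- The vectors with decaying orbit form a subspace, so it is enough to treat each generalized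
  -- eigenspace of `A`; these span the whole space.
  let S : Submodule ℂ (n → ℂ) :=
    { carrier := {v | ∀ i, ExpDecay (fun x => (expNeg A x *ᵥ v) i)}
      zero_mem' := fun i => by simpa using ExpDecay.zero
      add_mem' := fun {u v} hu hv i => by
        simpa [Matrix.mulVec_add] using (hu i).add (hv i)
      smul_mem' := fun c v hv i => by
        simpa [Matrix.mulVec_smul] using (hv i).const_mul c }
  have hS : S = ⊤ := by
    rw [eq_top_iff, ← Module.End.iSup_maxGenEigenspace_eq_top (Matrix.toLin' A)]
    refine iSup_le fun μ v hv i => ?_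
    obtain ⟨k, hk⟩ := Module.End.mem_maxGenEigenspace _ _ _ |>.1 hv
    have hk' : (A - μ • 1) ^ k *ᵥ v = 0 := by
      rw [← Matrix.toLin'_apply, Matrix.toLin'_pow, map_sub, map_smul, Matrix.toLin'_one]
      exact hk
    -- For an eigenvalue, `e^{-xA}v` is `e^{-μx}` times a polynomial in `x`; otherwise `A - μ` is
    -- invertible and the generalized eigenspace is zero.
    by_cases hμ : μ ∈ spectrum ℂ A
    · have hre := hA μ hμ
      have : (fun x => (expNeg A x *ᵥ v) i) = fun x : ℝ => ∑ s ∈ Finset.range k,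
          (((s.factorial : ℂ)⁻¹ * (-1) ^ s) * ((A - μ • 1) ^ s *ᵥ v) i) *
            ((x : ℂ) ^ s * Complex.exp (-μ * x)) := by
        funext x
        conv_lhs => rw [← sub_add_cancel A (μ • 1), expNeg_add_smul_one]
        rw [Matrix.smul_mulVec, Pi.smul_apply, expNeg_mulVec_of_pow hk', smul_eq_mul,
          Finset.mul_sum]
        refine Finset.sum_congr rfl fun s _ => ?_
        rw [neg_pow]
        ring
      rw [this]
      exact ExpDecay.sum _ fun s _ => (expDecay_pow_mul_exp s hre).const_mul _
    · rw [spectrum.notMem_iff, Algebra.algebraMap_eq_smul_one] at hμ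
      have hu : IsUnit ((A - μ • 1) ^ k) := by
        rw [← neg_sub]
        exact hμ.neg.pow k
      have hv0 : v = 0 := by
        have h := congrArg (fun u => ((A - μ • 1) ^ k)⁻¹ *ᵥ u) hk'
        simpa [Matrix.mulVec_mulVec, Matrix.nonsing_inv_mul _
          ((Matrix.isUnit_iff_isUnit_det _).1 hu)] using h
      simpa [hv0] using ExpDecay.zero
  intro i j
  have : Pi.single j 1 ∈ S := hS ▸ Submodule.mem_top
  simpa using this i

variable {A : Matrix m m ℂ} {D : Matrix n n ℂ}

theorem continuous_sandwich (A : Matrix m m ℂ) (M : Matrix m n ℂ) (D : Matrix n n ℂ) :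
    Continuous (fun x => expNeg A x * M * expNeg D x) :=
  ((continuous_expNeg A).matrix_mul continuous_const).matrix_mul (continuous_expNeg D)

theorem matDecay_sandwich (hA : MatDecay (expNeg A)) (hD : MatDecay (expNeg D))
    (M : Matrix m n ℂ) : MatDecay (fun x => expNeg A x * M * expNeg D x) :=
  (hA.mul_const M).mul hD

theorem matHasDerivAt_sandwich (A : Matrix m m ℂ) (M : Matrix m n ℂ) (D : Matrix n n ℂ) (x : ℝ) :
    MatHasDerivAt (fun x => expNeg A x * M * expNeg D x)
      (-(expNeg A x * (A * M + M * D) * expNeg D x)) x := by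
  refine (((matHasDerivAt_expNeg' A x).mul_const M).mul
    (matHasDerivAt_expNeg D x)).congr_deriv ?_
  simp only [Matrix.mul_add, Matrix.add_mul, Matrix.neg_mul, Matrix.mul_neg, Matrix.mul_assoc,
    neg_add]

/-- The tail integrals of `e^{-xA} M e^{-xD}` in terms of a solution of the Sylvester equation. -/
theorem matIntegral_sandwich (hA : MatDecay (expNeg A)) (hD : MatDecay (expNeg D))
    {M X : Matrix m n ℂ} (h : A * X + X * D = M) (z : ℝ) :
    matIntegral (Ioi z) (fun x => expNeg A x * M * expNeg D x) =
      expNeg A z * X * expNeg D z := by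
  have := matIntegral_Ioi_of_deriv (F := fun x => -(expNeg A x * X * expNeg D x))
    (F' := fun x => expNeg A x * M * expNeg D x)
    (matDecay_sandwich hA hD X).neg (matDecay_sandwich hA hD M)
    (fun x => ((matHasDerivAt_sandwich A X D x).neg).congr_deriv (by rw [neg_neg, h]))
    (continuous_sandwich A M D) z
  simpa using this

/-- Both directions integrate the derivative of `e^{-xA}Ye^{-xD}` over the half-line, where decay
removes the boundary term at infinity: `Y = X` gives uniqueness, `Y = M` gives existence. -/
theorem sylvester_iff (hA : MatDecay (expNeg A)) (hD : MatDecay (expNeg D)) (M X : Matrix m n ℂ) :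
    A * X + X * D = M ↔ X = matIntegral (Ioi 0) (fun x => expNeg A x * M * expNeg D x) := by
  constructor
  · intro h
    rw [matIntegral_sandwich hA hD h 0, expNeg_zero, expNeg_zero, Matrix.one_mul, Matrix.mul_one]
  · rintro rfl
    have hi := (matDecay_sandwich hA hD M).entriesIntegrableOn (continuous_sandwich A M D) 0
    have hl : EntriesIntegrableOn (fun x => A * (expNeg A x * M * expNeg D x)) (Ioi 0) :=
      ((matDecay_sandwich hA hD M).const_mul A).entriesIntegrableOn
        (continuous_const.matrix_mul (continuous_sandwich A M D)) 0
    have hr : EntriesIntegrableOn (fun x => expNeg A x * M * expNeg D x * D) (Ioi 0) :=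
      ((matDecay_sandwich hA hD M).mul_const D).entriesIntegrableOn
        ((continuous_sandwich A M D).matrix_mul continuous_const) 0
    rw [← matIntegral_const_mul A hi, ← matIntegral_mul_const hi D, ← matIntegral_add hl hr]
    have := matIntegral_Ioi_of_deriv (F := fun x => -(expNeg A x * M * expNeg D x))
      (F' := fun x => A * (expNeg A x * M * expNeg D x) + expNeg A x * M * expNeg D x * D)
      (matDecay_sandwich hA hD M).neg
      (((matDecay_sandwich hA hD M).const_mul A).add ((matDecay_sandwich hA hD M).mul_const D))
      (fun x => ((matHasDerivAt_sandwich A M D x).neg).congr_deriv ?_)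
      ((continuous_const.matrix_mul (continuous_sandwich A M D)).add
        ((continuous_sandwich A M D).matrix_mul continuous_const)) 0
    · rw [this, expNeg_zero, expNeg_zero, Matrix.one_mul, Matrix.mul_one, neg_neg]
    · have h1 := (commute_expNeg (Commute.refl A) x).eq
      have h2 := (commute_expNeg (Commute.refl D) x).eq
      rw [neg_neg, Matrix.mul_add, Matrix.add_mul]
      congr 1
      · simp only [← Matrix.mul_assoc, h1]
      · simp only [Matrix.mul_assoc, h2]

theorem matIntegral_expNeg (hA : MatDecay (expNeg A)) (hdet : IsUnit A.det) (z : ℝ) :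
    matIntegral (Ioi z) (expNeg A) = expNeg A z * A⁻¹ := by
  have := matIntegral_Ioi_of_deriv (F := fun x => -(expNeg A x * A⁻¹)) (F' := expNeg A)
    (hA.mul_const _).neg hA (fun x => (((matHasDerivAt_expNeg' A x).mul_const A⁻¹).neg).congr_deriv
      (by rw [Matrix.neg_mul, neg_neg, Matrix.mul_assoc, Matrix.mul_nonsing_inv _ hdet,
        Matrix.mul_one])) (continuous_expNeg A) z
  simpa using this

theorem isUnit_add_smul_of_spectrum (hA : ∀ μ ∈ spectrum ℂ A, 0 < μ.re) {ν : ℂ} (hν : 0 ≤ ν.re) :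
    IsUnit (A + ν • 1).det := by
  rw [← Matrix.isUnit_iff_isUnit_det]
  by_contra h
  have : -ν ∈ spectrum ℂ A := by
    rw [spectrum.mem_iff, Algebra.algebraMap_eq_smul_one, neg_smul, ← neg_add', IsUnit.neg_iff,
      add_comm]
    exact h
  have := hA _ this
  simp at this
  linarith

end ExpDecay

/-! ### Realizations and minimality -/

section Realization

variable {q r : ℕ} {A : Matrix (Fin q) (Fin q) ℂ} {B : Matrix (Fin q) (Fin 1) ℂ}
  {C : Matrix (Fin 1) (Fin q) ℂ}

/-- `T` need not be square or invertible, which permits passing to a quotient of the state space. -/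
theorem scalarKernel_of_intertwine {A' : Matrix (Fin r) (Fin r) ℂ} {C' : Matrix (Fin 1) (Fin r) ℂ}
    {T : Matrix (Fin r) (Fin q) ℂ} (hA : T * A = A' * T) (hC : C' * T = C) (w : ℝ) :
    scalarKernel A' (T * B) C' w = scalarKernel A B C w := by
  unfold scalarKernel
  rw [← hC, Matrix.mul_assoc C' T, intertwine_expNeg hA w]
  simp only [Matrix.mul_assoc]

/-- If `Y` inverts `μ - A`, then `TYS` is a right inverse of `μ - A'`, so the spectrum of `A'` lies
in that of `A`. -/
theorem eigenvaluesInRightHalfPlane_of_intertwine {A' : Matrix (Fin r) (Fin r) ℂ}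
    {T : Matrix (Fin r) (Fin q) ℂ} {S : Matrix (Fin q) (Fin r) ℂ} (hA : T * A = A' * T)
    (hTS : T * S = 1) (h : EigenvaluesInRightHalfPlane A) : EigenvaluesInRightHalfPlane A' := by
  intro μ hμ
  refine h μ ?_
  contrapose! hμ
  rw [spectrum.notMem_iff] at hμ ⊢
  obtain ⟨Y, hY⟩ := hμ.exists_right_inv
  have hint : (algebraMap ℂ (Matrix (Fin r) (Fin r) ℂ) μ - A') * T =
      T * (algebraMap ℂ (Matrix (Fin q) (Fin q) ℂ) μ - A) := by
    rw [Matrix.sub_mul, Matrix.mul_sub, hA, Algebra.algebraMap_eq_smul_one,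
      Algebra.algebraMap_eq_smul_one]
    simp
  rw [Matrix.isUnit_iff_isUnit_det]
  refine Matrix.isUnit_det_of_right_inverse (B := T * Y * S) ?_
  rw [← Matrix.mul_assoc, ← Matrix.mul_assoc, hint, Matrix.mul_assoc T, hY, Matrix.mul_one, hTS]

theorem conj_scalarKernel (A : Matrix (Fin q) (Fin q) ℂ) (B : Matrix (Fin q) (Fin 1) ℂ)
    (C : Matrix (Fin 1) (Fin q) ℂ) (w : ℝ) :
    conj (scalarKernel A B C w) = scalarKernel Aᴴ Cᴴ Bᴴ w := by
  unfold scalarKernel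
  rw [expNeg_conjTranspose, Matrix.mul_assoc, ← Matrix.conjTranspose_mul,
    ← Matrix.conjTranspose_mul, Matrix.conjTranspose_apply]
  rfl

theorem EigenvaluesInRightHalfPlane.conjTranspose (h : EigenvaluesInRightHalfPlane A) :
    EigenvaluesInRightHalfPlane Aᴴ := by
  intro μ hμ
  have : star μ ∈ spectrum ℂ A := by
    rw [spectrum.mem_iff] at hμ ⊢
    contrapose! hμ
    have := hμ.star
    rw [star_sub, ← algebraMap_star_comm, star_star] at this
    exact this
  simpa using h _ this

/-- Taking adjoints conjugates the kernel and preserves the order, so competitors of the adjoint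
triplet are adjoints of competitors. This duality transfers statements about `Q` to `N`. -/
theorem IsMinimalTriplet.conjTranspose (h : IsMinimalTriplet A B C) :
    IsMinimalTriplet Aᴴ Cᴴ Bᴴ := by
  refine ⟨h.eigenvalues.conjTranspose, fun r A' B' C' hA' hk => ?_⟩
  refine h.minimal r A'ᴴ C'ᴴ B'ᴴ hA'.conjTranspose fun w => ?_
  rw [← conj_scalarKernel, hk w, conj_scalarKernel]
  simp

theorem IsMinimalTriplet.matDecay (h : IsMinimalTriplet A B C) : MatDecay (expNeg A) :=
  matDecay_expNeg h.eigenvalues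

/-- The vectors `v` that are not observed by the output `C e^{-xA} v`, `x > 0`. -/
def unobservable (A : Matrix (Fin q) (Fin q) ℂ) (C : Matrix (Fin 1) (Fin q) ℂ) :
    Submodule ℂ (Fin q → ℂ) where
  carrier := {v | ∀ x : ℝ, 0 < x → (C * expNeg A x) *ᵥ v = 0}
  zero_mem' := fun x _ => Matrix.mulVec_zero _
  add_mem' := fun {u v} hu hv x hx => by rw [Matrix.mulVec_add, hu x hx, hv x hx, add_zero]
  smul_mem' := fun c v hv x hx => by rw [Matrix.mulVec_smul, hv x hx, smul_zero]

/-- The output `Ce^{-xA}v` vanishes on the open half-line, hence so does its derivative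
`-Ce^{-xA}Av`. -/
theorem mulVec_mem_unobservable {v : Fin q → ℂ} (hv : v ∈ unobservable A C) :
    A *ᵥ v ∈ unobservable A C := by
  intro x hx
  have h1 : MatHasDerivAt (fun x => C * expNeg A x * Matrix.replicateCol (Fin 1) v)
      (C * (-(expNeg A x * A)) * Matrix.replicateCol (Fin 1) v) x :=
    ((matHasDerivAt_expNeg' A x).const_mul C).mul_const _
  funext i
  have h2 : HasDerivAt (fun x => (C * expNeg A x * Matrix.replicateCol (Fin 1) v) i 0) 0 x := by
    refine (hasDerivAt_const x (0 : ℂ)).congr_of_eventuallyEq ?_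
    filter_upwards [lt_mem_nhds hx] with y hy
    exact congrFun (hv y hy) i
  have h3 := (h1 i 0).unique h2
  rw [Matrix.mul_neg, Matrix.neg_mul, Matrix.neg_apply, neg_eq_zero, ← Matrix.mul_assoc] at h3
  rw [Matrix.mulVec_mulVec]
  exact h3

theorem mulVec_eq_zero_of_mem_unobservable {v : Fin q → ℂ} (hv : v ∈ unobservable A C) :
    C *ᵥ v = 0 := by
  have hc : Continuous fun x => (C * expNeg A x) *ᵥ v :=
    (continuous_const.matrix_mul (continuous_expNeg A)).matrix_mulVec continuous_const
  have h1 : Tendsto (fun x => (C * expNeg A x) *ᵥ v) (𝓝[>] 0) (𝓝 (C *ᵥ v)) := by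
    have := (hc.tendsto 0).mono_left (nhdsWithin_le_nhds (s := Ioi (0 : ℝ)))
    simpa [expNeg_zero] using this
  refine tendsto_nhds_unique h1 (tendsto_const_nhds.congr' ?_)
  filter_upwards [self_mem_nhdsWithin] with x hx
  exact (hv x hx).symm

/-- The unobservable subspace `K` is invariant under `A` and killed by `C`, so the triplet descends
to `ℂ^q / K` with the same kernel. Minimality then forces `dim K = 0`. -/
theorem IsMinimalTriplet.unobservable_eq_bot (h : IsMinimalTriplet A B C) :
    unobservable A C = ⊥ := by
  set K := unobservable A C
  have hK : K ≤ K.comap (Matrix.toLin' A) := fun v hv => mulVec_mem_unobservable hv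
  have hC : K ≤ LinearMap.ker (Matrix.toLin' C) := fun v hv =>
    mulVec_eq_zero_of_mem_unobservable hv
  let b := Module.finBasis ℂ ((Fin q → ℂ) ⧸ K)
  let e := Pi.basisFun ℂ (Fin q)
  let e₁ := Pi.basisFun ℂ (Fin 1)
  -- A linear section of the quotient map; its matrix is the right inverse of `T` that carries the
  -- spectral condition over to the quotient.
  obtain ⟨s, hs⟩ := LinearMap.exists_rightInverse_of_surjective K.mkQ K.range_mkQ
  let T := LinearMap.toMatrix e b K.mkQ
  let A' := LinearMap.toMatrix b b (K.mapQ K (Matrix.toLin' A) hK)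
  let C' := LinearMap.toMatrix b e₁ (K.liftQ (Matrix.toLin' C) hC)
  have hA : LinearMap.toMatrix e e (Matrix.toLin' A) = A := by
    rw [LinearMap.toMatrix_eq_toMatrix', LinearMap.toMatrix'_toLin']
  have hC1 : LinearMap.toMatrix e e₁ (Matrix.toLin' C) = C := by
    exact LinearMap.toMatrix'_toLin' C
  have hTA : T * A = A' * T := by
    conv_lhs => rw [← hA]
    rw [← LinearMap.toMatrix_comp, ← LinearMap.toMatrix_comp]
    congr 1
  have hCT : C' * T = C := by
    conv_rhs => rw [← hC1]
    rw [← LinearMap.toMatrix_comp, Submodule.liftQ_mkQ]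
  have hTS : T * LinearMap.toMatrix b e s = 1 := by
    rw [← LinearMap.toMatrix_comp, hs, LinearMap.toMatrix_id]
  have hle := h.minimal _ A' (T * B) C'
    (eigenvaluesInRightHalfPlane_of_intertwine hTA hTS h.eigenvalues)
    (scalarKernel_of_intertwine hTA hCT)
  have hfin := K.finrank_quotient_add_finrank
  rw [Module.finrank_fin_fun] at hfin
  exact Submodule.finrank_eq_zero.1 (by omega)

theorem continuous_integrandQ (A : Matrix (Fin q) (Fin q) ℂ) (C : Matrix (Fin 1) (Fin q) ℂ) :
    Continuous (integrandQ A C) :=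
  (((continuous_expNeg Aᴴ).matrix_mul continuous_const).matrix_mul continuous_const).matrix_mul
    (continuous_expNeg A)

theorem matDecay_integrandQ (hA : EigenvaluesInRightHalfPlane A) (C : Matrix (Fin 1) (Fin q) ℂ) :
    MatDecay (integrandQ A C) :=
  (((matDecay_expNeg hA.conjTranspose).mul_const _).mul_const _).mul (matDecay_expNeg hA)

theorem integrandN_eq (A : Matrix (Fin q) (Fin q) ℂ) (B : Matrix (Fin q) (Fin 1) ℂ) :
    integrandN A B = integrandQ Aᴴ Bᴴ := by
  funext x
  simp [integrandN, integrandQ]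

theorem gramN_eq (A : Matrix (Fin q) (Fin q) ℂ) (B : Matrix (Fin q) (Fin 1) ℂ) :
    gramN A B = gramQ Aᴴ Bᴴ := by
  rw [gramN, gramQ, integrandN_eq]

theorem gramQ_isHermitian (A : Matrix (Fin q) (Fin q) ℂ) (C : Matrix (Fin 1) (Fin q) ℂ) :
    (gramQ A C).IsHermitian := by
  ext i j
  simp only [gramQ, matIntegral, Matrix.conjTranspose_apply, Matrix.of_apply]
  have : ∀ x, (starRingEnd ℂ) (integrandQ A C x j i) = integrandQ A C x i j := by
    intro x
    have h : (integrandQ A C x)ᴴ = integrandQ A C x := by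
      simp only [integrandQ, Matrix.conjTranspose_mul, ← expNeg_conjTranspose,
        Matrix.conjTranspose_conjTranspose, Matrix.mul_assoc]
    exact congrFun (congrFun h i) j
  rw [← starRingEnd_apply, ← integral_conj]
  simp only [this]

/-- The quadratic form is an observed energy, `v†Qv = ∫₀^∞ ‖Ce^{-xA}v‖² dx`; it vanishes only on
unobservable vectors. -/
theorem IsMinimalTriplet.posDef_gramQ (h : IsMinimalTriplet A B C) : (gramQ A C).PosDef := by
  refine Matrix.PosDef.of_dotProduct_mulVec_pos (gramQ_isHermitian A C) fun v hv => ?_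
  set g : ℝ → ℂ := fun x => ((C * expNeg A x) *ᵥ v) 0 with hg
  have hgc : Continuous g := (continuous_apply 0).comp
    ((continuous_const.matrix_mul (continuous_expNeg A)).matrix_mulVec continuous_const)
  have hgd : ExpDecay g := ((h.matDecay.const_mul C).mul_const (Matrix.replicateCol (Fin 1) v)) 0 0
  have hi := (matDecay_integrandQ h.eigenvalues C).entriesIntegrableOn (continuous_integrandQ A C) 0
  have hpt : ∀ x, (Matrix.replicateRow (Fin 1) (star v) *
      (integrandQ A C x * Matrix.replicateCol (Fin 1) v)) 0 0 = ((‖g x‖ ^ 2 : ℝ) : ℂ) := by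
    intro x
    have h1 : Matrix.replicateRow (Fin 1) (star v) *
        (integrandQ A C x * Matrix.replicateCol (Fin 1) v) =
        (C * expNeg A x * Matrix.replicateCol (Fin 1) v)ᴴ *
          (C * expNeg A x * Matrix.replicateCol (Fin 1) v) := by
      simp only [integrandQ, Matrix.conjTranspose_mul, ← expNeg_conjTranspose,
        Matrix.conjTranspose_replicateCol, Matrix.mul_assoc]
    have h2 : (C * expNeg A x * Matrix.replicateCol (Fin 1) v) 0 0 = g x := rfl
    rw [h1, Matrix.mul_apply, Fin.sum_univ_one, Matrix.conjTranspose_apply, h2]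
    rw [← starRingEnd_apply, mul_comm, Complex.mul_conj, Complex.normSq_eq_norm_sq]
  have hint : star v ⬝ᵥ (gramQ A C *ᵥ v) = ((∫ x in Ioi (0 : ℝ), ‖g x‖ ^ 2 : ℝ) : ℂ) := by
    have h1 : star v ⬝ᵥ (gramQ A C *ᵥ v) = (Matrix.replicateRow (Fin 1) (star v) *
        (gramQ A C * Matrix.replicateCol (Fin 1) v)) 0 0 := rfl
    have hi' : EntriesIntegrableOn
        (fun x => integrandQ A C x * Matrix.replicateCol (Fin 1) v) (Ioi 0) :=
      ((matDecay_integrandQ h.eigenvalues C).mul_const _).entriesIntegrableOn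
        ((continuous_integrandQ A C).matrix_mul continuous_const) 0
    rw [h1, gramQ, ← matIntegral_mul_const hi, ← matIntegral_const_mul _ hi', matIntegral,
      Matrix.of_apply, ← integral_complex_ofReal]
    simp only [hpt]
  rw [hint]
  have hsq : Integrable (fun x => ‖g x‖ ^ 2) (volume.restrict (Ioi 0)) := by
    have h1 := ((hgd.mul hgd).integrableOn (hgc.mul hgc) 0).norm
    refine h1.congr (Eventually.of_forall fun x => ?_)
    simp [sq]
  rw [Complex.zero_lt_real]
  refine lt_of_le_of_ne (integral_nonneg fun x => by positivity) fun h0 => hv ?_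
  have hae := (integral_eq_zero_iff_of_nonneg (fun x => by positivity) hsq).1 h0.symm
  -- Continuity upgrades almost everywhere vanishing to vanishing at every `x > 0`.
  have heq := Measure.eqOn_open_of_ae_eq (f := fun x => ‖g x‖ ^ 2) (g := fun _ => (0 : ℝ)) hae
    isOpen_Ioi (hgc.norm.pow 2).continuousOn continuousOn_const
  have hmem : v ∈ unobservable A C := by
    intro x hx
    have : ‖g x‖ ^ 2 = 0 := heq hx
    funext i
    rw [Subsingleton.elim i 0]
    simpa using this
  rw [h.unobservable_eq_bot] at hmem
  simpa using hmem

theorem IsMinimalTriplet.posDef_gramN (h : IsMinimalTriplet A B C) : (gramN A B).PosDef := by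
  rw [gramN_eq]
  exact h.conjTranspose.posDef_gramQ

end Realization

/-! ### The doubled matrices -/

section Doubled

variable {q : ℕ} {A : Matrix (Fin q) (Fin q) ℂ} {B : Matrix (Fin q) (Fin 1) ℂ}
  {C : Matrix (Fin 1) (Fin q) ℂ}

theorem expNeg_calA (A : Matrix (Fin q) (Fin q) ℂ) (w : ℝ) :
    expNeg (calA A) w = Matrix.fromBlocks (expNeg A w) 0 0 (expNeg Aᴴ w) :=
  expNeg_fromBlocks _ _ _

theorem matDecay_expNeg_calA (h : EigenvaluesInRightHalfPlane A) : MatDecay (expNeg (calA A)) := by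
  have := (matDecay_expNeg h).fromBlocks (matDecay_expNeg h.conjTranspose)
  simpa only [← expNeg_calA] using this

theorem calB_mul_calC (B : Matrix (Fin q) (Fin 1) ℂ) (C : Matrix (Fin 1) (Fin q) ℂ) :
    calB B C * calC B C = Matrix.fromBlocks 0 (B * Bᴴ) (-(Cᴴ * C)) 0 := by
  ext i j
  rcases i with i | i <;> rcases j with j | j <;>
    simp [calB, calC, Matrix.mul_apply, Fin.sum_univ_two]

/-- A block diagonal matrix between `𝒞` and `ℬ`. -/
theorem calC_mul_fromBlocks_mul_calB (B B' : Matrix (Fin q) (Fin 1) ℂ)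
    (C C' : Matrix (Fin 1) (Fin q) ℂ) (M M' : Matrix (Fin q) (Fin q) ℂ) :
    calC B C * Matrix.fromBlocks M 0 0 M' * calB B' C' =
      !![0, (C * M * B') 0 0; -(Bᴴ * M' * C'ᴴ) 0 0, 0] := by
  ext i j
  fin_cases i <;> fin_cases j <;>
    simp [calB, calC, Matrix.mul_apply, Fintype.sum_sum_type, Matrix.vecMul, dotProduct]

/-- A block antidiagonal matrix between `𝒞` and `ℬ`. -/
theorem calC_mul_fromBlocks_mul_calB' (B B' : Matrix (Fin q) (Fin 1) ℂ)
    (C C' : Matrix (Fin 1) (Fin q) ℂ) (M M' : Matrix (Fin q) (Fin q) ℂ) :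
    calC B C * Matrix.fromBlocks 0 M M' 0 * calB B' C' =
      !![-(C * M * C'ᴴ) 0 0, 0; 0, (Bᴴ * M' * B') 0 0] := by
  ext i j
  fin_cases i <;> fin_cases j <;>
    simp [calB, calC, Matrix.mul_apply, Fintype.sum_sum_type, Matrix.vecMul, dotProduct]

theorem matrixKernel_eq (A : Matrix (Fin q) (Fin q) ℂ) (B : Matrix (Fin q) (Fin 1) ℂ)
    (C : Matrix (Fin 1) (Fin q) ℂ) (w : ℝ) :
    matrixKernel (scalarKernel A B C) w = calC B C * expNeg (calA A) w * calB B C := by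
  rw [expNeg_calA, calC_mul_fromBlocks_mul_calB, matrixKernel, conj_scalarKernel]
  rfl

theorem integrandP_eq (A : Matrix (Fin q) (Fin q) ℂ) (B : Matrix (Fin q) (Fin 1) ℂ)
    (C : Matrix (Fin 1) (Fin q) ℂ) (x : ℝ) :
    integrandP A B C x = Matrix.fromBlocks 0 (integrandN A B x) (-integrandQ A C x) 0 := by
  simp only [integrandP, Matrix.mul_assoc, calB_mul_calC, expNeg_calA,
    Matrix.fromBlocks_multiply, integrandN, integrandQ]
  simp [Matrix.mul_assoc]

theorem calP_eq (A : Matrix (Fin q) (Fin q) ℂ) (B : Matrix (Fin q) (Fin 1) ℂ)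
    (C : Matrix (Fin 1) (Fin q) ℂ) :
    calP A B C = Matrix.fromBlocks 0 (gramN A B) (-gramQ A C) 0 := by
  ext i j
  rcases i with i | i <;> rcases j with j | j <;>
    simp [calP, matIntegral, integrandP_eq, gramN, gramQ, integral_neg]

theorem sylvester_calP (h : EigenvaluesInRightHalfPlane A) (B : Matrix (Fin q) (Fin 1) ℂ)
    (C : Matrix (Fin 1) (Fin q) ℂ) (X : Matrix (Fin q ⊕ Fin q) (Fin q ⊕ Fin q) ℂ) :
    calA A * X + X * calA A = calB B C * calC B C ↔ X = calP A B C := by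
  rw [sylvester_iff (matDecay_expNeg_calA h) (matDecay_expNeg_calA h)]
  have h1 : integrandP A B C =
      fun x => expNeg (calA A) x * (calB B C * calC B C) * expNeg (calA A) x := by
    funext x
    simp only [integrandP, Matrix.mul_assoc]
  rw [calP, h1]

theorem calP_mul_inverse (hN : IsUnit (gramN A B).det) (hQ : IsUnit (gramQ A C).det) :
    calP A B C * Matrix.fromBlocks 0 (-(gramQ A C)⁻¹) (gramN A B)⁻¹ 0 = 1 := by
  rw [calP_eq, Matrix.fromBlocks_multiply]
  simp [Matrix.mul_nonsing_inv _ hN, Matrix.mul_nonsing_inv _ hQ]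

theorem _root_.Matrix.PosDef.isUnit_det' {n : Type*} [Fintype n] [DecidableEq n]
    {M : Matrix n n ℂ} (h : M.PosDef) : IsUnit M.det :=
  (Matrix.isUnit_iff_isUnit_det _).1 h.isUnit

theorem IsMinimalTriplet.calP_inv (h : IsMinimalTriplet A B C) :
    (calP A B C)⁻¹ = Matrix.fromBlocks 0 (-(gramQ A C)⁻¹) (gramN A B)⁻¹ 0 :=
  Matrix.inv_eq_right_inv (calP_mul_inverse h.posDef_gramN.isUnit_det' h.posDef_gramQ.isUnit_det')

theorem IsMinimalTriplet.isUnit_det_calP (h : IsMinimalTriplet A B C) :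
    IsUnit (calP A B C).det :=
  Matrix.isUnit_det_of_right_inverse
    (calP_mul_inverse h.posDef_gramN.isUnit_det' h.posDef_gramQ.isUnit_det')

theorem isUnit_det_expNeg {n : Type*} [Fintype n] [DecidableEq n] (A : Matrix n n ℂ) (x : ℝ) :
    IsUnit (expNeg A x).det :=
  Matrix.isUnit_det_of_right_inverse (expNeg_mul_neg A x)

/-- Since `1 + KH = K(K⁻¹ + H)` and `K⁻¹ + H` is positive definite, no commutation of `K` and `H` is
needed. -/
theorem _root_.Matrix.PosDef.isUnit_det_one_add_mul {n : Type*} [Fintype n] [DecidableEq n]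
    {H K : Matrix n n ℂ} (hK : K.PosDef) (hH : H.PosSemidef) : IsUnit (1 + K * H).det := by
  have h1 : 1 + K * H = K * (K⁻¹ + H) := by
    rw [mul_add, Matrix.mul_nonsing_inv _ hK.isUnit_det']
  rw [h1, Matrix.det_mul]
  exact hK.isUnit_det'.mul (hK.inv.add_posSemidef hH).isUnit_det'

/-- The matrix has identity diagonal blocks and off-diagonal blocks `N_z`, `-Q_z`, the Gram matrices
conjugated by `e^{-zA}`. Its Schur complement is `1 + Q_zN_z`, with `Q_z` positive definite and
`N_z` positive semidefinite. -/
theorem IsMinimalTriplet.isUnit_det_gammaMatrix (h : IsMinimalTriplet A B C) (z : ℝ) :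
    IsUnit (gammaMatrix A B C z).det := by
  have h1 : gammaMatrix A B C z = Matrix.fromBlocks 1 (expNeg A z * gramN A B * (expNeg A z)ᴴ)
      (-((expNeg A z)ᴴ * gramQ A C * expNeg A z)) 1 := by
    rw [gammaMatrix, calP_eq, expNeg_calA, ← expNeg_conjTranspose, Matrix.fromBlocks_multiply,
      Matrix.fromBlocks_multiply, ← Matrix.fromBlocks_one, Matrix.fromBlocks_add]
    simp
  rw [h1, Matrix.det_fromBlocks_one₁₁, Matrix.neg_mul, sub_neg_eq_add]
  refine Matrix.PosDef.isUnit_det_one_add_mul (h.posDef_gramQ.conjTranspose_mul_mul_same ?_)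
    (h.posDef_gramN.posSemidef.mul_mul_conjTranspose_same _)
  exact Matrix.mulVec_injective_of_isUnit
    ((Matrix.isUnit_iff_isUnit_det _).2 (isUnit_det_expNeg A z))

end Doubled

/-! ### Reflectionless kernels -/

section Representable

/-- `ω` is the kernel of a triplet whose state space is indexed by an arbitrary finite type. -/
def Representable (ω : ℝ → ℂ) : Prop :=
  ∃ (n : Type) (_ : Fintype n) (_ : DecidableEq n) (A : Matrix n n ℂ) (B : Matrix n (Fin 1) ℂ)
    (C : Matrix (Fin 1) n ℂ), (∀ μ ∈ spectrum ℂ A, 0 < μ.re) ∧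
    ∀ w, (C * expNeg A w * B) 0 0 = ω w

theorem Representable.zero : Representable (fun _ => 0) :=
  ⟨Fin 0, inferInstance, inferInstance, 0, 0, 0, fun μ hμ => by
    rw [spectrum.mem_iff] at hμ
    exact absurd (isUnit_of_subsingleton _) hμ, fun w => by simp⟩

theorem Representable.const_mul {ω : ℝ → ℂ} (h : Representable ω) (c : ℂ) :
    Representable (fun w => c * ω w) := by
  obtain ⟨n, _, _, A, B, C, hA, h⟩ := h
  exact ⟨n, inferInstance, inferInstance, A, B, c • C, hA, fun w => by simp [← h w]⟩

/-- The direct sum of two triplets realizes the sum of their kernels; arbitrary finite index types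
let the state space be a disjoint union. -/
theorem Representable.add {ω₁ ω₂ : ℝ → ℂ} (h₁ : Representable ω₁) (h₂ : Representable ω₂) :
    Representable (fun w => ω₁ w + ω₂ w) := by
  obtain ⟨n, _, _, A, B, C, hA, h₁⟩ := h₁
  obtain ⟨n', _, _, A', B', C', hA', h₂⟩ := h₂
  refine ⟨n ⊕ n', inferInstance, inferInstance, Matrix.fromBlocks A 0 0 A',
    Matrix.fromRows B B', Matrix.fromCols C C', fun μ hμ => ?_, fun w => ?_⟩
  · have : μ ∈ spectrum ℂ A ∨ μ ∈ spectrum ℂ A' := by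
      by_contra! h
      refine hμ ?_
      have h1 := h.1
      have h2 := h.2
      rw [spectrum.notMem_iff, Matrix.isUnit_iff_isUnit_det, Algebra.algebraMap_eq_smul_one]
        at h1 h2
      have h3 : algebraMap ℂ (Matrix (n ⊕ n') (n ⊕ n') ℂ) μ - Matrix.fromBlocks A 0 0 A' =
          Matrix.fromBlocks (μ • 1 - A) 0 0 (μ • 1 - A') := by
        rw [Algebra.algebraMap_eq_smul_one, ← Matrix.fromBlocks_one, Matrix.fromBlocks_smul,
          sub_eq_add_neg, Matrix.fromBlocks_neg, Matrix.fromBlocks_add]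
        simp [sub_eq_add_neg]
      rw [spectrum.mem_resolventSet_iff, h3, Matrix.isUnit_iff_isUnit_det, Matrix.det_fromBlocks_zero₂₁]
      exact h1.mul h2
    exact this.elim (hA μ) (hA' μ)
  · rw [expNeg_fromBlocks, Matrix.fromCols_mul_fromBlocks, Matrix.fromCols_mul_fromRows]
    simp [← h₁, ← h₂]

theorem Representable.sum {ι : Type*} (s : Finset ι) {ω : ι → ℝ → ℂ}
    (h : ∀ i ∈ s, Representable (ω i)) : Representable (fun w => ∑ i ∈ s, ω i w) := by
  classical
  induction s using Finset.induction_on with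
  | empty => simpa using Representable.zero
  | insert a s ha ih =>
    simp only [Finset.sum_insert ha]
    exact (h a (Finset.mem_insert_self a s)).add
      (ih fun i hi => h i (Finset.mem_insert_of_mem hi))

/-- The nilpotent shift. -/
def shiftMatrix (s : ℕ) : Matrix (Fin (s + 1)) (Fin (s + 1)) ℂ :=
  Matrix.of fun i j => if (i : ℕ) + 1 = j then 1 else 0

theorem shiftMatrix_pow (s k : ℕ) (i j : Fin (s + 1)) :
    (shiftMatrix s ^ k) i j = if (i : ℕ) + k = j then 1 else 0 := by
  induction k generalizing j with
  | zero => simp [Matrix.one_apply, Fin.ext_iff]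
  | succ k ih =>
    have hs : ∀ l j : Fin (s + 1), shiftMatrix s l j = if (l : ℕ) + 1 = j then 1 else 0 :=
      fun _ _ => rfl
    rw [pow_succ, Matrix.mul_apply]
    simp only [ih, hs]
    by_cases h : (i : ℕ) + (k + 1) = j
    · rw [Finset.sum_eq_single (⟨i + k, by omega⟩ : Fin (s + 1))]
      · simp [h, add_assoc]
      · intro l _ hl
        have : ¬ (i : ℕ) + k = l := fun h' => hl (Fin.ext h'.symm)
        simp [this]
      · simp
    · rw [if_neg h]
      refine Finset.sum_eq_zero fun l _ => ?_
      split_ifs <;> first | omega | simp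

/-- A Jordan block `a - J`, with `J` the nilpotent shift: the corner entry of `e^{-w(a-J)}` is
`e^{-aw}w^s/s!`. For `μ ≠ a`, `μ - (a - J)` is an invertible scalar plus a nilpotent, so `a` is the
only possible eigenvalue. -/
theorem representable_pow_mul_exp (s : ℕ) {a : ℂ} (ha : 0 < a.re) :
    Representable (fun w => (w : ℂ) ^ s / (s.factorial : ℂ) * Complex.exp (-a * w)) := by
  refine ⟨Fin (s + 1), inferInstance, inferInstance, -shiftMatrix s + a • 1,
    Matrix.of fun i _ => if i = Fin.last s then 1 else 0,
    Matrix.of fun _ j => if j = 0 then 1 else 0, fun μ hμ => ?_, fun w => ?_⟩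
  · by_cases h : μ = a
    · rwa [h]
    · refine absurd ?_ hμ
      have hnil : IsNilpotent (shiftMatrix s) := by
        refine ⟨s + 1, Matrix.ext fun i j => ?_⟩
        rw [shiftMatrix_pow, if_neg (by omega), Matrix.zero_apply]
      have h1 : algebraMap ℂ (Matrix (Fin (s + 1)) (Fin (s + 1)) ℂ) μ -
          (-shiftMatrix s + a • 1) = algebraMap ℂ _ (μ - a) + shiftMatrix s := by
        simp only [Algebra.algebraMap_eq_smul_one, sub_smul]
        abel
      rw [spectrum.mem_resolventSet_iff, h1]
      exact hnil.isUnit_add_left_of_commute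
        ((IsUnit.mk0 _ (sub_ne_zero.2 h)).map (algebraMap ℂ _))
        (Algebra.commutes _ _).symm
  · have h1 : expNeg (-shiftMatrix s) w 0 (Fin.last s) = (w : ℂ) ^ s / (s.factorial : ℂ) := by
      refine (hasSum_expNeg _ w 0 (Fin.last s)).unique ?_
      -- Only the power `J^s` reaches the corner; the sign from `-J` cancels the sign from `-w`.
      convert hasSum_single s fun k hk => ?_ using 1
      · rw [neg_pow (shiftMatrix s), neg_pow (w : ℂ)]
        have : ((-1) ^ s * shiftMatrix s ^ s : Matrix _ _ ℂ) = (-1 : ℂ) ^ s • shiftMatrix s ^ s := by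
          rcases Nat.even_or_odd s with h | h <;> simp [h.neg_one_pow]
        rw [this, Matrix.smul_apply, shiftMatrix_pow]
        have h2 : ((-1 : ℂ) ^ s) * (-1) ^ s = 1 := by
          rw [← mul_pow]
          simp
        simp only [Fin.val_zero, zero_add, Fin.val_last, if_true, smul_eq_mul, mul_one]
        linear_combination (-(s.factorial : ℂ)⁻¹ * (w : ℂ) ^ s) * h2
      · have : (-shiftMatrix s) ^ k = (-1 : ℂ) ^ k • shiftMatrix s ^ k := by
          rw [neg_pow]
          rcases Nat.even_or_odd k with h | h <;> simp [h.neg_one_pow]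
        rw [this, Matrix.smul_apply, shiftMatrix_pow, if_neg (by simpa using hk)]
        simp
    rw [expNeg_add_smul_one]
    simp [Matrix.mul_apply, h1, mul_comm]

theorem Representable.exists_fin {ω : ℝ → ℂ} (h : Representable ω) :
    ∃ (q : ℕ) (A : Matrix (Fin q) (Fin q) ℂ) (B : Matrix (Fin q) (Fin 1) ℂ)
      (C : Matrix (Fin 1) (Fin q) ℂ), EigenvaluesInRightHalfPlane A ∧
      ∀ w, scalarKernel A B C w = ω w := by
  obtain ⟨n, _, _, A, B, C, hA, h⟩ := h
  let e := Fintype.equivFin n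
  refine ⟨Fintype.card n, Matrix.reindexAlgEquiv ℂ ℂ e A, B.submatrix e.symm id,
    C.submatrix id e.symm, ?_, fun w => ?_⟩
  · intro μ hμ
    rw [AlgEquiv.spectrum_eq] at hμ
    exact hA μ hμ
  · have h1 : expNeg (Matrix.reindexAlgEquiv ℂ ℂ e A) w =
        (expNeg A w).submatrix e.symm e.symm := by
      ext i j
      refine (hasSum_expNeg _ w i j).unique ?_
      simp only [← map_pow]
      exact hasSum_expNeg A w (e.symm i) (e.symm j)
    rw [scalarKernel, h1, Matrix.submatrix_mul_equiv, Matrix.submatrix_mul_equiv, ← h w]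
    rfl

theorem Representable.exists_minimal {ω : ℝ → ℂ} (h : Representable ω) :
    ∃ (q : ℕ) (A : Matrix (Fin q) (Fin q) ℂ) (B : Matrix (Fin q) (Fin 1) ℂ)
      (C : Matrix (Fin 1) (Fin q) ℂ), IsMinimalTriplet A B C ∧
      ∀ w, scalarKernel A B C w = ω w := by
  classical
  have hex := h.exists_fin
  obtain ⟨A, B, C, hA, hk⟩ := Nat.find_spec hex
  refine ⟨Nat.find hex, A, B, C, ⟨hA, fun r A' B' C' hA' hk' => ?_⟩, hk⟩
  exact Nat.find_min' hex ⟨A', B', C', hA', fun w => (hk' w).trans (hk w)⟩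

theorem representable_reflectionlessKernel {N : ℕ} (a : Fin N → ℂ) (n : Fin N → ℕ)
    (c : Fin N → ℕ → ℂ) (ha : ∀ j, 0 < (a j).re) : Representable (reflectionlessKernel a n c) := by
  have : reflectionlessKernel a n c = fun w : ℝ => ∑ j, ∑ s ∈ Finset.range (n j),
      c j s * ((w : ℂ) ^ s / (s.factorial : ℂ) * Complex.exp (-a j * w)) := by
    funext w
    simp only [reflectionlessKernel, mul_assoc]
  rw [this]
  exact Representable.sum _ fun j _ => Representable.sum _ fun s _ =>
    (representable_pow_mul_exp s (ha j)).const_mul _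

end Representable

/-! ### The Marchenko equation -/

section Marchenko

variable {q : ℕ} {A : Matrix (Fin q) (Fin q) ℂ} {B : Matrix (Fin q) (Fin 1) ℂ}
  {C : Matrix (Fin 1) (Fin q) ℂ}

theorem isUnit_det_calA (h : EigenvaluesInRightHalfPlane A) : IsUnit (calA A).det := by
  have h1 := isUnit_add_smul_of_spectrum h (ν := 0) (by simp)
  have h2 := isUnit_add_smul_of_spectrum h.conjTranspose (ν := 0) (by simp)
  rw [zero_smul, add_zero] at h1 h2
  rw [calA, Matrix.det_fromBlocks_zero₂₁]
  exact h1.mul h2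

theorem continuous_kernelL (A : Matrix (Fin q) (Fin q) ℂ) (B : Matrix (Fin q) (Fin 1) ℂ)
    (C : Matrix (Fin 1) (Fin q) ℂ) (z : ℝ) : Continuous (kernelL A B C z) :=
  ((continuous_const.matrix_mul (continuous_expNeg _)).matrix_mul continuous_const).neg

theorem matDecay_kernelL (h : EigenvaluesInRightHalfPlane A) (B : Matrix (Fin q) (Fin 1) ℂ)
    (C : Matrix (Fin 1) (Fin q) ℂ) (z : ℝ) : MatDecay (kernelL A B C z) :=
  (((matDecay_expNeg_calA h).const_mul _).mul_const _).neg

theorem entriesIntegrableOn_kernelL (h : EigenvaluesInRightHalfPlane A)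
    (B : Matrix (Fin q) (Fin 1) ℂ) (C : Matrix (Fin 1) (Fin q) ℂ) (z : ℝ) :
    EntriesIntegrableOn (kernelL A B C z) (Ioi z) :=
  (matDecay_kernelL h B C z).entriesIntegrableOn (continuous_kernelL A B C z) z

/-- An integrable matrix function times a continuous decaying one is integrable. -/
theorem EntriesIntegrableOn.mul_decay {l m n : Type*} [Fintype m] {F : ℝ → Matrix l m ℂ}
    {G : ℝ → Matrix m n ℂ} {z : ℝ} (hF : EntriesIntegrableOn F (Ioi z)) (hG : MatDecay G)
    (hc : Continuous G) : EntriesIntegrableOn (fun u => F u * G u) (Ioi z) := by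
  intro i j
  simp only [Matrix.mul_apply]
  refine integrable_finsetSum _ fun k _ => ?_
  have hgc : Continuous fun u => G u k j := (continuous_apply j).comp ((continuous_apply k).comp hc)
  obtain ⟨R, hR⟩ : ∃ R, ∀ u ∈ Ici z, ‖G u k j‖ ≤ R := by
    have h1 : ∀ᶠ u in atTop, ‖G u k j‖ < 1 := by
      have := (hG k j).tendsto.norm
      rw [norm_zero] at this
      exact this.eventually_lt_const one_pos
    obtain ⟨b, hb⟩ := eventually_atTop.1 h1
    obtain ⟨R, hR⟩ := (isCompact_Icc (a := z) (b := b)).exists_bound_of_continuousOn hgc.continuousOn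
    refine ⟨max 1 R, fun u hu => ?_⟩
    by_cases hub : u ≤ b
    · exact (hR u ⟨hu, hub⟩).trans (le_max_right _ _)
    · exact (hb u (le_of_not_ge hub)).le.trans (le_max_left _ _)
  refine Integrable.mul_bdd (c := R) (hF i k) hgc.aestronglyMeasurable ?_
  filter_upwards [ae_restrict_mem measurableSet_Ioi] with u hu
  exact hR u (mem_Ici.2 (mem_Ioi.1 hu).le)

/-- Separation of the variables `u` and `y` is what makes the Marchenko equation finite-dimensional.
-/
theorem matrixKernel_add (A : Matrix (Fin q) (Fin q) ℂ) (B : Matrix (Fin q) (Fin 1) ℂ)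
    (C : Matrix (Fin 1) (Fin q) ℂ) (u y : ℝ) :
    matrixKernel (scalarKernel A B C) (u + y) =
      calC B C * expNeg (calA A) u * (expNeg (calA A) y * calB B C) := by
  rw [matrixKernel_eq, expNeg_add]
  simp only [Matrix.mul_assoc]

theorem entriesIntegrableOn_mul_matrixKernel (h : EigenvaluesInRightHalfPlane A) {z : ℝ}
    {ℓ : ℝ → Matrix (Fin 2) (Fin 2) ℂ} (hℓ : EntriesIntegrableOn ℓ (Ioi z)) (y : ℝ) :
    EntriesIntegrableOn (fun u => ℓ u * matrixKernel (scalarKernel A B C) (u + y)) (Ioi z) := by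
  simp only [matrixKernel_add]
  exact hℓ.mul_decay (((matDecay_expNeg_calA h).const_mul _).mul_const _)
    ((continuous_const.matrix_mul (continuous_expNeg _)).matrix_mul continuous_const)

theorem matIntegral_mul_matrixKernel (h : EigenvaluesInRightHalfPlane A) {z : ℝ}
    {ℓ : ℝ → Matrix (Fin 2) (Fin 2) ℂ} (hℓ : EntriesIntegrableOn ℓ (Ioi z)) (y : ℝ) :
    matIntegral (Ioi z) (fun u => ℓ u * matrixKernel (scalarKernel A B C) (u + y)) =
      matIntegral (Ioi z) (fun u => ℓ u * (calC B C * expNeg (calA A) u)) *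
        (expNeg (calA A) y * calB B C) := by
  rw [← matIntegral_mul_const]
  · simp only [matrixKernel_add, Matrix.mul_assoc]
  · exact hℓ.mul_decay ((matDecay_expNeg_calA h).const_mul _)
      (continuous_const.matrix_mul (continuous_expNeg _))

/-- The tail integral of `e^{-u𝒜}ℬ𝒞e^{-u𝒜}` from `z` is `e^{-z𝒜}𝒫e^{-z𝒜}`, because `𝒫` solves the
Sylvester equation. -/
theorem matIntegral_gamma (h : EigenvaluesInRightHalfPlane A) (B : Matrix (Fin q) (Fin 1) ℂ)
    (C : Matrix (Fin 1) (Fin q) ℂ) (M : Matrix (Fin 2) (Fin q ⊕ Fin q) ℂ) (z : ℝ) :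
    matIntegral (Ioi z) (fun u => M * expNeg (calA A) u * calB B C *
      (calC B C * expNeg (calA A) u)) = M * (gammaMatrix A B C z - 1) := by
  have hd := matDecay_expNeg_calA h
  have h1 := matIntegral_sandwich hd hd ((sylvester_calP h B C _).2 rfl) z
  rw [gammaMatrix, add_sub_cancel_left, ← h1, ← matIntegral_const_mul]
  · simp only [Matrix.mul_assoc]
  · exact (matDecay_sandwich hd hd _).entriesIntegrableOn (continuous_sandwich _ _ _) z

/-- With `G = I + e^{-z𝒜}𝒫e^{-z𝒜}`, the integral term carries the coefficient `-𝒞e^{-z𝒜}G⁻¹(G - 1) =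
-𝒞e^{-z𝒜} + 𝒞e^{-z𝒜}G⁻¹`; the first summand cancels `Ω(z+y)`, the second cancels `L`. -/
theorem marchenkoAt_kernelL (h : IsMinimalTriplet A B C) (z y : ℝ) :
    MarchenkoAt (matrixKernel (scalarKernel A B C)) z (kernelL A B C z) y := by
  have hΓ := h.isUnit_det_gammaMatrix z
  set G := gammaMatrix A B C z
  have h1 : matIntegral (Ioi z)
      (fun u => kernelL A B C z u * (calC B C * expNeg (calA A) u)) =
      -(calC B C * expNeg (calA A) z * G⁻¹) * (G - 1) := by
    rw [← matIntegral_gamma h.eigenvalues]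
    simp only [kernelL, Matrix.neg_mul, G]
  rw [MarchenkoAt, matIntegral_mul_matrixKernel h.eigenvalues
    (entriesIntegrableOn_kernelL h.eigenvalues B C z), h1, matrixKernel_add, kernelL,
    Matrix.neg_mul, Matrix.mul_sub, Matrix.mul_one, Matrix.mul_assoc _ G⁻¹ G,
    Matrix.nonsing_inv_mul _ hΓ, Matrix.mul_one, Matrix.neg_mul, Matrix.sub_mul]
  simp only [Matrix.mul_assoc, G]
  abel

/-- A solution enters its own integral only through the constant matrix `D = ∫_z^∞ ℓ(u)𝒞e^{-u𝒜}du`.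
Invertibility of `gammaMatrix` determines `D`, and the equation then returns `ℓ`. -/
theorem eq_kernelL_of_marchenko (h : IsMinimalTriplet A B C) {z : ℝ}
    {ℓ : ℝ → Matrix (Fin 2) (Fin 2) ℂ} (hℓ : EntriesIntegrableOn ℓ (Ioi z))
    (hm : ∀ᵐ y ∂(volume.restrict (Ioi z)),
      MarchenkoAt (matrixKernel (scalarKernel A B C)) z ℓ y) :
    ∀ᵐ y ∂(volume.restrict (Ioi z)), ℓ y = kernelL A B C z y := by
  have hΓ := h.isUnit_det_gammaMatrix z
  set D := matIntegral (Ioi z) (fun u => ℓ u * (calC B C * expNeg (calA A) u)) with hD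
  have h1 : ∀ᵐ y ∂(volume.restrict (Ioi z)),
      ℓ y = -(calC B C * expNeg (calA A) z + D) * expNeg (calA A) y * calB B C := by
    filter_upwards [hm] with y hy
    rw [MarchenkoAt, matIntegral_mul_matrixKernel h.eigenvalues hℓ, matrixKernel_add,
      add_assoc, ← Matrix.add_mul] at hy
    rw [eq_neg_of_add_eq_zero_left hy, Matrix.neg_mul, Matrix.neg_mul, Matrix.mul_assoc]
  -- Feeding the expression for `ℓ` back into the definition of `D` closes the linear system.
  have h2 : D = -(calC B C * expNeg (calA A) z + D) * (gammaMatrix A B C z - 1) := by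
    rw [← matIntegral_gamma h.eigenvalues, hD]
    ext i j
    refine integral_congr_ae ?_
    filter_upwards [h1] with y hy
    rw [hy]
  have h3 : (calC B C * expNeg (calA A) z + D) * gammaMatrix A B C z =
      calC B C * expNeg (calA A) z := by
    rw [Matrix.mul_sub, Matrix.mul_one, Matrix.neg_mul] at h2
    have := sub_eq_zero.2 h2
    rw [← sub_eq_zero, ← this]
    abel
  have h4 : calC B C * expNeg (calA A) z + D =
      calC B C * expNeg (calA A) z * (gammaMatrix A B C z)⁻¹ := by
    have h5 := congrArg (· * (gammaMatrix A B C z)⁻¹) h3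
    rwa [Matrix.mul_assoc, Matrix.mul_nonsing_inv _ hΓ, Matrix.mul_one] at h5
  filter_upwards [h1] with y hy
  rw [hy, h4, kernelL, Matrix.neg_mul, Matrix.neg_mul]

theorem tildeL_eq (h : EigenvaluesInRightHalfPlane A) (B : Matrix (Fin q) (Fin 1) ℂ)
    (C : Matrix (Fin 1) (Fin q) ℂ) (z : ℝ) :
    tildeL A B C z = -(calC B C * expNeg (calA A) z * (gammaMatrix A B C z)⁻¹ *
      expNeg (calA A) z * (calA A)⁻¹ * calB B C) := by
  have hd := matDecay_expNeg_calA h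
  have h1 := matIntegral_expNeg hd (isUnit_det_calA h) z
  have hi := hd.entriesIntegrableOn (continuous_expNeg (calA A)) z
  have hi' : EntriesIntegrableOn (fun y => expNeg (calA A) y * calB B C) (Ioi z) :=
    (hd.mul_const _).entriesIntegrableOn
      ((continuous_expNeg (calA A)).matrix_mul continuous_const) z
  have h2 : kernelL A B C z = fun y => (-(calC B C * expNeg (calA A) z *
      (gammaMatrix A B C z)⁻¹)) * (expNeg (calA A) y * calB B C) := by
    funext y
    simp only [kernelL, Matrix.neg_mul, Matrix.mul_assoc]
  rw [tildeL, h2, matIntegral_const_mul _ hi', matIntegral_mul_const hi, h1]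
  simp only [Matrix.neg_mul, Matrix.mul_assoc]

end Marchenko

/-! ### Time evolution of the kernel -/

section Evolution

variable {q r : ℕ} {A : Matrix (Fin q) (Fin q) ℂ} {B : Matrix (Fin q) (Fin 1) ℂ}
  {C : Matrix (Fin 1) (Fin q) ℂ}

/-- The propagator `e^{-4itA²}`. -/
noncomputable def propagator (A : Matrix (Fin q) (Fin q) ℂ) (t : ℝ) : Matrix (Fin q) (Fin q) ℂ :=
  expNeg ((4 * Complex.I) • A ^ 2) t

theorem exp_eq_propagator (A : Matrix (Fin q) (Fin q) ℂ) (t : ℝ) :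
    NormedSpace.exp ((-4 * Complex.I * (t : ℂ)) • A ^ 2) = propagator A t := by
  rw [propagator, expNeg, smul_smul]
  congr 2
  ring

theorem evolvedC_eq (A : Matrix (Fin q) (Fin q) ℂ) (C : Matrix (Fin 1) (Fin q) ℂ) (t : ℝ) :
    evolvedC A C t = C * propagator A t := by
  rw [evolvedC, exp_eq_propagator]

theorem commute_propagator (A : Matrix (Fin q) (Fin q) ℂ) (t : ℝ) : Commute A (propagator A t) :=
  commute_expNeg (((Commute.refl A).pow_right 2).smul_right _) t

theorem commute_propagator_expNeg (A : Matrix (Fin q) (Fin q) ℂ) (t w : ℝ) :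
    Commute (propagator A t) (expNeg A w) :=
  commute_expNeg (commute_propagator A t).symm w

theorem evolvedC_evolvedC_neg (A : Matrix (Fin q) (Fin q) ℂ) (C : Matrix (Fin 1) (Fin q) ℂ)
    (t : ℝ) : evolvedC A (evolvedC A C t) (-t) = C := by
  rw [evolvedC_eq, evolvedC_eq, Matrix.mul_assoc, propagator, propagator, expNeg_mul_neg,
    Matrix.mul_one]

theorem scalarKernel_evolvedC (A : Matrix (Fin q) (Fin q) ℂ) (B : Matrix (Fin q) (Fin 1) ℂ)
    (C : Matrix (Fin 1) (Fin q) ℂ) (t w : ℝ) :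
    scalarKernel A B (evolvedC A C t) w =
      (C * propagator A t * (expNeg A w * B)) 0 0 := by
  rw [scalarKernel, evolvedC_eq, Matrix.mul_assoc (C * _)]

/-- Differentiating the equality of kernels `k` times in `w` inserts the factor `(-A)^k`. -/
theorem markov_eq {A' : Matrix (Fin r) (Fin r) ℂ} {B' : Matrix (Fin r) (Fin 1) ℂ}
    {C' : Matrix (Fin 1) (Fin r) ℂ} (h : ∀ w, scalarKernel A' B' C' w = scalarKernel A B C w)
    (k : ℕ) (w : ℝ) :
    (C' * A' ^ k * (expNeg A' w * B')) 0 0 = (C * A ^ k * (expNeg A w * B)) 0 0 := by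
  have hd : ∀ {s : ℕ} (A : Matrix (Fin s) (Fin s) ℂ) (B : Matrix (Fin s) (Fin 1) ℂ)
      (C : Matrix (Fin 1) (Fin s) ℂ) (k : ℕ) (w : ℝ),
      HasDerivAt (fun w => (C * A ^ k * (expNeg A w * B)) 0 0)
        (-(C * A ^ (k + 1) * (expNeg A w * B)) 0 0) w := by
    intro s A B C k w
    have h1 := (((matHasDerivAt_expNeg A w).mul_const B).const_mul (C * A ^ k)) 0 0
    convert h1 using 1
    rw [← Matrix.neg_apply, pow_succ]
    simp only [Matrix.mul_assoc, Matrix.neg_mul, Matrix.mul_neg]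
  induction k generalizing w with
  | zero =>
    have := h w
    simpa [scalarKernel, Matrix.mul_assoc] using this
  | succ k ih =>
    have h1 := hd A' B' C' k w
    simp only [ih] at h1
    exact neg_injective (h1.unique (hd A B C k w))

theorem hasSum_row_expNeg_col {n : Type*} [Fintype n] [DecidableEq n] (X : Matrix (Fin 1) n ℂ)
    (M : Matrix n n ℂ) (Y : Matrix n (Fin 1) ℂ) (t : ℝ) :
    HasSum (fun k : ℕ => ((k.factorial : ℂ)⁻¹ * (-(t : ℂ)) ^ k) * (X * M ^ k * Y) 0 0)
      ((X * expNeg M t * Y) 0 0) := by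
  simp only [Matrix.mul_apply, Finset.mul_sum, Finset.sum_mul]
  refine hasSum_sum fun i _ => hasSum_sum fun j _ => ?_
  refine (((hasSum_expNeg M t j i).mul_left (X 0 j)).mul_right (Y i 0)).congr_fun fun k => ?_
  ring

/-- Triplets with the same kernel have the same evolved kernels. -/
theorem scalarKernel_evolvedC_congr {A' : Matrix (Fin r) (Fin r) ℂ} {B' : Matrix (Fin r) (Fin 1) ℂ}
    {C' : Matrix (Fin 1) (Fin r) ℂ} (h : ∀ w, scalarKernel A' B' C' w = scalarKernel A B C w)
    (t w : ℝ) :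
    scalarKernel A' B' (evolvedC A' C' t) w = scalarKernel A B (evolvedC A C t) w := by
  rw [scalarKernel_evolvedC, scalarKernel_evolvedC, propagator, propagator]
  -- In the power series in `t` the coefficients involve only `CA^{2k}e^{-wA}B`, which equal kernels
  -- share by `markov_eq`.
  refine (hasSum_row_expNeg_col _ _ _ t).unique ?_
  convert hasSum_row_expNeg_col C ((4 * Complex.I) • A ^ 2) (expNeg A w * B) t using 3 with k
  have := markov_eq h (2 * k) w
  simp only [smul_pow, ← pow_mul, Matrix.mul_smul, Matrix.smul_mul, Matrix.smul_apply, this]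

/-- Evolution is reversible: a competitor of the evolved triplet, evolved by `-t`, competes with the
original one at the same order. -/
theorem IsMinimalTriplet.evolvedC (h : IsMinimalTriplet A B C) (t : ℝ) :
    IsMinimalTriplet A B (evolvedC A C t) := by
  refine ⟨h.eigenvalues, fun r A' B' C' hA' hk => ?_⟩
  refine h.minimal r A' B' (HeisenbergChain.evolvedC A' C' (-t)) hA' fun w => ?_
  rw [scalarKernel_evolvedC_congr hk, evolvedC_evolvedC_neg]

theorem expNeg_diagonal {n : Type*} [Fintype n] [DecidableEq n] (a : n → ℂ) (w : ℝ) :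
    expNeg (Matrix.diagonal a) w = Matrix.diagonal fun j => Complex.exp (-a j * w) := by
  rw [expNeg, ← Matrix.diagonal_smul, Matrix.exp_diagonal]
  congr 1
  funext k
  rw [Pi.coe_exp, Complex.exp_eq_exp_ℂ]
  congr 1
  simp [mul_comm]

/-- The sum of exponentials is also the kernel of a diagonal triplet, whose evolution is explicit.
Equality of kernels suffices for the comparison, so that triplet need not be minimal and the `a j`
need not be distinct. -/
theorem scalarKernel_evolvedC_of_sum {N : ℕ} {a c : Fin N → ℂ}
    (h : ∀ w : ℝ, scalarKernel A B C w = ∑ j, c j * Complex.exp (-a j * w)) (t w : ℝ) :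
    scalarKernel A B (evolvedC A C t) w =
      ∑ j, Complex.exp (-4 * Complex.I * a j ^ 2 * t) * c j * Complex.exp (-a j * w) := by
  have h1 : ∀ w, scalarKernel A B C w = scalarKernel (Matrix.diagonal a)
      (Matrix.of fun _ _ => 1) (Matrix.of fun _ j => c j) w := by
    intro w
    rw [h w, scalarKernel, expNeg_diagonal, Matrix.mul_apply]
    simp only [Matrix.mul_diagonal, Matrix.of_apply, mul_one]
  rw [scalarKernel_evolvedC_congr h1, scalarKernel, evolvedC_eq, propagator, Matrix.diagonal_pow,
    ← Matrix.diagonal_smul, expNeg_diagonal, expNeg_diagonal, Matrix.mul_apply]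
  simp only [Matrix.mul_diagonal, Matrix.of_apply, mul_one, Pi.smul_apply,
    Pi.pow_apply, smul_eq_mul]
  refine Finset.sum_congr rfl fun j _ => ?_
  rw [mul_comm (c j)]
  congr 3
  ring

/-! ### The time-dependent closed form of `L̃` -/

/-- `diag(e^{-4itA²}, I)`. -/
noncomputable def rightEvolution (A : Matrix (Fin q) (Fin q) ℂ) (t : ℝ) :
    Matrix (Fin q ⊕ Fin q) (Fin q ⊕ Fin q) ℂ :=
  Matrix.fromBlocks (propagator A t) 0 0 1

/-- `diag(I, (e^{-4itA²})†)`. -/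
noncomputable def leftEvolution (A : Matrix (Fin q) (Fin q) ℂ) (t : ℝ) :
    Matrix (Fin q ⊕ Fin q) (Fin q ⊕ Fin q) ℂ :=
  Matrix.fromBlocks 1 0 0 (propagator A t)ᴴ

theorem calC_evolvedC (A : Matrix (Fin q) (Fin q) ℂ) (B : Matrix (Fin q) (Fin 1) ℂ)
    (C : Matrix (Fin 1) (Fin q) ℂ) (t : ℝ) :
    calC B (evolvedC A C t) = calC B C * rightEvolution A t := by
  ext i j
  rw [evolvedC_eq]
  fin_cases i <;> rcases j with j | j <;>
    simp [calC, rightEvolution, Matrix.mul_apply, Fintype.sum_sum_type,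
      Matrix.one_apply]

theorem calB_evolvedC (A : Matrix (Fin q) (Fin q) ℂ) (B : Matrix (Fin q) (Fin 1) ℂ)
    (C : Matrix (Fin 1) (Fin q) ℂ) (t : ℝ) :
    calB B (evolvedC A C t) = leftEvolution A t * calB B C := by
  ext i j
  rw [evolvedC_eq]
  rcases i with i | i <;> fin_cases j <;>
    simp [calB, leftEvolution, Matrix.mul_apply, Fintype.sum_sum_type, Matrix.one_apply, mul_comm]

theorem commute_calA_rightEvolution (A : Matrix (Fin q) (Fin q) ℂ) (t : ℝ) :
    Commute (calA A) (rightEvolution A t) := by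
  simp [Commute, SemiconjBy, calA, rightEvolution, Matrix.fromBlocks_multiply,
    (commute_propagator A t).eq]

theorem commute_calA_leftEvolution (A : Matrix (Fin q) (Fin q) ℂ) (t : ℝ) :
    Commute (calA A) (leftEvolution A t) := by
  have h : Aᴴ * (propagator A t)ᴴ = (propagator A t)ᴴ * Aᴴ := by
    rw [← Matrix.conjTranspose_mul, ← Matrix.conjTranspose_mul, (commute_propagator A t).eq]
  simp [Commute, SemiconjBy, calA, leftEvolution, Matrix.fromBlocks_multiply, h]

/-- Both evolution factors commute with `𝒜`, so the right-hand side solves the Sylvester equation of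
the evolved triplet; uniqueness does the rest. -/
theorem calP_evolvedC (h : EigenvaluesInRightHalfPlane A) (B : Matrix (Fin q) (Fin 1) ℂ)
    (C : Matrix (Fin 1) (Fin q) ℂ) (t : ℝ) :
    calP A B (evolvedC A C t) = leftEvolution A t * calP A B C * rightEvolution A t := by
  refine ((sylvester_calP h B (evolvedC A C t) _).1 ?_).symm
  have h1 := (sylvester_calP h B C _).2 rfl
  have h2 := (commute_calA_rightEvolution A t).eq
  have h3 := (commute_calA_leftEvolution A t).eq
  rw [calC_evolvedC, calB_evolvedC, Matrix.mul_assoc (leftEvolution A t) (calB B C),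
    ← Matrix.mul_assoc (calB B C), ← h1, Matrix.mul_assoc _ (rightEvolution A t), ← h2,
    ← Matrix.mul_assoc, ← Matrix.mul_assoc, h3]
  simp only [Matrix.mul_add, Matrix.add_mul, Matrix.mul_assoc]

/-- The generator `diag(-4iA², 4iA†²)` of the time dependence. -/
noncomputable def timeGenerator (A : Matrix (Fin q) (Fin q) ℂ) :
    Matrix (Fin q ⊕ Fin q) (Fin q ⊕ Fin q) ℂ :=
  Matrix.fromBlocks (-((4 * Complex.I) • A ^ 2)) 0 0 ((4 * Complex.I) • Aᴴ ^ 2)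

/-- `e^{2z𝒜}` times the propagator of the time dependence. -/
noncomputable def phaseE (A : Matrix (Fin q) (Fin q) ℂ) (z t : ℝ) :
    Matrix (Fin q ⊕ Fin q) (Fin q ⊕ Fin q) ℂ :=
  expNeg (calA A) (-2 * z) * expNeg (timeGenerator A) t

/-- The resolvent-like matrix `(E + 𝒫)⁻¹`. -/
noncomputable def resR (A : Matrix (Fin q) (Fin q) ℂ) (B : Matrix (Fin q) (Fin 1) ℂ)
    (C : Matrix (Fin 1) (Fin q) ℂ) (z t : ℝ) : Matrix (Fin q ⊕ Fin q) (Fin q ⊕ Fin q) ℂ :=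
  (phaseE A z t + calP A B C)⁻¹

theorem leftEvolution_mul_rightEvolution (A : Matrix (Fin q) (Fin q) ℂ) (t : ℝ) :
    leftEvolution A t * expNeg (timeGenerator A) t * rightEvolution A t = 1 := by
  have h1 : ((4 * Complex.I) • Aᴴ ^ 2) = -((4 * Complex.I) • A ^ 2)ᴴ := by
    rw [Matrix.conjTranspose_smul, Matrix.conjTranspose_pow]
    simp
  have h2 : expNeg (-((4 * Complex.I) • A ^ 2)) t * propagator A t = 1 := by
    rw [expNeg_neg, propagator, expNeg_neg_mul]
  have h3 : (propagator A t)ᴴ * expNeg ((4 * Complex.I) • Aᴴ ^ 2) t = 1 := by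
    rw [h1, expNeg_neg, expNeg_conjTranspose, propagator, ← Matrix.conjTranspose_mul,
      expNeg_neg_mul, Matrix.conjTranspose_one]
  rw [leftEvolution, rightEvolution, timeGenerator, expNeg_fromBlocks,
    Matrix.fromBlocks_multiply, Matrix.fromBlocks_multiply]
  simp [h2, h3]

/-- Pulling out invertible factors leaves `E + 𝒫` with `𝒫` constant, so that inside the bracket only
the exponential `E` depends on `z` and `t`. -/
theorem gammaMatrix_evolvedC (h : EigenvaluesInRightHalfPlane A) (B : Matrix (Fin q) (Fin 1) ℂ)
    (C : Matrix (Fin 1) (Fin q) ℂ) (z t : ℝ) :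
    gammaMatrix A B (evolvedC A C t) z =
      expNeg (calA A) z * leftEvolution A t * (phaseE A z t + calP A B C) *
        (rightEvolution A t * expNeg (calA A) z) := by
  have h1 : expNeg (calA A) z * leftEvolution A t * phaseE A z t *
      (rightEvolution A t * expNeg (calA A) z) = 1 := by
    have h2 := (commute_expNeg (commute_calA_leftEvolution A t).symm (-2 * z)).eq
    calc _ = expNeg (calA A) z * (leftEvolution A t * expNeg (calA A) (-2 * z)) *
          expNeg (timeGenerator A) t * rightEvolution A t * expNeg (calA A) z := by
          simp only [phaseE, Matrix.mul_assoc]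
      _ = expNeg (calA A) z * expNeg (calA A) (-2 * z) * (leftEvolution A t *
          expNeg (timeGenerator A) t * rightEvolution A t) * expNeg (calA A) z := by
          rw [h2]
          simp only [Matrix.mul_assoc]
      _ = 1 := by
          rw [leftEvolution_mul_rightEvolution, Matrix.mul_one, ← expNeg_add, ← expNeg_add,
            ← expNeg_zero (calA A)]
          congr 1
          ring
  rw [gammaMatrix, calP_evolvedC h, Matrix.mul_add, Matrix.add_mul, h1]
  simp only [Matrix.mul_assoc]

theorem isUnit_det_leftEvolution (A : Matrix (Fin q) (Fin q) ℂ) (t : ℝ) :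
    IsUnit (leftEvolution A t).det := by
  refine Matrix.isUnit_det_of_right_inverse
    (B := expNeg (timeGenerator A) t * rightEvolution A t) ?_
  rw [← Matrix.mul_assoc, leftEvolution_mul_rightEvolution]

/-- Invertibility of `E + 𝒫` is inherited from `gammaMatrix` of the evolved triplet, which is again
minimal. -/
theorem IsMinimalTriplet.phaseE_add_calP_mul (h : IsMinimalTriplet A B C) (z t : ℝ) :
    (phaseE A z t + calP A B C) * (rightEvolution A t * expNeg (calA A) z *
      (gammaMatrix A B (HeisenbergChain.evolvedC A C t) z)⁻¹ *
        (expNeg (calA A) z * leftEvolution A t)) = 1 := by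
  have hΓ := (h.evolvedC t).isUnit_det_gammaMatrix z
  have hg := gammaMatrix_evolvedC h.eigenvalues B C z t
  set G := gammaMatrix A B (HeisenbergChain.evolvedC A C t) z
  set K := expNeg (calA A) z * leftEvolution A t with hK
  have hKu : IsUnit K.det := by
    rw [hK, Matrix.det_mul]
    exact (isUnit_det_expNeg _ _).mul (isUnit_det_leftEvolution A t)
  have h1 : K * ((phaseE A z t + calP A B C) * (rightEvolution A t * expNeg (calA A) z *
      G⁻¹ * K)) = K := by
    have : K * ((phaseE A z t + calP A B C) * (rightEvolution A t * expNeg (calA A) z *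
        G⁻¹ * K)) = (K * (phaseE A z t + calP A B C) *
          (rightEvolution A t * expNeg (calA A) z)) * G⁻¹ * K := by
      simp only [Matrix.mul_assoc]
    rw [this, ← hg, Matrix.mul_nonsing_inv _ hΓ, Matrix.one_mul]
  have h2 := congrArg (K⁻¹ * ·) h1
  simpa only [← Matrix.mul_assoc, Matrix.nonsing_inv_mul _ hKu, Matrix.one_mul] using h2

theorem IsMinimalTriplet.isUnit_det_phaseE_add_calP (h : IsMinimalTriplet A B C) (z t : ℝ) :
    IsUnit (phaseE A z t + calP A B C).det :=
  Matrix.isUnit_det_of_right_inverse (h.phaseE_add_calP_mul z t)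

/-- The evolution factors of `ℬ(t)` and `𝒞(t)` are absorbed into the resolvent, so derivatives in
`z` and `t` fall on `R` alone. -/
theorem IsMinimalTriplet.tildeL_evolvedC (h : IsMinimalTriplet A B C) (z t : ℝ) :
    tildeL A B (HeisenbergChain.evolvedC A C t) z =
      -(calC B C * resR A B C z t * (calA A)⁻¹ * calB B C) := by
  have hA := isUnit_det_calA h.eigenvalues
  have h1 : (calA A)⁻¹ * leftEvolution A t = leftEvolution A t * (calA A)⁻¹ := by
    have h2 := (commute_calA_leftEvolution A t).eq
    calc _ = (calA A)⁻¹ * (leftEvolution A t * calA A) * (calA A)⁻¹ := by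
          rw [Matrix.mul_assoc, Matrix.mul_assoc, Matrix.mul_nonsing_inv _ hA, Matrix.mul_one]
      _ = _ := by
          rw [← h2, ← Matrix.mul_assoc, Matrix.nonsing_inv_mul _ hA, Matrix.one_mul]
  rw [tildeL_eq h.eigenvalues, calC_evolvedC, calB_evolvedC, resR,
    Matrix.inv_eq_right_inv (h.phaseE_add_calP_mul z t)]
  rw [← Matrix.mul_assoc _ (leftEvolution A t), Matrix.mul_assoc _ (calA A)⁻¹, h1]
  simp only [Matrix.mul_assoc]

end Evolution

/-! ### Algebra of the dressing matrix -/

section Dressing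

variable {n : Type*} [Fintype n] [DecidableEq n]

/-- Matrices `E`, `P` with `R = (E + P)⁻¹`, `R' = (E - P)⁻¹`, where `P` solves the Sylvester equation
`A P + P A = b c`, and an involution `S` that commutes with `A`, `E` and anticommutes with `P`. -/
structure IsDressing (A P E S R R' : Matrix n n ℂ) (b : Matrix n (Fin 2) ℂ)
    (c : Matrix (Fin 2) n ℂ) : Prop where
  sylvester : A * P + P * A = b * c
  commute_AE : A * E = E * A
  S_sq : S * S = 1
  S_A : S * A = A * S
  S_E : S * E = E * S
  S_P : S * P = -(P * S)
  c_S : c * S = pauli3 * c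
  S_b : S * b = -(b * pauli3)
  R_left : R * (E + P) = 1
  R_right : (E + P) * R = 1
  R'_left : R' * (E - P) = 1
  R'_right : (E - P) * R' = 1

variable {A P E S R R' G : Matrix n n ℂ} {b : Matrix n (Fin 2) ℂ} {c : Matrix (Fin 2) n ℂ} {κ : ℂ}

/-- The dressing matrix `I - c R G b`. -/
def dressing (R G : Matrix n n ℂ) (b : Matrix n (Fin 2) ℂ) (c : Matrix (Fin 2) n ℂ) :
    Matrix (Fin 2) (Fin 2) ℂ :=
  1 - c * R * G * b

/-- The inverse dressing matrix `I + c G R' b`. -/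
def dressingInv (R' G : Matrix n n ℂ) (b : Matrix n (Fin 2) ℂ) (c : Matrix (Fin 2) n ℂ) :
    Matrix (Fin 2) (Fin 2) ℂ :=
  1 + c * G * R' * b

namespace IsDressing

/-- `S` intertwines `E + P` with `E - P`, hence also their inverses. -/
theorem S_R (h : IsDressing A P E S R R' b c) : S * R = R' * S := by
  have h1 : (E - P) * S = S * (E + P) := by
    rw [sub_mul, mul_add, h.S_E, h.S_P, sub_eq_add_neg]
  calc S * R = R' * (E - P) * S * R := by rw [h.R'_left, one_mul]
    _ = R' * ((E - P) * S) * R := by rw [mul_assoc R']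
    _ = R' * S * ((E + P) * R) := by rw [h1]; simp only [mul_assoc]
    _ = R' * S := by rw [h.R_right, mul_one]

theorem S_R' (h : IsDressing A P E S R R' b c) : S * R' = R * S := by
  have h1 := h.S_R
  calc S * R' = S * (R' * S) * S := by rw [mul_assoc, mul_assoc R', h.S_sq, mul_one]
    _ = R * S := by rw [← h1, ← mul_assoc S S R, h.S_sq, one_mul]

/-- The Sylvester equation with a free spectral parameter: the `AE` terms cancel by commutation, and
the `κ` terms cancel because `S` commutes with `E` and anticommutes with `P`. -/
theorem bc_eq (h : IsDressing A P E S R R' b c) (κ : ℂ) :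
    b * c = (A + κ • S) * (E + P) - (E - P) * (A + κ • S) := by
  rw [← h.sylvester]
  simp only [mul_add, add_mul, sub_mul, smul_mul_assoc, mul_smul_comm, h.S_P, h.S_E,
    h.commute_AE]
  module

/-- `bc_eq` multiplied by `RG` on the left and by `GR'` on the right, where `G` is the inverse of
the pencil `A + κS`. -/
theorem resolvent_right (h : IsDressing A P E S R R' b c) (hG : G * (A + κ • S) = 1)
    (hG' : (A + κ • S) * G = 1) : R * G + R * G * (b * c) * (G * R') = G * R' := by
  rw [h.bc_eq κ, mul_sub, sub_mul]
  have h1 : R * G * ((A + κ • S) * (E + P)) * (G * R') = G * R' := by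
    calc _ = R * (G * (A + κ • S)) * (E + P) * (G * R') := by simp only [mul_assoc]
      _ = _ := by rw [hG, mul_one, h.R_left, one_mul]
  have h2 : R * G * ((E - P) * (A + κ • S)) * (G * R') = R * G := by
    calc _ = R * G * (E - P) * ((A + κ • S) * G) * R' := by simp only [mul_assoc]
      _ = _ := by rw [hG', mul_one, mul_assoc, h.R'_right, mul_one]
  rw [h1, h2]
  abel

theorem resolvent_left (h : IsDressing A P E S R R' b c) (hG' : (A + κ • S) * G = 1) :
    R' - R' * (b * c) * (R * G) = (A + κ • S) * R * G := by
  rw [h.bc_eq κ, mul_sub, sub_mul]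
  have h1 : R' * ((A + κ • S) * (E + P)) * (R * G) = R' := by
    calc _ = R' * (A + κ • S) * ((E + P) * R) * G := by simp only [mul_assoc]
      _ = _ := by rw [h.R_right, mul_one, mul_assoc, hG', mul_one]
  have h2 : R' * ((E - P) * (A + κ • S)) * (R * G) = (A + κ • S) * R * G := by
    calc _ = R' * (E - P) * (A + κ • S) * (R * G) := by simp only [mul_assoc]
      _ = _ := by rw [h.R'_left, one_mul, mul_assoc]
  rw [h1, h2]
  abel

/-- Expanding the product leaves exactly the terms of `resolvent_right` between `c` and `b`. -/
theorem dressing_mul_inv (h : IsDressing A P E S R R' b c) (hG : G * (A + κ • S) = 1)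
    (hG' : (A + κ • S) * G = 1) : dressing R G b c * dressingInv R' G b c = 1 := by
  have h1 := congrArg (fun M => c * M * b) (h.resolvent_right hG hG')
  simp only [Matrix.mul_add, Matrix.add_mul] at h1
  have h2 : dressing R G b c * dressingInv R' G b c = 1 + c * (G * R') * b -
      (c * (R * G) * b + c * (R * G * (b * c) * (G * R')) * b) := by
    simp only [dressing, dressingInv, Matrix.sub_mul, Matrix.mul_add, Matrix.one_mul,
      Matrix.mul_one, Matrix.mul_assoc]
    abel
  rw [h2, h1]
  abel

theorem inv_mul_dressing (h : IsDressing A P E S R R' b c) (hG : G * (A + κ • S) = 1)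
    (hG' : (A + κ • S) * G = 1) : dressingInv R' G b c * dressing R G b c = 1 :=
  mul_eq_one_comm.1 (h.dressing_mul_inv hG hG')

theorem resolvent_mul_dressing (h : IsDressing A P E S R R' b c) (hG : G * (A + κ • S) = 1)
    (hG' : (A + κ • S) * G = 1) : R * G * b = G * R' * b * dressing R G b c := by
  have h1 : R * G * b * dressingInv R' G b c = G * R' * b := by
    have := congrArg (· * b) (h.resolvent_right hG hG')
    simp only [Matrix.add_mul] at this
    rw [← this]
    simp only [dressingInv, Matrix.mul_add, Matrix.mul_one, Matrix.mul_assoc]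
  rw [← h1, Matrix.mul_assoc (R * G * b), h.inv_mul_dressing hG hG', Matrix.mul_one]

theorem pencil_mul_resolvent (h : IsDressing A P E S R R' b c) (hG' : (A + κ • S) * G = 1) :
    (A + κ • S) * R * G * b = R' * b * dressing R G b c := by
  rw [← h.resolvent_left hG']
  simp only [dressing, Matrix.sub_mul, Matrix.mul_sub, Matrix.mul_one, Matrix.mul_assoc]

/-- As `AE = EA`, `2AE = A(E+P) + (E+P)A - bc`; each of the first two terms loses one factor `R`.
This evaluates the `z`-derivative of `R` up to sign. -/
theorem two_smul_RER' (h : IsDressing A P E S R R' b c) :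
    R * (2 • (A * E)) * R = R * A + A * R - R * (b * c) * R := by
  have h1 : 2 • (A * E) = A * (E + P) + (E + P) * A - b * c := by
    rw [← h.sylvester, two_smul]
    nth_rewrite 2 [h.commute_AE]
    simp only [mul_add, add_mul]
    abel
  rw [h1, mul_sub, sub_mul, mul_add, add_mul]
  congr 2
  · rw [mul_assoc, mul_assoc, h.R_right, mul_one]
  · rw [← mul_assoc, h.R_left, one_mul]

/-- The potential `c (R + R') b`. -/
def _root_.HeisenbergChain.potential (R R' : Matrix n n ℂ) (b : Matrix n (Fin 2) ℂ)
    (c : Matrix (Fin 2) n ℂ) : Matrix (Fin 2) (Fin 2) ℂ :=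
  c * (R + R') * b

theorem S_G (h : IsDressing A P E S R R' b c) (hG : G * (A + κ • S) = 1)
    (hG' : (A + κ • S) * G = 1) : S * G = G * S := by
  have h1 : S * (A + κ • S) = (A + κ • S) * S := by
    rw [mul_add, add_mul, h.S_A]
    simp
  calc S * G = G * (A + κ • S) * S * G := by rw [hG, one_mul]
    _ = G * (S * (A + κ • S)) * G := by rw [h1]; simp only [mul_assoc]
    _ = G * S * ((A + κ • S) * G) := by simp only [mul_assoc]
    _ = _ := by rw [hG', mul_one]

/-- The spatial part of the Lax pair. -/
theorem lax_space (h : IsDressing A P E S R R' b c) (hG : G * (A + κ • S) = 1)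
    (hG' : (A + κ • S) * G = 1) :
    c * (R * (2 • (A * E)) * R) * G * b =
      potential R R' b c * dressing R G b c +
        κ • (pauli3 * dressing R G b c - dressing R G b c * pauli3) := by
  -- Trading `A` for the pencil leaves a multiple of `S`; moved through `b`, it becomes the right
  -- factor `σ₃`.
  have hAG : A * G = 1 - κ • (S * G) := by
    rw [eq_sub_iff_add_eq, ← hG', add_mul, smul_mul_assoc]
  have h1 : c * (R * A) * G * b = c * R * b + κ • (c * R * G * b * pauli3) := by
    have hs : S * G * b = -(G * b * pauli3) := by
      rw [h.S_G hG hG', Matrix.mul_assoc, h.S_b, Matrix.mul_neg, Matrix.mul_assoc]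
    calc _ = c * R * (A * G * b) := by simp only [Matrix.mul_assoc]
      _ = c * R * (b - κ • (S * G * b)) := by
        rw [hAG, Matrix.sub_mul, Matrix.one_mul, Matrix.smul_mul]
      _ = _ := by
        rw [hs, smul_neg, sub_neg_eq_add, Matrix.mul_add, Matrix.mul_smul]
        simp only [Matrix.mul_assoc]
  -- Here `S` moves left through `c` to become a left factor `σ₃`, and `pencil_mul_resolvent`
  -- produces `R'` together with the dressing matrix.
  have h2 : c * (A * R) * G * b =
      c * R' * b * dressing R G b c - κ • (pauli3 * (c * R * G * b)) := by
    have h3 := congrArg (c * ·) (h.pencil_mul_resolvent hG')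
    have h4 : c * (R' * b * dressing R G b c) = c * R' * b * dressing R G b c := by
      simp only [Matrix.mul_assoc]
    have h5 : pauli3 * (c * R * G * b) = c * (S * R * G * b) := by
      have : c * (S * R * G * b) = c * S * (R * G * b) := by simp only [Matrix.mul_assoc]
      rw [this, h.c_S]
      simp only [Matrix.mul_assoc]
    rw [← h4, ← h3, h5, ← Matrix.mul_smul, ← Matrix.mul_sub, Matrix.mul_assoc, Matrix.mul_assoc]
    congr 1
    simp only [Matrix.add_mul, Matrix.smul_mul, Matrix.mul_assoc]
    abel
  -- This quadratic term completes `cRb` from `h1` to `cRb` times the dressing matrix.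
  have h3 : c * (R * (b * c) * R) * G * b = c * R * b * (c * R * G * b) := by
    simp only [Matrix.mul_assoc]
  rw [h.two_smul_RER', Matrix.mul_sub, Matrix.sub_mul, Matrix.sub_mul, Matrix.mul_add,
    Matrix.add_mul, Matrix.add_mul, h1, h2, h3]
  simp only [potential, dressing, Matrix.mul_sub, Matrix.sub_mul, Matrix.mul_add, Matrix.add_mul,
    Matrix.mul_one, Matrix.one_mul, smul_sub]
  abel

/-- `S` becomes `σ₃` when moved through `c` and `-σ₃` when moved through `b`; hence sums symmetric
under `R ↔ R'` anticommute with `σ₃`. -/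
theorem pauli3_mul_conj (h : IsDressing A P E S R R' b c) {M M' : Matrix n n ℂ}
    (hM : S * M = M' * S) : pauli3 * (c * M * b) = -(c * M' * b * pauli3) := by
  rw [← Matrix.mul_assoc, ← Matrix.mul_assoc, ← h.c_S, Matrix.mul_assoc c, hM, ← Matrix.mul_assoc,
    Matrix.mul_assoc _ S, h.S_b, Matrix.mul_neg]
  simp only [Matrix.mul_assoc]

theorem pauli3_mul_potential (h : IsDressing A P E S R R' b c) :
    pauli3 * potential R R' b c = -(potential R R' b c * pauli3) := by
  refine h.pauli3_mul_conj ?_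
  rw [mul_add, add_mul, h.S_R, h.S_R', add_comm]

/-- The spatial derivative of the potential. -/
def _root_.HeisenbergChain.potentialDeriv (A E R R' : Matrix n n ℂ) (b : Matrix n (Fin 2) ℂ)
    (c : Matrix (Fin 2) n ℂ) : Matrix (Fin 2) (Fin 2) ℂ :=
  -(c * (R * (2 • (A * E)) * R + R' * (2 • (A * E)) * R') * b)

theorem S_RAER (h : IsDressing A P E S R R' b c) (k : ℕ) :
    S * (R * (k • (A * E)) * R) = R' * (k • (A * E)) * R' * S := by
  have h1 : S * (k • (A * E)) = k • (A * E) * S := by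
    rw [mul_smul_comm, smul_mul_assoc, ← mul_assoc, h.S_A, mul_assoc, h.S_E, mul_assoc]
  rw [← mul_assoc, ← mul_assoc, h.S_R, mul_assoc R', h1]
  simp only [mul_assoc, h.S_R]

theorem S_R'AER' (h : IsDressing A P E S R R' b c) (k : ℕ) :
    S * (R' * (k • (A * E)) * R') = R * (k • (A * E)) * R * S := by
  have h1 : S * (k • (A * E)) = k • (A * E) * S := by
    rw [mul_smul_comm, smul_mul_assoc, ← mul_assoc, h.S_A, mul_assoc, h.S_E, mul_assoc]
  rw [← mul_assoc, ← mul_assoc, h.S_R', mul_assoc R, h1]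
  simp only [mul_assoc, h.S_R']

theorem pauli3_mul_potentialDeriv (h : IsDressing A P E S R R' b c) :
    pauli3 * potentialDeriv A E R R' b c = -(potentialDeriv A E R R' b c * pauli3) := by
  rw [potentialDeriv, Matrix.mul_neg, Matrix.neg_mul, neg_inj]
  refine h.pauli3_mul_conj ?_
  rw [mul_add, add_mul, h.S_RAER, h.S_R'AER', add_comm]

/-- The temporal part of the Lax pair at the spectral parameter `0`. -/
theorem lax_time (h : IsDressing A P E S R R' b c) (hG : G * A = 1) (hG' : A * G = 1) :
    c * (R * (S * A * (A * E)) * R) * G * b =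
      c * (R * S * (A * E) * R') * b * dressing R G b c := by
  have hG1 : G * (A + (0 : ℂ) • S) = 1 := by rw [zero_smul, add_zero, hG]
  have hG2 : (A + (0 : ℂ) • S) * G = 1 := by rw [zero_smul, add_zero, hG']
  calc _ = c * (R * S * A * (A * E)) * (R * G * b) := by simp only [Matrix.mul_assoc]
    -- The factor `A` next to the resolvent now meets `G` and cancels it, so the dressing matrix
    -- splits off on the right.
    _ = c * (R * S * A * (A * E)) * (G * R' * b * dressing R G b c) := by
      rw [h.resolvent_mul_dressing hG1 hG2]
    _ = c * (R * S * (A * (A * E) * G)) * (R' * b * dressing R G b c) := by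
      simp only [Matrix.mul_assoc]
    _ = c * (R * S * (A * E)) * (R' * b * dressing R G b c) := by
      have : A * (A * E) * G = A * E := by
        rw [h.commute_AE, ← mul_assoc, h.commute_AE, mul_assoc (E * A), hG', mul_one]
      rw [this]
    _ = _ := by simp only [Matrix.mul_assoc]

/-- Multiplication by `σ₃` on the left turns the outer `R` into `R'`, and on the right the outer
`R'` into `R`. The two results are the halves of `-V_z`. -/
theorem commutator_lax_time (h : IsDressing A P E S R R' b c) :
    2 • (pauli3 * (c * (R * S * (A * E) * R') * b) - c * (R * S * (A * E) * R') * b * pauli3) =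
      -potentialDeriv A E R R' b c := by
  have hAE : S * (A * E) = A * E * S := by
    rw [← mul_assoc, h.S_A, mul_assoc, h.S_E, mul_assoc]
  have h1 : pauli3 * (c * (R * S * (A * E) * R') * b) = c * (R' * (A * E) * R') * b := by
    have hs : S * (R * S * (A * E) * R') = R' * (A * E) * R' := by
      calc _ = S * R * S * (A * E) * R' := by simp only [mul_assoc]
        _ = _ := by rw [h.S_R, mul_assoc R' S S, h.S_sq, mul_one]
    rw [← Matrix.mul_assoc, ← Matrix.mul_assoc, ← h.c_S, Matrix.mul_assoc c, hs]
  have h2 : c * (R * S * (A * E) * R') * b * pauli3 = -(c * (R * (A * E) * R) * b) := by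
    have hs : R * S * (A * E) * R' * S = R * (A * E) * R := by
      rw [mul_assoc _ R' S, ← h.S_R, ← mul_assoc _ S R, mul_assoc R S, hAE]
      rw [mul_assoc R, mul_assoc (A * E), h.S_sq, mul_one]
    rw [Matrix.mul_assoc _ b, ← neg_neg (b * pauli3), ← h.S_b, Matrix.mul_neg, ← hs]
    simp only [Matrix.mul_assoc]
  rw [h1, h2, potentialDeriv, neg_neg, sub_neg_eq_add, ← Matrix.add_mul, ← Matrix.mul_add,
    ← Matrix.smul_mul, ← Matrix.mul_smul, smul_add]
  congr 2
  rw [add_comm]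
  simp only [mul_smul_comm, smul_mul_assoc]

end IsDressing

end Dressing

/-! ### The dressing matrix of a triplet -/

section Concrete

variable {q : ℕ} {A : Matrix (Fin q) (Fin q) ℂ} {B : Matrix (Fin q) (Fin 1) ℂ}
  {C : Matrix (Fin 1) (Fin q) ℂ}

/-- `diag(I, -I)`. -/
def signS (q : ℕ) : Matrix (Fin q ⊕ Fin q) (Fin q ⊕ Fin q) ℂ := Matrix.fromBlocks 1 0 0 (-1)

/-- `(E - 𝒫)⁻¹`. -/
noncomputable def resR' (A : Matrix (Fin q) (Fin q) ℂ) (B : Matrix (Fin q) (Fin 1) ℂ)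
    (C : Matrix (Fin 1) (Fin q) ℂ) (z t : ℝ) : Matrix (Fin q ⊕ Fin q) (Fin q ⊕ Fin q) ℂ :=
  (phaseE A z t - calP A B C)⁻¹

theorem signS_sq (q : ℕ) : signS q * signS q = 1 := by
  simp [signS, Matrix.fromBlocks_multiply]

theorem signS_mul_calA (A : Matrix (Fin q) (Fin q) ℂ) : signS q * calA A = calA A * signS q := by
  simp [signS, calA, Matrix.fromBlocks_multiply]

theorem timeGenerator_eq (A : Matrix (Fin q) (Fin q) ℂ) :
    timeGenerator A = -((4 * Complex.I) • (signS q * calA A * calA A)) := by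
  simp [timeGenerator, signS, calA, Matrix.fromBlocks_multiply, Matrix.fromBlocks_smul,
    Matrix.fromBlocks_neg, pow_two]

theorem commute_calA_timeGenerator (A : Matrix (Fin q) (Fin q) ℂ) :
    Commute (calA A) (timeGenerator A) := by
  rw [timeGenerator_eq]
  have h : Commute (calA A) (signS q) := (signS_mul_calA A).symm
  exact (((h.mul_right (Commute.refl _)).mul_right (Commute.refl _)).smul_right _).neg_right

theorem commute_signS_timeGenerator (A : Matrix (Fin q) (Fin q) ℂ) :
    Commute (signS q) (timeGenerator A) := by
  rw [timeGenerator_eq]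
  have h : Commute (signS q) (calA A) := signS_mul_calA A
  exact ((((Commute.refl _).mul_right h).mul_right h).smul_right _).neg_right

theorem commute_calA_phaseE (A : Matrix (Fin q) (Fin q) ℂ) (z t : ℝ) :
    Commute (calA A) (phaseE A z t) :=
  (commute_expNeg (Commute.refl _) _).mul_right (commute_expNeg (commute_calA_timeGenerator A) _)

theorem commute_signS_phaseE (A : Matrix (Fin q) (Fin q) ℂ) (z t : ℝ) :
    Commute (signS q) (phaseE A z t) :=
  (commute_expNeg (signS_mul_calA A) _).mul_right (commute_expNeg (commute_signS_timeGenerator A) _)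

theorem signS_mul_calP (A : Matrix (Fin q) (Fin q) ℂ) (B : Matrix (Fin q) (Fin 1) ℂ)
    (C : Matrix (Fin 1) (Fin q) ℂ) : signS q * calP A B C = -(calP A B C * signS q) := by
  rw [calP_eq]
  simp [signS, Matrix.fromBlocks_multiply, Matrix.fromBlocks_neg]

theorem phaseE_sub_calP (A : Matrix (Fin q) (Fin q) ℂ) (B : Matrix (Fin q) (Fin 1) ℂ)
    (C : Matrix (Fin 1) (Fin q) ℂ) (z t : ℝ) :
    phaseE A z t - calP A B C = signS q * (phaseE A z t + calP A B C) * signS q := by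
  rw [mul_add, add_mul, (commute_signS_phaseE A z t).eq, signS_mul_calP, mul_assoc, signS_sq,
    mul_one, neg_mul, mul_assoc, signS_sq, mul_one, sub_eq_add_neg]

theorem IsMinimalTriplet.isUnit_det_phaseE_sub_calP (h : IsMinimalTriplet A B C) (z t : ℝ) :
    IsUnit (phaseE A z t - calP A B C).det := by
  have hs : IsUnit (signS q).det := Matrix.isUnit_det_of_right_inverse (signS_sq q)
  rw [phaseE_sub_calP, Matrix.det_mul, Matrix.det_mul]
  exact (hs.mul (h.isUnit_det_phaseE_add_calP z t)).mul hs

theorem calC_mul_signS (B : Matrix (Fin q) (Fin 1) ℂ) (C : Matrix (Fin 1) (Fin q) ℂ) :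
    calC B C * signS q = pauli3 * calC B C := by
  ext i j
  fin_cases i <;> rcases j with j | j <;>
    simp [calC, signS, pauli3, Matrix.mul_apply, Fintype.sum_sum_type, Matrix.one_apply,
      Fin.sum_univ_two]

theorem signS_mul_calB (B : Matrix (Fin q) (Fin 1) ℂ) (C : Matrix (Fin 1) (Fin q) ℂ) :
    signS q * calB B C = -(calB B C * pauli3) := by
  ext i j
  rcases i with i | i <;> fin_cases j <;>
    simp [calB, signS, pauli3, Matrix.mul_apply, Fintype.sum_sum_type, Matrix.one_apply,
      Fin.sum_univ_two]

theorem IsMinimalTriplet.isDressing (h : IsMinimalTriplet A B C) (z t : ℝ) :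
    IsDressing (calA A) (calP A B C) (phaseE A z t) (signS q) (resR A B C z t) (resR' A B C z t)
      (calB B C) (calC B C) where
  sylvester := (sylvester_calP h.eigenvalues B C _).2 rfl
  commute_AE := (commute_calA_phaseE A z t).eq
  S_sq := signS_sq q
  S_A := signS_mul_calA A
  S_E := (commute_signS_phaseE A z t).eq
  S_P := signS_mul_calP A B C
  c_S := calC_mul_signS B C
  S_b := signS_mul_calB B C
  R_left := Matrix.nonsing_inv_mul _ (h.isUnit_det_phaseE_add_calP z t)
  R_right := Matrix.mul_nonsing_inv _ (h.isUnit_det_phaseE_add_calP z t)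
  R'_left := Matrix.nonsing_inv_mul _ (h.isUnit_det_phaseE_sub_calP z t)
  R'_right := Matrix.mul_nonsing_inv _ (h.isUnit_det_phaseE_sub_calP z t)

/-- The pencil `𝒜 + κ S`. -/
noncomputable def pencil (A : Matrix (Fin q) (Fin q) ℂ) (κ : ℂ) :
    Matrix (Fin q ⊕ Fin q) (Fin q ⊕ Fin q) ℂ :=
  calA A + κ • signS q

theorem pencil_eq (A : Matrix (Fin q) (Fin q) ℂ) (κ : ℂ) :
    pencil A κ = Matrix.fromBlocks (A + κ • 1) 0 0 (Aᴴ + (-κ) • 1) := by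
  simp [pencil, calA, signS, Matrix.fromBlocks_smul, Matrix.fromBlocks_add]

/-- The blocks are `A + κ` and `A† - κ`; an imaginary shift keeps both spectra in the open right
half-plane. -/
theorem isUnit_det_pencil (h : EigenvaluesInRightHalfPlane A) {κ : ℂ} (hκ : κ.re = 0) :
    IsUnit (pencil A κ).det := by
  rw [pencil_eq, Matrix.det_fromBlocks_zero₂₁]
  exact (isUnit_add_smul_of_spectrum h (by simp [hκ])).mul
    (isUnit_add_smul_of_spectrum h.conjTranspose (by simp [hκ]))

/-- The dressing matrix of the triplet at the spectral parameter `κ`. -/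
noncomputable def waveW (A : Matrix (Fin q) (Fin q) ℂ) (B : Matrix (Fin q) (Fin 1) ℂ)
    (C : Matrix (Fin 1) (Fin q) ℂ) (κ : ℂ) (z t : ℝ) : Matrix (Fin 2) (Fin 2) ℂ :=
  dressing (resR A B C z t) (pencil A κ)⁻¹ (calB B C) (calC B C)

/-- At `κ = 0` the pencil is `𝒜`, so the dressing algebra applies to `I + L̃`. -/
theorem IsMinimalTriplet.one_add_tildeL (h : IsMinimalTriplet A B C) (z t : ℝ) :
    1 + tildeL A B (HeisenbergChain.evolvedC A C t) z = waveW A B C 0 z t := by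
  rw [h.tildeL_evolvedC, waveW, dressing, pencil, zero_smul, add_zero, sub_eq_add_neg]

theorem IsMinimalTriplet.isUnit_det_waveW (h : IsMinimalTriplet A B C) {κ : ℂ} (hκ : κ.re = 0)
    (z t : ℝ) : IsUnit (waveW A B C κ z t).det :=
  Matrix.isUnit_det_of_right_inverse ((h.isDressing z t).dressing_mul_inv (κ := κ)
    (Matrix.nonsing_inv_mul _ (isUnit_det_pencil h.eigenvalues hκ))
    (Matrix.mul_nonsing_inv _ (isUnit_det_pencil h.eigenvalues hκ)))

/-! ### Smoothness and derivatives -/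

theorem matSmooth_phaseE (A : Matrix (Fin q) (Fin q) ℂ) :
    MatSmooth (fun p : ℝ × ℝ => phaseE A p.1 p.2) :=
  ((matSmooth_expNeg (calA A)).comp (contDiff_const.mul contDiff_fst)).mul
    ((matSmooth_expNeg (timeGenerator A)).comp contDiff_snd)

theorem IsMinimalTriplet.matSmooth_waveW (h : IsMinimalTriplet A B C) (κ : ℂ) :
    MatSmooth (fun p : ℝ × ℝ => waveW A B C κ p.1 p.2) := by
  have hR : MatSmooth (fun p : ℝ × ℝ => resR A B C p.1 p.2) :=
    ((matSmooth_phaseE A).add (MatSmooth.const _)).inv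
      fun p => h.isUnit_det_phaseE_add_calP p.1 p.2
  exact (MatSmooth.const _).sub ((((MatSmooth.const _).mul hR).mul (MatSmooth.const _)).mul
    (MatSmooth.const _))

theorem contDiff_prodMk_left (t : ℝ) : ContDiff ℝ (⊤ : ℕ∞) fun z : ℝ => (z, t) :=
  contDiff_id.prodMk contDiff_const

theorem contDiff_prodMk_right (z : ℝ) : ContDiff ℝ (⊤ : ℕ∞) fun t : ℝ => (z, t) :=
  contDiff_const.prodMk contDiff_id

theorem matHasDerivAt_phaseE_space (A : Matrix (Fin q) (Fin q) ℂ) (z t : ℝ) :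
    MatHasDerivAt (fun z => phaseE A z t) (2 • (calA A * phaseE A z t)) z := by
  have h1 : HasDerivAt (fun z : ℝ => -2 * z) (-2) z := by
    simpa using (hasDerivAt_id z).const_mul (-2 : ℝ)
  refine (((matHasDerivAt_expNeg (calA A) (-2 * z)).scomp h1).mul_const _).congr_deriv ?_
  rw [phaseE, smul_neg, ← neg_smul, Matrix.smul_mul, Matrix.mul_assoc, two_smul]
  push_cast
  rw [neg_neg, two_smul]

theorem matHasDerivAt_phaseE_time (A : Matrix (Fin q) (Fin q) ℂ) (z t : ℝ) :
    MatHasDerivAt (fun t => phaseE A z t)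
      ((4 * Complex.I) • (signS q * calA A * (calA A * phaseE A z t))) t := by
  refine ((matHasDerivAt_expNeg (timeGenerator A) t).const_mul _).congr_deriv ?_
  have h1 := (commute_expNeg (commute_calA_timeGenerator A).symm (-2 * z)).eq
  rw [Matrix.mul_neg, ← Matrix.mul_assoc, ← h1, phaseE]
  nth_rewrite 1 [timeGenerator_eq]
  simp only [Matrix.neg_mul, neg_neg, Matrix.smul_mul, Matrix.mul_assoc]

theorem MatHasDerivAt.dressing {n : Type*} [Fintype n] {R : ℝ → Matrix n n ℂ} {D : Matrix n n ℂ}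
    {x : ℝ} (hR : MatHasDerivAt R (-(R x * D * R x)) x) (G : Matrix n n ℂ)
    (b : Matrix n (Fin 2) ℂ) (c : Matrix (Fin 2) n ℂ) :
    MatHasDerivAt (fun x => HeisenbergChain.dressing (R x) G b c) (c * (R x * D * R x) * G * b) x := by
  refine ((MatHasDerivAt.const 1 x).sub (((hR.const_mul c).mul_const G).mul_const b)).congr_deriv ?_
  simp only [Matrix.mul_neg, Matrix.neg_mul, sub_neg_eq_add, zero_add]

theorem IsMinimalTriplet.matHasDerivAt_resR_space (h : IsMinimalTriplet A B C) (z t : ℝ) :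
    MatHasDerivAt (fun z => resR A B C z t)
      (-(resR A B C z t * (2 • (calA A * phaseE A z t)) * resR A B C z t)) z := by
  have h1 := (matHasDerivAt_phaseE_space A z t).add (MatHasDerivAt.const (calP A B C) z)
  rw [add_zero] at h1
  exact MatHasDerivAt.inv
    (((matSmooth_phaseE A).comp (contDiff_prodMk_left t)).add (MatSmooth.const _)) h1
    fun y => h.isUnit_det_phaseE_add_calP y t

theorem IsMinimalTriplet.matHasDerivAt_resR_time (h : IsMinimalTriplet A B C) (z t : ℝ) :
    MatHasDerivAt (fun t => resR A B C z t)
      (-(resR A B C z t * ((4 * Complex.I) • (signS q * calA A * (calA A * phaseE A z t))) *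
        resR A B C z t)) t := by
  have h1 := (matHasDerivAt_phaseE_time A z t).add (MatHasDerivAt.const (calP A B C) t)
  rw [add_zero] at h1
  exact MatHasDerivAt.inv
    (((matSmooth_phaseE A).comp (contDiff_prodMk_right z)).add (MatSmooth.const _)) h1
    fun y => h.isUnit_det_phaseE_add_calP z y

theorem IsMinimalTriplet.matHasDerivAt_resR'_space (h : IsMinimalTriplet A B C) (z t : ℝ) :
    MatHasDerivAt (fun z => resR' A B C z t)
      (-(resR' A B C z t * (2 • (calA A * phaseE A z t)) * resR' A B C z t)) z := by
  have h1 := (matHasDerivAt_phaseE_space A z t).sub (MatHasDerivAt.const (calP A B C) z)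
  rw [sub_zero] at h1
  exact MatHasDerivAt.inv
    (((matSmooth_phaseE A).comp (contDiff_prodMk_left t)).sub (MatSmooth.const _)) h1
    fun y => h.isUnit_det_phaseE_sub_calP y t

/-- The Zakharov–Shabat potential of the triplet. -/
noncomputable def pot (A : Matrix (Fin q) (Fin q) ℂ) (B : Matrix (Fin q) (Fin 1) ℂ)
    (C : Matrix (Fin 1) (Fin q) ℂ) (z t : ℝ) : Matrix (Fin 2) (Fin 2) ℂ :=
  potential (resR A B C z t) (resR' A B C z t) (calB B C) (calC B C)

/-- The spatial derivative of `pot`. -/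
noncomputable def potDeriv (A : Matrix (Fin q) (Fin q) ℂ) (B : Matrix (Fin q) (Fin 1) ℂ)
    (C : Matrix (Fin 1) (Fin q) ℂ) (z t : ℝ) : Matrix (Fin 2) (Fin 2) ℂ :=
  potentialDeriv (calA A) (phaseE A z t) (resR A B C z t) (resR' A B C z t) (calB B C) (calC B C)

/-- The generator of the time evolution of the dressing matrix at spectral parameter `0`. -/
noncomputable def timePot (A : Matrix (Fin q) (Fin q) ℂ) (B : Matrix (Fin q) (Fin 1) ℂ)
    (C : Matrix (Fin 1) (Fin q) ℂ) (z t : ℝ) : Matrix (Fin 2) (Fin 2) ℂ :=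
  calC B C * (resR A B C z t * signS q * (calA A * phaseE A z t) * resR' A B C z t) * calB B C

theorem IsMinimalTriplet.matHasDerivAt_waveW_space (h : IsMinimalTriplet A B C) {κ : ℂ}
    (hκ : κ.re = 0) (z t : ℝ) :
    MatHasDerivAt (fun z => waveW A B C κ z t)
      (pot A B C z t * waveW A B C κ z t +
        κ • (pauli3 * waveW A B C κ z t - waveW A B C κ z t * pauli3)) z := by
  have hu := isUnit_det_pencil h.eigenvalues hκ
  exact ((h.matHasDerivAt_resR_space z t).dressing _ _ _).congr_deriv
    ((h.isDressing z t).lax_space (Matrix.nonsing_inv_mul _ hu) (Matrix.mul_nonsing_inv _ hu))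

theorem IsMinimalTriplet.matHasDerivAt_waveW_time (h : IsMinimalTriplet A B C) (z t : ℝ) :
    MatHasDerivAt (fun t => waveW A B C 0 z t)
      ((4 * Complex.I) • timePot A B C z t * waveW A B C 0 z t) t := by
  have hu := isUnit_det_calA h.eigenvalues
  have hp : pencil A 0 = calA A := by rw [pencil, zero_smul, add_zero]
  refine ((h.matHasDerivAt_resR_time z t).dressing _ _ _).congr_deriv ?_
  have h1 := (h.isDressing z t).lax_time (Matrix.nonsing_inv_mul _ hu)
    (Matrix.mul_nonsing_inv _ hu)
  rw [waveW, hp, timePot, Matrix.smul_mul, ← h1]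
  simp only [Matrix.mul_smul, Matrix.smul_mul]

theorem IsMinimalTriplet.matHasDerivAt_pot (h : IsMinimalTriplet A B C) (z t : ℝ) :
    MatHasDerivAt (fun z => pot A B C z t) (potDeriv A B C z t) z := by
  refine ((((h.matHasDerivAt_resR_space z t).add
    (h.matHasDerivAt_resR'_space z t)).const_mul _).mul_const _).congr_deriv ?_
  rw [potDeriv, potentialDeriv, ← neg_add, Matrix.mul_neg, Matrix.neg_mul]

/-! ### Unitarity -/

/-- The symplectic unit `(0, -I; I, 0)`. -/
def sympX (q : ℕ) : Matrix (Fin q ⊕ Fin q) (Fin q ⊕ Fin q) ℂ := Matrix.fromBlocks 0 (-1) 1 0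

theorem sympX_sq (q : ℕ) : sympX q * sympX q = -1 := by
  rw [← Matrix.fromBlocks_one, Matrix.fromBlocks_neg]
  simp [sympX, Matrix.fromBlocks_multiply]

theorem sympX_mul_calA (A : Matrix (Fin q) (Fin q) ℂ) :
    sympX q * calA A = (calA A)ᴴ * sympX q := by
  simp [sympX, calA, Matrix.fromBlocks_multiply, Matrix.fromBlocks_conjTranspose]

theorem sympX_mul_timeGenerator (A : Matrix (Fin q) (Fin q) ℂ) :
    sympX q * timeGenerator A = (timeGenerator A)ᴴ * sympX q := by
  simp [sympX, timeGenerator, Matrix.fromBlocks_multiply, Matrix.fromBlocks_conjTranspose,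
    Matrix.conjTranspose_smul, Matrix.conjTranspose_pow]

/-- The adjoint reverses the two exponential factors of `E`, which commute. -/
theorem sympX_mul_phaseE (A : Matrix (Fin q) (Fin q) ℂ) (z t : ℝ) :
    sympX q * phaseE A z t = (phaseE A z t)ᴴ * sympX q := by
  have h1 := intertwine_expNeg (sympX_mul_calA A) (-2 * z)
  have h2 := intertwine_expNeg (sympX_mul_timeGenerator A) t
  have h3 := (commute_expNeg (commute_expNeg (commute_calA_timeGenerator A) t).symm (-2 * z)).eq
  rw [phaseE, ← h3, ← mul_assoc, h2, mul_assoc, h1, ← mul_assoc, Matrix.conjTranspose_mul,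
    expNeg_conjTranspose, expNeg_conjTranspose, ← Matrix.conjTranspose_mul,
    ← Matrix.conjTranspose_mul, h3]

theorem sympX_mul_calP (A : Matrix (Fin q) (Fin q) ℂ) (B : Matrix (Fin q) (Fin 1) ℂ)
    (C : Matrix (Fin 1) (Fin q) ℂ) :
    sympX q * calP A B C = -((calP A B C)ᴴ * sympX q) := by
  have hQ := (gramQ_isHermitian A C).eq
  have hN : (gramN A B)ᴴ = gramN A B := by
    rw [gramN_eq]
    exact (gramQ_isHermitian _ _).eq
  rw [calP_eq]
  simp [sympX, Matrix.fromBlocks_multiply, Matrix.fromBlocks_conjTranspose,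
    Matrix.fromBlocks_neg, hQ, hN]

theorem calB_conjTranspose (B : Matrix (Fin q) (Fin 1) ℂ) (C : Matrix (Fin 1) (Fin q) ℂ) :
    (calB B C)ᴴ = calC B C * sympX q := by
  ext i j
  fin_cases i <;> rcases j with j | j <;>
    simp [calB, calC, sympX, Matrix.mul_apply, Fintype.sum_sum_type, Matrix.one_apply]

theorem calC_conjTranspose (B : Matrix (Fin q) (Fin 1) ℂ) (C : Matrix (Fin 1) (Fin q) ℂ) :
    (calC B C)ᴴ = sympX q * calB B C := by
  ext i j
  rcases i with i | i <;> fin_cases j <;>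
    simp [calB, calC, sympX, Matrix.mul_apply, Fintype.sum_sum_type, Matrix.one_apply]

/-- Conjugation by the symplectic unit `X` exchanges `ℬ` and `𝒞` with their adjoints and sends `𝒫`
to `-𝒫†`, so the adjoint of `W₀` is its inverse dressing matrix. -/
theorem IsMinimalTriplet.waveW_conjTranspose_mul (h : IsMinimalTriplet A B C) (z t : ℝ) :
    (waveW A B C 0 z t)ᴴ * waveW A B C 0 z t = 1 := by
  have hu := isUnit_det_calA h.eigenvalues
  have hp : pencil A 0 = calA A := by rw [pencil, zero_smul, add_zero]
  have hd := h.isDressing z t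
  set R := resR A B C z t
  set R' := resR' A B C z t
  have hG : (calA A)⁻¹ * (calA A + (0 : ℂ) • signS q) = 1 := by
    rw [zero_smul, add_zero, Matrix.nonsing_inv_mul _ hu]
  have hG' : (calA A + (0 : ℂ) • signS q) * (calA A)⁻¹ = 1 := by
    rw [zero_smul, add_zero, Matrix.mul_nonsing_inv _ hu]
  have hA : ((calA A)⁻¹)ᴴ * sympX q = sympX q * (calA A)⁻¹ := by
    calc _ = ((calA A)⁻¹)ᴴ * (sympX q * calA A) * (calA A)⁻¹ := by
          rw [mul_assoc, mul_assoc, Matrix.mul_nonsing_inv _ hu, mul_one]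
      _ = _ := by
          rw [sympX_mul_calA, ← mul_assoc, ← Matrix.conjTranspose_mul, Matrix.mul_nonsing_inv _ hu,
            Matrix.conjTranspose_one, one_mul]
  -- `X` intertwines `E - 𝒫` with `(E + 𝒫)†`, hence `R'` with `R†`.
  have hR : Rᴴ * sympX q = sympX q * R' := by
    have h1 : sympX q * (phaseE A z t - calP A B C) =
        (phaseE A z t + calP A B C)ᴴ * sympX q := by
      rw [mul_sub, sympX_mul_phaseE, sympX_mul_calP, sub_neg_eq_add, ← add_mul,
        Matrix.conjTranspose_add]
    calc _ = Rᴴ * (sympX q * (phaseE A z t - calP A B C)) * R' := by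
          rw [mul_assoc, mul_assoc, hd.R'_right, mul_one]
      _ = _ := by
          rw [h1, ← mul_assoc, ← Matrix.conjTranspose_mul, hd.R_right,
            Matrix.conjTranspose_one, one_mul]
  have hW : (waveW A B C 0 z t)ᴴ = dressingInv R' (calA A)⁻¹ (calB B C) (calC B C) := by
    rw [waveW, hp, dressing, Matrix.conjTranspose_sub, Matrix.conjTranspose_one,
      Matrix.conjTranspose_mul, Matrix.conjTranspose_mul, Matrix.conjTranspose_mul,
      calB_conjTranspose, calC_conjTranspose, dressingInv, sub_eq_add_neg]
    congr 1
    -- The sign of `X² = -1` turns the minus of `dressing` into the plus of `dressingInv`.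
    have h1 : sympX q * ((calA A)⁻¹ᴴ * (Rᴴ * sympX q)) = -((calA A)⁻¹ * R') := by
      rw [hR, ← mul_assoc ((calA A)⁻¹ᴴ), hA, ← mul_assoc, ← mul_assoc, sympX_sq, neg_mul, one_mul,
        neg_mul]
    calc _ = -(calC B C * (sympX q * ((calA A)⁻¹ᴴ * (Rᴴ * sympX q))) * calB B C) := by
          simp only [Matrix.mul_assoc]
          rfl
      _ = _ := by
          rw [h1, Matrix.mul_neg, Matrix.neg_mul, neg_neg]
          simp only [Matrix.mul_assoc]
  rw [hW, waveW, hp]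
  exact hd.inv_mul_dressing hG hG'

theorem IsMinimalTriplet.waveW_inv (h : IsMinimalTriplet A B C) (z t : ℝ) :
    (waveW A B C 0 z t)⁻¹ = (waveW A B C 0 z t)ᴴ :=
  Matrix.inv_eq_left_inv (h.waveW_conjTranspose_mul z t)

end Concrete

/-! ### Vectors and Pauli matrices -/

section Pauli

/-- The vector `m` with `m · σ = M`, for `M` hermitian of trace zero. -/
def spinVec (M : Matrix (Fin 2) (Fin 2) ℂ) : Fin 3 → ℝ := ![(M 1 0).re, (M 1 0).im, (M 0 0).re]

theorem pauliDot_eq (m : Fin 3 → ℝ) :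
    pauliDot m = !![(m 2 : ℂ), m 0 - Complex.I * m 1; m 0 + Complex.I * m 1, -(m 2 : ℂ)] := by
  ext i j
  fin_cases i <;> fin_cases j <;> simp [pauliDot, pauli3] <;> ring

theorem spinVec_pauliDot (m : Fin 3 → ℝ) : spinVec (pauliDot m) = m := by
  funext i
  fin_cases i <;> simp [spinVec, pauliDot_eq]

theorem pauliDot_spinVec {M : Matrix (Fin 2) (Fin 2) ℂ} (hM : Mᴴ = M) (ht : M.trace = 0) :
    pauliDot (spinVec M) = M := by
  have h00 : conj (M 0 0) = M 0 0 := congrFun (congrFun hM 0) 0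
  have h01 : conj (M 1 0) = M 0 1 := congrFun (congrFun hM 0) 1
  have h11 : M 1 1 = -M 0 0 := by
    rw [Matrix.trace_fin_two] at ht
    exact eq_neg_of_add_eq_zero_right ht
  have hre : ((M 0 0).re : ℂ) = M 0 0 := Complex.conj_eq_iff_re.1 h00
  rw [pauliDot_eq]
  ext i j
  fin_cases i <;> fin_cases j
  · simpa [spinVec] using hre
  · apply Complex.ext <;> simp [spinVec, ← h01]
  · apply Complex.ext <;> simp [spinVec]
  · simp [spinVec, h11, hre]

theorem pauliDot_cross (m n : Fin 3 → ℝ) :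
    pauliDot (crossProduct m n) =
      (-(Complex.I / 2)) • (pauliDot m * pauliDot n - pauliDot n * pauliDot m) := by
  simp only [pauliDot_eq]
  ext i j
  fin_cases i <;> fin_cases j <;>
    simp [cross_apply] <;> ring_nf <;> simp only [Complex.I_sq] <;> ring

theorem norm_sq_of_pauliDot_sq {m : Fin 3 → ℝ} (h : pauliDot m * pauliDot m = 1) :
    m 0 ^ 2 + m 1 ^ 2 + m 2 ^ 2 = 1 := by
  have h1 := congrFun (congrFun h 0) 0
  simp only [pauliDot_eq, Matrix.mul_apply, Fin.sum_univ_two, Matrix.of_apply,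
    Matrix.cons_val_zero, Matrix.cons_val_one, Matrix.one_apply_eq] at h1
  have h2 : ((m 0 ^ 2 + m 1 ^ 2 + m 2 ^ 2 : ℝ) : ℂ) = 1 := by
    push_cast
    linear_combination h1 + (m 1 : ℂ) ^ 2 * Complex.I_sq
  exact_mod_cast h2

theorem MatHasDerivAt.spinVec {M : ℝ → Matrix (Fin 2) (Fin 2) ℂ} {M' : Matrix (Fin 2) (Fin 2) ℂ}
    {x : ℝ} (h : MatHasDerivAt M M' x) :
    HasDerivAt (fun y => HeisenbergChain.spinVec (M y)) (HeisenbergChain.spinVec M') x := by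
  have hre : ∀ i j, HasDerivAt (fun y => (M y i j).re) (M' i j).re x := fun i j =>
    Complex.reCLM.hasFDerivAt.comp_hasDerivAt x (h i j)
  have him : ∀ i j, HasDerivAt (fun y => (M y i j).im) (M' i j).im x := fun i j =>
    Complex.imCLM.hasFDerivAt.comp_hasDerivAt x (h i j)
  refine hasDerivAt_pi.2 fun i => ?_
  fin_cases i
  · exact hre 1 0
  · exact him 1 0
  · exact hre 0 0

theorem matHasDerivAt_pauliDot {m : ℝ → Fin 3 → ℝ} {m' : Fin 3 → ℝ} {x : ℝ}
    (h : HasDerivAt m m' x) : MatHasDerivAt (fun y => pauliDot (m y)) (pauliDot m') x := by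
  have h1 : ∀ i, HasDerivAt (fun y => (m y i : ℂ)) (m' i : ℂ) x := fun i =>
    ((hasDerivAt_pi.1 h) i).ofReal_comp
  intro i j
  simp only [pauliDot_eq]
  fin_cases i <;> fin_cases j
  · exact h1 2
  · exact (h1 0).sub ((h1 1).const_mul Complex.I)
  · exact (h1 0).add ((h1 1).const_mul Complex.I)
  · exact (h1 2).neg

/-- Differentiating the identity `pauliDot (spinVec (M y)) = M y` shows that the derivative is again
of the form `n · σ` with `n` real. -/
theorem pauliDot_spinVec_deriv {M : ℝ → Matrix (Fin 2) (Fin 2) ℂ}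
    {M' : Matrix (Fin 2) (Fin 2) ℂ} {x : ℝ} (hM : ∀ y, pauliDot (spinVec (M y)) = M y)
    (h : MatHasDerivAt M M' x) : pauliDot (spinVec M') = M' := by
  have h1 := matHasDerivAt_pauliDot h.spinVec
  simp only [hM] at h1
  exact h1.unique h

end Pauli

/-! ### The solution of the Heisenberg ferromagnet equation -/

section Solution

variable {q : ℕ} {A : Matrix (Fin q) (Fin q) ℂ} {B : Matrix (Fin q) (Fin 1) ℂ}
  {C : Matrix (Fin 1) (Fin q) ℂ}

/-- The derivative of a gauge-transformed matrix. -/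
theorem MatHasDerivAt.gauge {W K : ℝ → Matrix (Fin 2) (Fin 2) ℂ} {V K' : Matrix (Fin 2) (Fin 2) ℂ}
    {x : ℝ} (hs : MatSmooth W) (hu : ∀ y, IsUnit (W y).det) (hW : MatHasDerivAt W (V * W x) x)
    (hK : MatHasDerivAt K K' x) :
    MatHasDerivAt (fun y => (W y)⁻¹ * K y * W y) ((W x)⁻¹ * (K' + K x * V - V * K x) * W x) x := by
  refine (((MatHasDerivAt.inv hs hW hu).mul hK).mul hW).congr_deriv ?_
  have h1 : (W x)⁻¹ * (V * W x) * (W x)⁻¹ = (W x)⁻¹ * V := by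
    rw [mul_assoc, mul_assoc V, Matrix.mul_nonsing_inv _ (hu x), mul_one]
  rw [h1]
  noncomm_ring

/-- The matrix `m · σ` of the solution. -/
noncomputable def spinM (A : Matrix (Fin q) (Fin q) ℂ) (B : Matrix (Fin q) (Fin 1) ℂ)
    (C : Matrix (Fin 1) (Fin q) ℂ) (z t : ℝ) : Matrix (Fin 2) (Fin 2) ℂ :=
  (waveW A B C 0 z t)⁻¹ * pauli3 * waveW A B C 0 z t

theorem pauli3_sq : pauli3 * pauli3 = 1 := by
  ext i j
  fin_cases i <;> fin_cases j <;> simp [pauli3]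

theorem pauli3_conjTranspose : pauli3ᴴ = pauli3 := by
  ext i j
  fin_cases i <;> fin_cases j <;> simp [pauli3]

theorem IsMinimalTriplet.spinM_sq (h : IsMinimalTriplet A B C) (z t : ℝ) :
    spinM A B C z t * spinM A B C z t = 1 := by
  have hu := h.isUnit_det_waveW (κ := 0) rfl z t
  calc _ = (waveW A B C 0 z t)⁻¹ * pauli3 * (waveW A B C 0 z t * (waveW A B C 0 z t)⁻¹) *
        pauli3 * waveW A B C 0 z t := by simp only [spinM, mul_assoc]
    _ = 1 := by
      rw [Matrix.mul_nonsing_inv _ hu, mul_one, mul_assoc _ pauli3 pauli3, pauli3_sq, mul_one,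
        Matrix.nonsing_inv_mul _ hu]

theorem IsMinimalTriplet.pauliDot_spinM (h : IsMinimalTriplet A B C) (z t : ℝ) :
    pauliDot (spinVec (spinM A B C z t)) = spinM A B C z t := by
  have hu := h.isUnit_det_waveW (κ := 0) rfl z t
  refine pauliDot_spinVec ?_ ?_
  · rw [spinM, h.waveW_inv, Matrix.conjTranspose_mul, Matrix.conjTranspose_mul,
      Matrix.conjTranspose_conjTranspose, pauli3_conjTranspose, mul_assoc]
  · rw [spinM, Matrix.trace_mul_comm, ← mul_assoc, Matrix.mul_nonsing_inv _ hu, one_mul]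
    simp [pauli3, Matrix.trace_fin_two]

theorem IsMinimalTriplet.matSmooth_spinM (h : IsMinimalTriplet A B C) :
    MatSmooth (fun p : ℝ × ℝ => spinM A B C p.1 p.2) :=
  (((h.matSmooth_waveW 0).inv fun p => h.isUnit_det_waveW rfl p.1 p.2).mul
    (MatSmooth.const _)).mul (h.matSmooth_waveW 0)

theorem IsMinimalTriplet.matHasDerivAt_gauge_space (h : IsMinimalTriplet A B C) (z t : ℝ)
    {K : ℝ → Matrix (Fin 2) (Fin 2) ℂ} {K' : Matrix (Fin 2) (Fin 2) ℂ}
    (hK : MatHasDerivAt K K' z) :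
    MatHasDerivAt (fun y => (waveW A B C 0 y t)⁻¹ * K y * waveW A B C 0 y t)
      ((waveW A B C 0 z t)⁻¹ * (K' + K z * pot A B C z t - pot A B C z t * K z) *
        waveW A B C 0 z t) z := by
  have hs : MatSmooth (fun y => waveW A B C 0 y t) :=
    MatSmooth.comp (F := fun p : ℝ × ℝ => waveW A B C 0 p.1 p.2) (h.matSmooth_waveW 0)
      (g := fun y => (y, t)) (contDiff_prodMk_left t)
  refine MatHasDerivAt.gauge (W := fun y => waveW A B C 0 y t) hs
    (fun y => h.isUnit_det_waveW rfl y t) ?_ hK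
  simpa using h.matHasDerivAt_waveW_space (κ := 0) rfl z t

/-- The first spatial derivative of `m · σ`. -/
noncomputable def spinM_z (A : Matrix (Fin q) (Fin q) ℂ) (B : Matrix (Fin q) (Fin 1) ℂ)
    (C : Matrix (Fin 1) (Fin q) ℂ) (z t : ℝ) : Matrix (Fin 2) (Fin 2) ℂ :=
  (waveW A B C 0 z t)⁻¹ * (2 • (pauli3 * pot A B C z t)) * waveW A B C 0 z t

/-- The second spatial derivative of `m · σ`. -/
noncomputable def spinM_zz (A : Matrix (Fin q) (Fin q) ℂ) (B : Matrix (Fin q) (Fin 1) ℂ)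
    (C : Matrix (Fin 1) (Fin q) ℂ) (z t : ℝ) : Matrix (Fin 2) (Fin 2) ℂ :=
  (waveW A B C 0 z t)⁻¹ * (2 • (pauli3 * potDeriv A B C z t) +
    4 • (pauli3 * (pot A B C z t * pot A B C z t))) * waveW A B C 0 z t

theorem IsMinimalTriplet.pauli3_mul_pot (h : IsMinimalTriplet A B C) (z t : ℝ) :
    pauli3 * pot A B C z t = -(pot A B C z t * pauli3) :=
  (h.isDressing z t).pauli3_mul_potential

theorem IsMinimalTriplet.pauli3_mul_potDeriv (h : IsMinimalTriplet A B C) (z t : ℝ) :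
    pauli3 * potDeriv A B C z t = -(potDeriv A B C z t * pauli3) :=
  (h.isDressing z t).pauli3_mul_potentialDeriv

/-- The gauge rule gives the commutator `[σ₃,V]`, which is `2σ₃V` by anticommutation. -/
theorem IsMinimalTriplet.matHasDerivAt_spinM (h : IsMinimalTriplet A B C) (z t : ℝ) :
    MatHasDerivAt (fun z => spinM A B C z t) (spinM_z A B C z t) z := by
  have hg := h.matHasDerivAt_gauge_space z t (K := fun _ => pauli3)
    (MatHasDerivAt.const pauli3 z)
  unfold spinM
  refine hg.congr_deriv ?_
  rw [spinM_z, zero_add, two_smul, sub_eq_add_neg]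
  nth_rewrite 3 [h.pauli3_mul_pot]
  rfl

theorem IsMinimalTriplet.matHasDerivAt_spinM_z (h : IsMinimalTriplet A B C) (z t : ℝ) :
    MatHasDerivAt (fun z => spinM_z A B C z t) (spinM_zz A B C z t) z := by
  have hK : MatHasDerivAt (fun y => 2 • (pauli3 * pot A B C y t))
      (2 • (pauli3 * potDeriv A B C z t)) z := by
    have h1 := (h.matHasDerivAt_pot z t).const_mul pauli3
    simpa only [two_smul] using h1.add h1
  refine (h.matHasDerivAt_gauge_space z t hK).congr_deriv ?_
  rw [spinM_zz, add_sub_assoc]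
  congr 3
  have h1 : pot A B C z t * pauli3 = -(pauli3 * pot A B C z t) := by
    rw [h.pauli3_mul_pot, neg_neg]
  rw [mul_smul_comm, smul_mul_assoc, ← mul_assoc (pot A B C z t), h1]
  noncomm_ring

/-- After conjugation by `W₀` the `V²` part of the second derivative commutes with `σ₃` and drops
out; the `V_z` part anticommutes with `σ₃` and doubles. -/
theorem IsMinimalTriplet.commutator_spinM (h : IsMinimalTriplet A B C) (z t : ℝ) :
    spinM A B C z t * spinM_zz A B C z t - spinM_zz A B C z t * spinM A B C z t =
      (waveW A B C 0 z t)⁻¹ * (4 • potDeriv A B C z t) * waveW A B C 0 z t := by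
  have hu := h.isUnit_det_waveW (κ := 0) rfl z t
  have hm : ∀ X Y : Matrix (Fin 2) (Fin 2) ℂ,
      ((waveW A B C 0 z t)⁻¹ * X * waveW A B C 0 z t) *
        ((waveW A B C 0 z t)⁻¹ * Y * waveW A B C 0 z t) =
        (waveW A B C 0 z t)⁻¹ * (X * Y) * waveW A B C 0 z t := by
    intro X Y
    calc _ = (waveW A B C 0 z t)⁻¹ * X * (waveW A B C 0 z t * (waveW A B C 0 z t)⁻¹) * Y *
          waveW A B C 0 z t := by simp only [mul_assoc]
      _ = _ := by rw [Matrix.mul_nonsing_inv _ hu, mul_one]; simp only [mul_assoc]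
  rw [spinM, spinM_zz, hm, hm, ← sub_mul, ← mul_sub]
  congr 2
  have h1 : pot A B C z t * pauli3 = -(pauli3 * pot A B C z t) := by
    rw [h.pauli3_mul_pot, neg_neg]
  have h2 : potDeriv A B C z t * pauli3 = -(pauli3 * potDeriv A B C z t) := by
    rw [h.pauli3_mul_potDeriv, neg_neg]
  have h3 : pauli3 * (pot A B C z t * pot A B C z t) * pauli3 =
      pot A B C z t * pot A B C z t := by
    rw [mul_assoc, mul_assoc (pot A B C z t), h1, mul_neg, ← mul_assoc (pot A B C z t), h1,
      neg_mul, neg_neg, mul_assoc, ← mul_assoc, pauli3_sq, one_mul]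
  have h4 : pauli3 * potDeriv A B C z t * pauli3 = -potDeriv A B C z t := by
    rw [mul_assoc, h2, mul_neg, ← mul_assoc, pauli3_sq, one_mul]
  have h5 : pauli3 * (pauli3 * potDeriv A B C z t) = potDeriv A B C z t := by
    rw [← mul_assoc, pauli3_sq, one_mul]
  have h6 : pauli3 * (pauli3 * (pot A B C z t * pot A B C z t)) =
      pot A B C z t * pot A B C z t := by
    rw [← mul_assoc, pauli3_sq, one_mul]
  simp only [mul_add, add_mul, mul_smul_comm, smul_mul_assoc, h3, h4, h5, h6]
  module

/-- The gauge rule gives `4i[σ₃,T] = -2iV_z` between `W₀⁻¹` and `W₀`, to be compared with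
`commutator_spinM`. -/
theorem IsMinimalTriplet.matHasDerivAt_spinM_time (h : IsMinimalTriplet A B C) (z t : ℝ) :
    MatHasDerivAt (fun t => spinM A B C z t) ((-(Complex.I / 2)) •
      (spinM A B C z t * spinM_zz A B C z t - spinM_zz A B C z t * spinM A B C z t)) t := by
  have hsm : MatSmooth (fun s => waveW A B C 0 z s) :=
    MatSmooth.comp (F := fun p : ℝ × ℝ => waveW A B C 0 p.1 p.2) (h.matSmooth_waveW 0)
      (g := fun s => (z, s)) (contDiff_prodMk_right z)
  have hg := MatHasDerivAt.gauge (W := fun s => waveW A B C 0 z s) (K := fun _ => pauli3)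
    (V := (4 * Complex.I) • timePot A B C z t) hsm
    (fun s => h.isUnit_det_waveW rfl z s) (h.matHasDerivAt_waveW_time z t)
    (MatHasDerivAt.const pauli3 t)
  have hs : (fun t => spinM A B C z t) =
      fun t => (waveW A B C 0 z t)⁻¹ * pauli3 * waveW A B C 0 z t := rfl
  rw [hs]
  refine hg.congr_deriv ?_
  have h1 : 2 • (pauli3 * timePot A B C z t - timePot A B C z t * pauli3) =
      -potDeriv A B C z t := (h.isDressing z t).commutator_lax_time
  rw [h.commutator_spinM, ← Matrix.smul_mul, ← Matrix.mul_smul]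
  congr 2
  have h2 : potDeriv A B C z t =
      -(2 • (pauli3 * timePot A B C z t - timePot A B C z t * pauli3)) := by rw [h1, neg_neg]
  rw [h2, zero_add, mul_smul_comm, smul_mul_assoc]
  module

theorem IsMinimalTriplet.hf_equation (h : IsMinimalTriplet A B C) (z t : ℝ) :
    deriv (fun s => spinVec (spinM A B C z s)) t =
      crossProduct (spinVec (spinM A B C z t))
        (iteratedDeriv 2 (fun x => spinVec (spinM A B C x t)) z) := by
  have h1 : deriv (fun x => spinVec (spinM A B C x t)) = fun x => spinVec (spinM_z A B C x t) :=
    funext fun x => (h.matHasDerivAt_spinM x t).spinVec.deriv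
  have h2 : iteratedDeriv 2 (fun x => spinVec (spinM A B C x t)) z =
      spinVec (spinM_zz A B C z t) := by
    rw [iteratedDeriv_succ, iteratedDeriv_one, h1]
    exact (h.matHasDerivAt_spinM_z z t).spinVec.deriv
  have h3 : ∀ x, pauliDot (spinVec (spinM_z A B C x t)) = spinM_z A B C x t := fun x =>
    pauliDot_spinVec_deriv (fun y => h.pauliDot_spinM y t) (h.matHasDerivAt_spinM x t)
  have h4 : pauliDot (spinVec (spinM_zz A B C z t)) = spinM_zz A B C z t :=
    pauliDot_spinVec_deriv h3 (h.matHasDerivAt_spinM_z z t)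
  rw [(h.matHasDerivAt_spinM_time z t).spinVec.deriv, h2]
  have h5 := pauliDot_cross (spinVec (spinM A B C z t)) (spinVec (spinM_zz A B C z t))
  rw [h4, h.pauliDot_spinM] at h5
  rw [← h5, spinVec_pauliDot]

theorem IsMinimalTriplet.contDiff_spinVec (h : IsMinimalTriplet A B C) :
    ContDiff ℝ 2 (fun p : ℝ × ℝ => spinVec (spinM A B C p.1 p.2)) := by
  have h1 : ∀ i j, ContDiff ℝ 2 (fun p : ℝ × ℝ => spinM A B C p.1 p.2 i j) := fun i j =>
    contDiff_infty.1 (h.matSmooth_spinM i j) 2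
  refine contDiff_pi.2 fun i => ?_
  fin_cases i
  · exact Complex.reCLM.contDiff.comp (h1 1 0)
  · exact Complex.imCLM.contDiff.comp (h1 1 0)
  · exact Complex.reCLM.contDiff.comp (h1 0 0)

/-! ### Asymptotics -/

theorem _root_.Filter.Tendsto.matrix_nonsing_inv {ι n : Type*} [Fintype n] [DecidableEq n]
    {l : Filter ι} {F : ι → Matrix n n ℂ} {M : Matrix n n ℂ} (hF : Tendsto F l (𝓝 M))
    (hM : IsUnit M.det) : Tendsto (fun x => (F x)⁻¹) l (𝓝 M⁻¹) := by
  simp only [Matrix.inv_def, Ring.inverse_eq_inv']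
  have h1 : Tendsto (fun x => (F x).det) l (𝓝 M.det) :=
    (continuous_id.matrix_det.tendsto M).comp hF
  have h2 : Tendsto (fun x => (F x).adjugate) l (𝓝 M.adjugate) :=
    (continuous_id.matrix_adjugate.tendsto M).comp hF
  exact (h1.inv₀ hM.ne_zero).smul h2

theorem tendsto_matrix_mul {ι l m n : Type*} [Fintype m] {f : Filter ι} {F : ι → Matrix l m ℂ}
    {G : ι → Matrix m n ℂ} {M : Matrix l m ℂ} {N : Matrix m n ℂ} (hF : Tendsto F f (𝓝 M))
    (hG : Tendsto G f (𝓝 N)) : Tendsto (fun x => F x * G x) f (𝓝 (M * N)) := by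
  refine tendsto_pi_nhds.2 fun i => tendsto_pi_nhds.2 fun j => ?_
  simp only [Matrix.mul_apply]
  exact tendsto_finsetSum _ fun k _ =>
    (tendsto_pi_nhds.1 (tendsto_pi_nhds.1 hF i) k).mul (tendsto_pi_nhds.1 (tendsto_pi_nhds.1 hG k) j)

theorem tendsto_phaseE_atBot (h : EigenvaluesInRightHalfPlane A) (t : ℝ) :
    Tendsto (fun z => phaseE A z t) atBot (𝓝 0) := by
  have h1 : Tendsto (fun z : ℝ => -2 * z) atBot atTop :=
    tendsto_id.const_mul_atBot_of_neg (by norm_num)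
  have h2 : Tendsto (fun z => expNeg (calA A) (-2 * z)) atBot (𝓝 0) :=
    (matDecay_expNeg_calA h).tendsto.comp h1
  have h3 : Tendsto (fun _ : ℝ => expNeg (timeGenerator A) t) atBot
    (𝓝 (expNeg (timeGenerator A) t)) := tendsto_const_nhds
  have h4 := tendsto_matrix_mul h2 h3
  rw [Matrix.zero_mul] at h4
  exact h4

theorem IsMinimalTriplet.tendsto_resR_atBot (h : IsMinimalTriplet A B C) (t : ℝ) :
    Tendsto (fun z => resR A B C z t) atBot (𝓝 (calP A B C)⁻¹) := by
  have h1 := (tendsto_phaseE_atBot h.eigenvalues t).add_const (calP A B C)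
  rw [zero_add] at h1
  exact h1.matrix_nonsing_inv h.isUnit_det_calP

/-- With `F = E⁻¹ → 0` one has `R = (1 + F𝒫)⁻¹F`. -/
theorem tendsto_resR_atTop (h : EigenvaluesInRightHalfPlane A) (t : ℝ) :
    Tendsto (fun z => resR A B C z t) atTop (𝓝 0) := by
  set F : ℝ → Matrix (Fin q ⊕ Fin q) (Fin q ⊕ Fin q) ℂ :=
    fun z => expNeg (timeGenerator A) (-t) * expNeg (calA A) (2 * z) with hF
  have h1 : Tendsto F atTop (𝓝 0) := by
    have h2 : Tendsto (fun z : ℝ => 2 * z) atTop atTop := tendsto_id.const_mul_atTop (by norm_num)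
    have h3 := tendsto_matrix_mul (F := fun _ => expNeg (timeGenerator A) (-t))
      (G := fun z => expNeg (calA A) (2 * z)) (tendsto_const_nhds (x := expNeg (timeGenerator A) (-t)))
      ((matDecay_expNeg_calA h).tendsto.comp h2)
    rw [Matrix.mul_zero] at h3
    exact h3
  have h2 : Tendsto (fun z => (1 + F z * calP A B C)⁻¹ * F z) atTop (𝓝 0) := by
    have h3 := (tendsto_matrix_mul h1 (tendsto_const_nhds (x := calP A B C))).const_add 1
    rw [Matrix.zero_mul, add_zero] at h3
    have h4 := tendsto_matrix_mul (h3.matrix_nonsing_inv (by simp)) h1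
    rwa [Matrix.mul_zero] at h4
  refine h2.congr fun z => ?_
  have hFE : F z * phaseE A z t = 1 := by
    have h3 : expNeg (calA A) (2 * z) * expNeg (calA A) (-2 * z) = 1 := by
      rw [neg_mul, expNeg_mul_neg]
    calc _ = expNeg (timeGenerator A) (-t) *
          (expNeg (calA A) (2 * z) * expNeg (calA A) (-2 * z)) * expNeg (timeGenerator A) t := by
          simp only [hF, phaseE, mul_assoc]
      _ = 1 := by rw [h3, mul_one, expNeg_neg_mul]
  have hEF : phaseE A z t * F z = 1 := mul_eq_one_comm.1 hFE
  have h3 : phaseE A z t + calP A B C = phaseE A z t * (1 + F z * calP A B C) := by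
    rw [mul_add, mul_one, ← mul_assoc, hEF, one_mul]
  rw [resR, h3, Matrix.mul_inv_rev, Matrix.inv_eq_left_inv hFE]

theorem tendsto_waveW_atTop (h : EigenvaluesInRightHalfPlane A) (κ : ℂ) (t : ℝ) :
    Tendsto (fun z => waveW A B C κ z t) atTop (𝓝 1) := by
  have h1 := (tendsto_matrix_mul (tendsto_matrix_mul (tendsto_matrix_mul
    (tendsto_const_nhds (x := calC B C)) (tendsto_resR_atTop (B := B) (C := C) h t))
    (tendsto_const_nhds (x := (pencil A κ)⁻¹))) (tendsto_const_nhds (x := calB B C))).const_sub 1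
  rw [Matrix.mul_zero, Matrix.zero_mul, Matrix.zero_mul, sub_zero] at h1
  exact h1

/-- The limit of the dressing matrix at `-∞`. -/
noncomputable def waveLimit (A : Matrix (Fin q) (Fin q) ℂ) (B : Matrix (Fin q) (Fin 1) ℂ)
    (C : Matrix (Fin 1) (Fin q) ℂ) (κ : ℂ) : Matrix (Fin 2) (Fin 2) ℂ :=
  dressing (calP A B C)⁻¹ (pencil A κ)⁻¹ (calB B C) (calC B C)

theorem IsMinimalTriplet.tendsto_waveW_atBot (h : IsMinimalTriplet A B C) (κ : ℂ) (t : ℝ) :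
    Tendsto (fun z => waveW A B C κ z t) atBot (𝓝 (waveLimit A B C κ)) :=
  (tendsto_matrix_mul (tendsto_matrix_mul (tendsto_matrix_mul
    (tendsto_const_nhds (x := calC B C)) (h.tendsto_resR_atBot t))
    (tendsto_const_nhds (x := (pencil A κ)⁻¹))) (tendsto_const_nhds (x := calB B C))).const_sub 1

end Solution

/-! ### Scattering coefficients -/

section Scattering

variable {q : ℕ} {A : Matrix (Fin q) (Fin q) ℂ} {B : Matrix (Fin q) (Fin 1) ℂ}
  {C : Matrix (Fin 1) (Fin q) ℂ}

/-- A rank-one perturbation formula for a solution of a Sylvester equation. -/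
theorem one_sub_row_mul_col {X D₁ D₂ : Matrix (Fin q) (Fin q) ℂ} {v : Matrix (Fin q) (Fin 1) ℂ}
    {w : Matrix (Fin 1) (Fin q) ℂ} (h : D₁ * X + X * D₂ = v * w) (hX : IsUnit X.det)
    (hD : IsUnit D₁.det) :
    1 - (w * (X⁻¹ * D₁⁻¹) * v) 0 0 = (-1) ^ q * (D₂.det / D₁.det) := by
  -- The scalar is read as a `1 × 1` determinant, so that `det(1 - wY) = det(1 - Yw)` moves the
  -- computation to size `q`.
  have h1 : 1 - (w * (X⁻¹ * D₁⁻¹) * v) 0 0 = (1 - w * (X⁻¹ * D₁⁻¹ * v)).det := by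
    rw [Matrix.det_fin_one, Matrix.sub_apply, Matrix.one_apply_eq, Matrix.mul_assoc]
  -- Substituting the Sylvester equation for `v * w` cancels the identity and leaves a product with
  -- explicit determinant.
  have h2 : 1 - X⁻¹ * D₁⁻¹ * v * w = -(X⁻¹ * D₁⁻¹ * (X * D₂)) := by
    rw [eq_neg_iff_add_eq_zero, Matrix.mul_assoc _ v w, ← h, Matrix.mul_add]
    have : X⁻¹ * D₁⁻¹ * (D₁ * X) = 1 := by
      calc _ = X⁻¹ * (D₁⁻¹ * D₁) * X := by simp only [Matrix.mul_assoc]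
        _ = 1 := by
          rw [Matrix.nonsing_inv_mul _ hD, Matrix.mul_one, Matrix.nonsing_inv_mul _ hX]
    rw [this]
    abel
  rw [h1, Matrix.det_one_sub_mul_comm, h2, Matrix.det_neg, Fintype.card_fin, Matrix.det_mul,
    Matrix.det_mul, Matrix.det_mul, Matrix.det_nonsing_inv, Matrix.det_nonsing_inv,
    Ring.inverse_eq_inv']
  have := hX.ne_zero
  have := hD.ne_zero
  field_simp

theorem sylvester_gramQ (h : EigenvaluesInRightHalfPlane A) (C : Matrix (Fin 1) (Fin q) ℂ) :
    Aᴴ * gramQ A C + gramQ A C * A = Cᴴ * C := by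
  refine (sylvester_iff (matDecay_expNeg h.conjTranspose) (matDecay_expNeg h) _ _).2 ?_
  simp only [gramQ, Matrix.mul_assoc]
  have : integrandQ A C = fun x => expNeg Aᴴ x * (Cᴴ * (C * expNeg A x)) := by
    funext x
    simp only [integrandQ, Matrix.mul_assoc]
  rw [this]

theorem sylvester_gramN (h : EigenvaluesInRightHalfPlane A) (B : Matrix (Fin q) (Fin 1) ℂ) :
    A * gramN A B + gramN A B * Aᴴ = B * Bᴴ := by
  have := sylvester_gramQ h.conjTranspose Bᴴ
  rw [← gramN_eq] at this
  simpa using this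

/-- Extracting `-i` from the numerator and `i` from the denominator leaves `(-i/i)^q = (-1)^q`. -/
theorem blaschke_eq (A : Matrix (Fin q) (Fin q) ℂ) (κ : ℝ) :
    blaschke A κ = (-1) ^ q * ((A + (Complex.I * κ) • 1).det / (Aᴴ + (-(Complex.I * κ)) • 1).det) := by
  have h1 : (κ : ℂ) • (1 : Matrix (Fin q) (Fin q) ℂ) - Complex.I • A =
      (-Complex.I) • (A + (Complex.I * κ) • 1) := by
    rw [smul_add, smul_smul]
    have : -Complex.I * (Complex.I * κ) = κ := by linear_combination (-(κ : ℂ)) * Complex.I_mul_I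
    rw [this, neg_smul]
    abel
  have h2 : (κ : ℂ) • (1 : Matrix (Fin q) (Fin q) ℂ) + Complex.I • Aᴴ =
      Complex.I • (Aᴴ + (-(Complex.I * κ)) • 1) := by
    rw [smul_add, smul_smul]
    have : Complex.I * -(Complex.I * κ) = κ := by linear_combination (-(κ : ℂ)) * Complex.I_mul_I
    rw [this]
    abel
  rw [blaschke, h1, h2, Matrix.det_smul, Matrix.det_smul, Fintype.card_fin, mul_div_mul_comm,
    ← div_pow, neg_div, div_self Complex.I_ne_zero]

theorem conj_blaschke (A : Matrix (Fin q) (Fin q) ℂ) (κ : ℝ) :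
    conj (blaschke A κ) =
      (-1) ^ q * ((Aᴴ + (-(Complex.I * κ)) • 1).det / (A + (Complex.I * κ) • 1).det) := by
  have h1 : conj (A + (Complex.I * κ) • 1).det = (Aᴴ + (-(Complex.I * κ)) • 1).det := by
    rw [starRingEnd_apply, ← Matrix.det_conjTranspose, Matrix.conjTranspose_add,
      Matrix.conjTranspose_smul]
    simp
  have h2 : conj (Aᴴ + (-(Complex.I * κ)) • 1).det = (A + (Complex.I * κ) • 1).det := by
    rw [← h1, Complex.conj_conj]
  rw [blaschke_eq, map_mul, map_div₀, h1, h2]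
  simp

theorem blaschke_ne_zero (h : EigenvaluesInRightHalfPlane A) (κ : ℝ) : blaschke A κ ≠ 0 := by
  rw [blaschke_eq]
  have h1 := isUnit_add_smul_of_spectrum h (ν := Complex.I * κ) (by simp)
  have h2 := isUnit_add_smul_of_spectrum h.conjTranspose (ν := -(Complex.I * κ)) (by simp)
  exact mul_ne_zero (by simp) (div_ne_zero h1.ne_zero h2.ne_zero)

/-- `𝒫⁻¹` is block antidiagonal and the pencil block diagonal, so the limit is diagonal: no
reflection. Each diagonal entry is a rank-one perturbation governed by the Sylvester equation of `Q`
or `N`. -/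
theorem IsMinimalTriplet.waveLimit_eq (h : IsMinimalTriplet A B C) (κ : ℝ) :
    waveLimit A B C (Complex.I * κ) =
      !![blaschke A κ, 0; 0, conj (blaschke A κ)] := by
  have h1 := isUnit_add_smul_of_spectrum h.eigenvalues (ν := Complex.I * κ) (by simp)
  have h2 := isUnit_add_smul_of_spectrum h.eigenvalues.conjTranspose
    (ν := -(Complex.I * κ)) (by simp)
  have hinv : (pencil A (Complex.I * κ))⁻¹ = Matrix.fromBlocks (A + (Complex.I * κ) • 1)⁻¹ 0 0
      (Aᴴ + (-(Complex.I * κ)) • 1)⁻¹ := by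
    refine Matrix.inv_eq_right_inv ?_
    rw [pencil_eq, Matrix.fromBlocks_multiply]
    simp only [Matrix.mul_nonsing_inv _ h1, Matrix.mul_nonsing_inv _ h2, Matrix.mul_zero,
      Matrix.zero_mul, add_zero, zero_add, Matrix.fromBlocks_one]
  -- The opposite shifts by `iκ` cancel, so the Gram matrix also solves the shifted equation.
  have hQ : (Aᴴ + (-(Complex.I * κ)) • 1) * gramQ A C +
      gramQ A C * (A + (Complex.I * κ) • 1) = Cᴴ * C := by
    rw [← sylvester_gramQ h.eigenvalues C]
    simp only [Matrix.add_mul, Matrix.mul_add, Matrix.smul_mul, Matrix.mul_smul, Matrix.one_mul,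
      Matrix.mul_one, neg_smul, Matrix.neg_mul]
    abel
  have hN : (A + (Complex.I * κ) • 1) * gramN A B +
      gramN A B * (Aᴴ + (-(Complex.I * κ)) • 1) = B * Bᴴ := by
    rw [← sylvester_gramN h.eigenvalues B]
    simp only [Matrix.add_mul, Matrix.mul_add, Matrix.smul_mul, Matrix.mul_smul, Matrix.one_mul,
      Matrix.mul_one, neg_smul, Matrix.mul_neg]
    abel
  have hprod : (calP A B C)⁻¹ * (pencil A (Complex.I * κ))⁻¹ =
      Matrix.fromBlocks 0 (-((gramQ A C)⁻¹ * (Aᴴ + (-(Complex.I * κ)) • 1)⁻¹))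
        ((gramN A B)⁻¹ * (A + (Complex.I * κ) • 1)⁻¹) 0 := by
    rw [h.calP_inv, hinv, Matrix.fromBlocks_multiply]
    simp
  have e1 := one_sub_row_mul_col hQ h.posDef_gramQ.isUnit_det' h2
  have e2 := one_sub_row_mul_col hN h.posDef_gramN.isUnit_det' h1
  rw [← blaschke_eq] at e1
  rw [← conj_blaschke] at e2
  rw [waveLimit, dressing, Matrix.mul_assoc (calC B C), hprod, calC_mul_fromBlocks_mul_calB',
    ← e2, ← e1]
  ext i j
  fin_cases i <;> fin_cases j <;> simp

theorem IsMinimalTriplet.waveLimit_zero (h : IsMinimalTriplet A B C) :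
    waveLimit A B C 0 = !![blaschke A 0, 0; 0, conj (blaschke A 0)] := by
  simpa using h.waveLimit_eq 0

theorem planeWave_apply_norm (κ z : ℝ) (i : Fin 2) : ‖planeWave κ z i i‖ = 1 := by
  fin_cases i <;> simp [planeWave, Complex.norm_exp]

theorem planeWave_neg_mul (κ z : ℝ) (i : Fin 2) :
    planeWave (-κ) z i i * planeWave κ z i i = 1 := by
  fin_cases i <;> simp [planeWave, ← Complex.exp_add]

/-- Conjugation by plane waves does not change a diagonal limit. -/
theorem tendsto_planeWave_conj {l : Filter ℝ} {X : ℝ → Matrix (Fin 2) (Fin 2) ℂ} {d : Fin 2 → ℂ}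
    (h : Tendsto X l (𝓝 (Matrix.diagonal d))) (κ : ℝ) :
    Tendsto (fun z => planeWave (-κ) z * X z * planeWave κ z) l (𝓝 (Matrix.diagonal d)) := by
  have hij : ∀ i j, Tendsto (fun z => X z i j) l (𝓝 (Matrix.diagonal d i j)) := fun i j =>
    tendsto_pi_nhds.1 (tendsto_pi_nhds.1 h i) j
  have hp : ∀ z i j, (planeWave (-κ) z * X z * planeWave κ z) i j =
      planeWave (-κ) z i i * X z i j * planeWave κ z j j := by
    intro z i j
    simp only [planeWave, Matrix.mul_diagonal, Matrix.diagonal_mul, Matrix.diagonal_apply_eq]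
  refine tendsto_pi_nhds.2 fun i => tendsto_pi_nhds.2 fun j => ?_
  simp only [hp]
  by_cases hij' : i = j
  · subst hij'
    refine (hij i i).congr fun z => ?_
    rw [mul_right_comm, planeWave_neg_mul, one_mul]
  -- Off the diagonal the plane waves only contribute unimodular factors, harmless for a limit equal
  -- to zero.
  · have h0 := hij i j
    rw [Matrix.diagonal_apply_ne _ hij'] at h0 ⊢
    rw [tendsto_zero_iff_norm_tendsto_zero] at h0 ⊢
    refine h0.congr fun z => ?_
    rw [norm_mul, norm_mul, planeWave_apply_norm, planeWave_apply_norm, one_mul, mul_one]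

theorem matHasDerivAt_planeWave (κ z : ℝ) :
    MatHasDerivAt (planeWave κ) ((Complex.I * κ) • (pauli3 * planeWave κ z)) z := by
  have h1 : ∀ s : ℂ, HasDerivAt (fun x : ℝ => Complex.exp (s * x)) (s * Complex.exp (s * z)) z := by
    intro s
    have h2 : HasDerivAt (fun x : ℝ => s * (x : ℂ)) s z := by
      simpa using (Complex.ofRealCLM.hasDerivAt (x := z)).const_mul s
    simpa [mul_comm] using h2.cexp
  intro i j
  fin_cases i <;> fin_cases j
  · simpa [planeWave, pauli3, Matrix.vecMul_diagonal] using h1 (Complex.I * κ)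
  · simpa [planeWave, pauli3, Matrix.vecMul_diagonal] using hasDerivAt_const z (0 : ℂ)
  · simpa [planeWave, pauli3, Matrix.vecMul_diagonal] using hasDerivAt_const z (0 : ℂ)
  · simpa [planeWave, pauli3, Matrix.vecMul_diagonal] using h1 (-(Complex.I * κ))

/-- The matrix `W₀⁻¹ W_κ` relating the Jost matrix to the plane wave. -/
noncomputable def gaugedWave (A : Matrix (Fin q) (Fin q) ℂ) (B : Matrix (Fin q) (Fin 1) ℂ)
    (C : Matrix (Fin 1) (Fin q) ℂ) (κ : ℝ) (z t : ℝ) : Matrix (Fin 2) (Fin 2) ℂ :=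
  (waveW A B C 0 z t)⁻¹ * waveW A B C (Complex.I * κ) z t

/-- `W₀` and `W_{iκ}` share the potential `V`, which cancels; the plane wave cancels the term
`-iκW_{iκ}σ₃`. What remains is `iκW₀⁻¹σ₃W_{iκ}` times the plane wave. -/
theorem IsMinimalTriplet.matHasDerivAt_gaugedWave (h : IsMinimalTriplet A B C) (κ z t : ℝ) :
    MatHasDerivAt (fun z => gaugedWave A B C κ z t * planeWave κ z)
      ((Complex.I * κ) • (spinM A B C z t * (gaugedWave A B C κ z t * planeWave κ z))) z := by
  have hu := fun y => h.isUnit_det_waveW (κ := 0) rfl y t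
  have hs : MatSmooth (fun y => waveW A B C 0 y t) :=
    MatSmooth.comp (F := fun p : ℝ × ℝ => waveW A B C 0 p.1 p.2) (h.matSmooth_waveW 0)
      (g := fun y => (y, t)) (contDiff_prodMk_left t)
  have hW0 : MatHasDerivAt (fun y => waveW A B C 0 y t)
      (pot A B C z t * waveW A B C 0 z t) z := by
    simpa using h.matHasDerivAt_waveW_space (κ := 0) rfl z t
  have hW := h.matHasDerivAt_waveW_space (κ := Complex.I * κ) (by simp) z t
  have hinv := MatHasDerivAt.inv hs hW0 hu
  refine ((hinv.mul hW).mul (matHasDerivAt_planeWave κ z)).congr_deriv ?_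
  set W := waveW A B C 0 z t
  set Wk := waveW A B C (Complex.I * κ) z t
  have hWW : W * W⁻¹ = 1 := Matrix.mul_nonsing_inv _ (hu z)
  have h1 : W⁻¹ * (pot A B C z t * W) * W⁻¹ = W⁻¹ * pot A B C z t := by
    rw [mul_assoc, mul_assoc (pot A B C z t), hWW, mul_one]
  have h2 : spinM A B C z t * (gaugedWave A B C κ z t * planeWave κ z) =
      W⁻¹ * pauli3 * Wk * planeWave κ z := by
    calc _ = W⁻¹ * pauli3 * (W * W⁻¹) * Wk * planeWave κ z := by
          simp only [spinM, gaugedWave, mul_assoc, W, Wk]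
      _ = _ := by rw [hWW, mul_one]
  rw [h2, h1]
  simp only [mul_add, add_mul, mul_sub, sub_mul, neg_mul, smul_mul_assoc, mul_smul_comm, mul_assoc,
    smul_sub]
  abel

theorem diagonal_fin_two (a b : ℂ) : Matrix.diagonal ![a, b] = !![a, 0; 0, b] := by
  ext i j
  fin_cases i <;> fin_cases j <;> simp

theorem IsMinimalTriplet.tendsto_gaugedWave_atTop (h : IsMinimalTriplet A B C) (κ t : ℝ) :
    Tendsto (fun z => gaugedWave A B C κ z t) atTop (𝓝 1) := by
  have h1 := tendsto_matrix_mul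
    ((tendsto_waveW_atTop (B := B) (C := C) h.eigenvalues 0 t).matrix_nonsing_inv (by simp))
    (tendsto_waveW_atTop (B := B) (C := C) h.eigenvalues (Complex.I * κ) t)
  rwa [inv_one, mul_one] at h1

theorem IsMinimalTriplet.tendsto_gaugedWave_atBot (h : IsMinimalTriplet A B C) (κ t : ℝ) :
    Tendsto (fun z => gaugedWave A B C κ z t) atBot
      (𝓝 (Matrix.diagonal ![blaschke A κ / blaschke A 0,
        conj (blaschke A κ / blaschke A 0)])) := by
  have hb := blaschke_ne_zero h.eigenvalues 0
  have hb' : conj (blaschke A 0) ≠ 0 := (map_ne_zero _).2 hb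
  have hinv : (waveLimit A B C 0)⁻¹ = !![(blaschke A 0)⁻¹, 0; 0, (conj (blaschke A 0))⁻¹] := by
    refine Matrix.inv_eq_right_inv ?_
    rw [h.waveLimit_zero]
    simp [Matrix.one_fin_two, hb]
  have hdet : IsUnit (waveLimit A B C 0).det := by
    rw [h.waveLimit_zero, Matrix.det_fin_two_of, isUnit_iff_ne_zero]
    simp [hb]
  have h1 := tendsto_matrix_mul ((h.tendsto_waveW_atBot 0 t).matrix_nonsing_inv hdet)
    (h.tendsto_waveW_atBot (Complex.I * κ) t)
  rw [hinv, h.waveLimit_eq] at h1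
  have h2 : Matrix.diagonal ![blaschke A κ / blaschke A 0, conj (blaschke A κ / blaschke A 0)] =
      !![(blaschke A 0)⁻¹, 0; 0, (conj (blaschke A 0))⁻¹] *
        !![blaschke A κ, 0; 0, conj (blaschke A κ)] := by
    rw [diagonal_fin_two]
    simp [div_eq_inv_mul]
  rw [h2]
  exact h1

/-- `Ψ` is the gauged wave times the plane wave; `Φ` is `Ψ` times the constant `diag(1/a, 1/a^*)`,
which normalizes the diagonal limit at `-∞`. -/
theorem IsMinimalTriplet.hasScatteringCoefficients (h : IsMinimalTriplet A B C) (t : ℝ) :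
    HasScatteringCoefficients (fun z => spinVec (spinM A B C z t))
      (fun κ => blaschke A κ / blaschke A 0) (fun _ => 0) := by
  intro κ
  set a := blaschke A κ / blaschke A 0 with ha
  have ha0 : a ≠ 0 := div_ne_zero (blaschke_ne_zero h.eigenvalues κ)
    (blaschke_ne_zero h.eigenvalues 0)
  have ha0' : conj a ≠ 0 := (map_ne_zero _).2 ha0
  refine ⟨fun z => gaugedWave A B C κ z t * planeWave κ z,
    fun z => gaugedWave A B C κ z t * planeWave κ z * Matrix.diagonal ![a⁻¹, (conj a)⁻¹],
    ⟨fun z i j => ?_, ?_⟩, ⟨fun z i j => ?_, ?_⟩, fun z => ?_⟩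
  · have h1 := h.matHasDerivAt_gaugedWave κ z t i j
    rwa [← h.pauliDot_spinM, Matrix.smul_apply, smul_eq_mul] at h1
  · have h1 := h.tendsto_gaugedWave_atTop κ t
    rw [← Matrix.diagonal_one] at h1 ⊢
    simpa only [mul_assoc] using tendsto_planeWave_conj h1 κ
  · have h1 := (h.matHasDerivAt_gaugedWave κ z t).mul_const
      (Matrix.diagonal ![a⁻¹, (conj a)⁻¹]) i j
    rwa [← h.pauliDot_spinM, Matrix.smul_mul, Matrix.smul_apply, smul_eq_mul,
      Matrix.mul_assoc (pauliDot _)] at h1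
  · have h1 := tendsto_planeWave_conj (h.tendsto_gaugedWave_atBot κ t) κ
    have h2 := tendsto_matrix_mul h1 (tendsto_const_nhds
      (x := Matrix.diagonal ![a⁻¹, (conj a)⁻¹]))
    have h3 : Matrix.diagonal ![blaschke A κ / blaschke A 0,
        conj (blaschke A κ / blaschke A 0)] * Matrix.diagonal ![a⁻¹, (conj a)⁻¹] = 1 := by
      rw [← ha, diagonal_fin_two, diagonal_fin_two]
      simp [Matrix.one_fin_two, ha0]
    rw [h3] at h2
    simpa only [mul_assoc] using h2
  · have h3 : Matrix.diagonal ![a⁻¹, (conj a)⁻¹] * !![a, -0; conj 0, conj a] = 1 := by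
      rw [diagonal_fin_two]
      simp [Matrix.one_fin_two, ha0]
    rw [mul_assoc _ (Matrix.diagonal _), h3, mul_one]

/-! ### The boundary values of the solution -/

theorem tendsto_spinVec {l : Filter ℝ} {M : ℝ → Matrix (Fin 2) (Fin 2) ℂ}
    (h : Tendsto M l (𝓝 pauli3)) : Tendsto (fun z => spinVec (M z)) l (𝓝 ![0, 0, 1]) := by
  have h1 : ∀ i j, Tendsto (fun z => M z i j) l (𝓝 (pauli3 i j)) := fun i j =>
    tendsto_pi_nhds.1 (tendsto_pi_nhds.1 h i) j
  refine tendsto_pi_nhds.2 fun i => ?_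
  fin_cases i
  · have h2 : Tendsto (fun z => (M z 1 0).re) l (𝓝 (pauli3 1 0).re) :=
      (Complex.continuous_re.tendsto _).comp (h1 1 0)
    have h3 : (pauli3 1 0).re = 0 := by simp [pauli3]
    rw [h3] at h2
    exact h2
  · have h2 : Tendsto (fun z => (M z 1 0).im) l (𝓝 (pauli3 1 0).im) :=
      (Complex.continuous_im.tendsto _).comp (h1 1 0)
    have h3 : (pauli3 1 0).im = 0 := by simp [pauli3]
    rw [h3] at h2
    exact h2
  · have h2 : Tendsto (fun z => (M z 0 0).re) l (𝓝 (pauli3 0 0).re) :=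
      (Complex.continuous_re.tendsto _).comp (h1 0 0)
    have h3 : (pauli3 0 0).re = 1 := by simp [pauli3]
    rw [h3] at h2
    exact h2

theorem IsMinimalTriplet.isHFSolution (h : IsMinimalTriplet A B C) :
    IsHFSolution (fun z t => spinVec (spinM A B C z t)) where
  regular := h.contDiff_spinVec
  unit z t := by
    refine norm_sq_of_pauliDot_sq ?_
    rw [h.pauliDot_spinM, h.spinM_sq]
  equation := h.hf_equation
  tendsto_atTop t := by
    have h0 := tendsto_waveW_atTop (B := B) (C := C) h.eigenvalues 0 t
    have h1 := tendsto_matrix_mul (tendsto_matrix_mul (h0.matrix_nonsing_inv (by simp))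
      (tendsto_const_nhds (x := pauli3))) h0
    rw [inv_one, one_mul, mul_one] at h1
    exact tendsto_spinVec h1
  tendsto_atBot t := by
    have h0 := h.tendsto_waveW_atBot 0 t
    have hdet : IsUnit (waveLimit A B C 0).det := by
      rw [h.waveLimit_zero, Matrix.det_fin_two_of, isUnit_iff_ne_zero]
      simp [blaschke_ne_zero h.eigenvalues 0]
    have h1 := tendsto_matrix_mul (tendsto_matrix_mul (h0.matrix_nonsing_inv hdet)
      (tendsto_const_nhds (x := pauli3))) h0
    -- `W₀` does not tend to `I` at `-∞`, but its limit is diagonal and commutes with `σ₃`, which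
    -- suffices for `m → e₃`.
    have h2 : pauli3 * waveLimit A B C 0 = waveLimit A B C 0 * pauli3 := by
      rw [h.waveLimit_zero]
      simp [pauli3]
    rw [mul_assoc, h2, ← mul_assoc, Matrix.nonsing_inv_mul _ hdet, one_mul] at h1
    exact tendsto_spinVec h1

end Scattering

/-! ### Convergence of the integrals of a triplet -/

section Convergence

variable {q : ℕ} {A : Matrix (Fin q) (Fin q) ℂ}

theorem entriesIntegrableOn_integrandQ (h : EigenvaluesInRightHalfPlane A)
    (C : Matrix (Fin 1) (Fin q) ℂ) : EntriesIntegrableOn (integrandQ A C) (Ioi 0) :=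
  (matDecay_integrandQ h C).entriesIntegrableOn (continuous_integrandQ A C) 0

theorem entriesIntegrableOn_integrandP (h : EigenvaluesInRightHalfPlane A)
    (B : Matrix (Fin q) (Fin 1) ℂ) (C : Matrix (Fin 1) (Fin q) ℂ) :
    EntriesIntegrableOn (integrandP A B C) (Ioi 0) := by
  have hd := matDecay_expNeg_calA h
  have hc := continuous_expNeg (calA A)
  exact MatDecay.entriesIntegrableOn (F := integrandP A B C) (((hd.mul_const _).mul_const _).mul hd)
    (((hc.matrix_mul continuous_const).matrix_mul continuous_const).matrix_mul hc) 0

end Convergence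

/-! ### The one-soliton solution -/

section OneSoliton

theorem mul_fin_one (x y : ℂ) : !![x] * !![y] = !![x * y] := by
  ext i j
  simp [Matrix.mul_apply, Subsingleton.elim i 0, Subsingleton.elim j 0]

theorem conjTranspose_fin_one (x : ℂ) : (!![x])ᴴ = !![conj x] := by
  ext i j
  simp [Subsingleton.elim i 0, Subsingleton.elim j 0]

theorem one_fin_one : (1 : Matrix (Fin 1) (Fin 1) ℂ) = !![1] := by
  ext i j
  rw [Subsingleton.elim i 0, Subsingleton.elim j 0]
  rfl

theorem expNeg_fin_one (x : ℂ) (w : ℝ) : expNeg !![x] w = !![Complex.exp (-x * w)] := by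
  have h : ∀ y : ℂ, !![y] = Matrix.diagonal fun _ : Fin 1 => y := by
    intro y
    ext i j
    simp [Subsingleton.elim i 0, Subsingleton.elim j 0]
  rw [h, h, expNeg_diagonal]

theorem eigenvaluesInRightHalfPlane_fin_one {a : ℂ} (ha : 0 < a.re) :
    EigenvaluesInRightHalfPlane !![a] := by
  intro μ hμ
  rw [spectrum.mem_iff, Matrix.isUnit_iff_isUnit_det, isUnit_iff_ne_zero, not_not,
    Matrix.det_fin_one] at hμ
  have : μ - a = 0 := by simpa [Matrix.algebraMap_matrix_apply] using hμ
  rwa [sub_eq_zero.1 this]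

/-- Order `0` represents only the zero kernel, whereas here the kernel equals `c ≠ 0` at `w = 0`. -/
theorem isMinimalTriplet_fin_one {a c : ℂ} (ha : 0 < a.re) (hc : c ≠ 0) :
    IsMinimalTriplet !![a] !![1] !![c] := by
  refine ⟨eigenvaluesInRightHalfPlane_fin_one ha, fun r A' B' C' _ hk => ?_⟩
  by_contra hr
  obtain rfl : r = 0 := by omega
  have h1 := hk 0
  rw [scalarKernel, scalarKernel, expNeg_zero, expNeg_zero, Matrix.mul_one, Matrix.mul_one,
    mul_fin_one] at h1
  exact hc (by simpa [Matrix.mul_apply] using h1.symm)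

/-- No integral is computed: the scalar Sylvester equation reads `(a^* + a)Q = |c|²`. -/
theorem gramQ_fin_one {a : ℂ} (ha : 0 < a.re) (c : ℂ) :
    gramQ !![a] !![c] = !![((‖c‖ ^ 2 / (2 * a.re) : ℝ) : ℂ)] := by
  have h1 := congrFun (congrFun
    (sylvester_gramQ (eigenvaluesInRightHalfPlane_fin_one ha) !![c]) 0) 0
  have h2 : (conj a + a) * gramQ !![a] !![c] 0 0 = conj c * c := by
    simp [Matrix.mul_apply] at h1
    linear_combination h1
  rw [Complex.conj_mul', add_comm, Complex.add_conj] at h2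
  have h3 : ((2 * a.re : ℝ) : ℂ) ≠ 0 := Complex.ofReal_ne_zero.2 (by positivity)
  ext i j
  rw [Subsingleton.elim i 0, Subsingleton.elim j 0, Complex.ofReal_div, Complex.ofReal_pow]
  exact eq_div_of_mul_eq h3 (by rw [mul_comm, h2])

theorem gramN_fin_one {a : ℂ} (ha : 0 < a.re) :
    gramN !![a] !![1] = !![((1 / (2 * a.re) : ℝ) : ℂ)] := by
  have h1 := gramQ_fin_one (a := conj a) (by simpa using ha) (conj 1)
  rw [gramN_eq, conjTranspose_fin_one, conjTranspose_fin_one, h1]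
  simp

theorem evolvedC_fin_one (a c : ℂ) (t : ℝ) :
    evolvedC !![a] !![c] t = !![c * Complex.exp (-4 * Complex.I * t * a ^ 2)] := by
  have h1 : (4 * Complex.I) • (!![a] ^ 2 : Matrix (Fin 1) (Fin 1) ℂ) =
      !![4 * Complex.I * a ^ 2] := by
    rw [pow_two, mul_fin_one, pow_two]
    simp
  rw [evolvedC_eq, propagator, h1, expNeg_fin_one, mul_fin_one,
    show -(4 * Complex.I * a ^ 2) * (t : ℂ) = -4 * Complex.I * t * a ^ 2 by ring]

/-- The dressing matrix of the one-soliton solution. -/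
theorem one_add_tildeL_fin_one {a : ℂ} (ha : 0 < a.re) (c : ℂ) (z : ℝ) {D : ℂ} (hD : D ≠ 0)
    (hD' : D = 1 + c * conj c / (2 * a.re) ^ 2 *
      (Complex.exp (-a * z) * Complex.exp (-conj a * z)) ^ 2) :
    1 + tildeL !![a] !![1] !![c] z =
      !![1 - c * conj c / (2 * a.re * conj a) *
          ((Complex.exp (-a * z) * Complex.exp (-conj a * z)) ^ 2 / D),
        -(c / a * (Complex.exp (-a * z) ^ 2 / D));
        conj c / conj a * (Complex.exp (-conj a * z) ^ 2 / D),
        1 - c * conj c / (2 * a.re * a) *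
          ((Complex.exp (-a * z) * Complex.exp (-conj a * z)) ^ 2 / D)] := by
  have ha0 : a ≠ 0 := fun h => by simp [h] at ha
  have ha' : conj a ≠ 0 := (map_ne_zero _).2 ha0
  have hp : (a.re : ℂ) ≠ 0 := Complex.ofReal_ne_zero.2 ha.ne'
  rw [tildeL_eq (eigenvaluesInRightHalfPlane_fin_one ha), gammaMatrix, calP_eq, gramQ_fin_one ha,
    gramN_fin_one ha, expNeg_calA, conjTranspose_fin_one, expNeg_fin_one, expNeg_fin_one]
  have hQ : ((‖c‖ ^ 2 / (2 * a.re) : ℝ) : ℂ) = c * conj c / (2 * a.re) := by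
    rw [Complex.mul_conj']
    push_cast
    rfl
  have hN : ((1 / (2 * a.re) : ℝ) : ℂ) = 1 / (2 * a.re) := by push_cast; rfl
  rw [hQ, hN]
  set e := Complex.exp (-a * z)
  set e' := Complex.exp (-conj a * z)
  have hA : (calA !![a])⁻¹ = Matrix.fromBlocks !![a⁻¹] 0 0 !![(conj a)⁻¹] := by
    refine Matrix.inv_eq_right_inv ?_
    rw [calA, conjTranspose_fin_one, Matrix.fromBlocks_multiply, mul_fin_one, mul_fin_one,
      mul_inv_cancel₀ ha0, mul_inv_cancel₀ ha', ← one_fin_one]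
    simp
  -- The pattern is `(1, x; -y, 1)⁻¹ = D⁻¹(1, -x; y, 1)` with `D = 1 + xy`.
  have hΓ : (1 + Matrix.fromBlocks !![e] 0 0 !![e'] *
      Matrix.fromBlocks 0 !![1 / (2 * (a.re : ℂ))] (-!![c * conj c / (2 * a.re)]) 0 *
        Matrix.fromBlocks !![e] 0 0 !![e'])⁻¹ =
      Matrix.fromBlocks !![D⁻¹] !![-(D⁻¹ * (e * e' / (2 * a.re)))]
        !![D⁻¹ * (c * conj c * (e * e') / (2 * a.re))] !![D⁻¹] := by
    refine Matrix.inv_eq_right_inv ?_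
    have h1 : -!![c * conj c / (2 * (a.re : ℂ))] = !![-(c * conj c / (2 * (a.re : ℂ)))] := by simp
    rw [h1, Matrix.fromBlocks_multiply, Matrix.fromBlocks_multiply, ← Matrix.fromBlocks_one,
      Matrix.fromBlocks_add, Matrix.fromBlocks_multiply]
    simp only [Matrix.mul_zero, Matrix.zero_mul, add_zero, zero_add, mul_fin_one, one_fin_one]
    congr 1 <;> ext i j <;> rw [Subsingleton.elim i 0, Subsingleton.elim j 0] <;>
      simp <;> field_simp
    all_goals (rw [hD']; field_simp; try ring)
  rw [hΓ, hA]
  have h2 : calC !![1] !![c] * Matrix.fromBlocks !![e] 0 0 !![e'] *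
      Matrix.fromBlocks !![D⁻¹] !![-(D⁻¹ * (e * e' / (2 * a.re)))]
        !![D⁻¹ * (c * conj c * (e * e') / (2 * a.re))] !![D⁻¹] *
      Matrix.fromBlocks !![e] 0 0 !![e'] * Matrix.fromBlocks !![a⁻¹] 0 0 !![(conj a)⁻¹] =
      Matrix.of ![Sum.elim (fun _ => c * (e * D⁻¹ * e * a⁻¹))
        (fun _ => c * (e * -(D⁻¹ * (e * e' / (2 * a.re))) * e' * (conj a)⁻¹)),
        Sum.elim (fun _ => e' * (D⁻¹ * (c * conj c * (e * e') / (2 * a.re))) * e * a⁻¹)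
          (fun _ => e' * D⁻¹ * e' * (conj a)⁻¹)] := by
    simp only [Matrix.mul_assoc, Matrix.fromBlocks_multiply, Matrix.mul_zero, Matrix.zero_mul,
      add_zero, zero_add, mul_fin_one]
    ext i j
    fin_cases i <;> rcases j with j | j <;>
      simp [calC, Matrix.mul_apply, Fintype.sum_sum_type, Subsingleton.elim j 0, mul_assoc]
  rw [h2]
  ext i j
  fin_cases i <;> fin_cases j <;>
    simp [calB, Fintype.sum_sum_type, Matrix.vecMul, dotProduct] <;> field_simp
  all_goals ring

/-- Normalization and orthogonality of the columns of `W` eliminate one of the two products in each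
entry of `W†σ₃W`. -/
theorem pauliDot_apply_of_unitary {m : Fin 3 → ℝ} {W : Matrix (Fin 2) (Fin 2) ℂ}
    (hW : Wᴴ * W = 1) (hm : pauliDot m = Wᴴ * pauli3 * W) :
    (m 2 : ℂ) = 1 - 2 * (conj (W 1 0) * W 1 0) ∧
      (m 0 : ℂ) + Complex.I * m 1 = 2 * (conj (W 0 1) * W 0 0) := by
  have h00 := congrFun (congrFun hm 0) 0
  have h10 := congrFun (congrFun hm 1) 0
  have u00 := congrFun (congrFun hW 0) 0
  have u10 := congrFun (congrFun hW 1) 0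
  rw [pauliDot_eq] at h00 h10
  simp [Matrix.mul_apply, Fin.sum_univ_two, pauli3] at h00 h10 u00 u10
  exact ⟨by linear_combination h00 + u00, by linear_combination h10 - u10⟩

theorem exp_neg_mul_exp_neg_conj (a : ℂ) (z : ℝ) :
    (Complex.exp (-a * z) * Complex.exp (-conj a * z)) ^ 2 = (Real.exp (-4 * a.re * z) : ℂ) := by
  have h := Complex.add_conj a
  rw [← Complex.exp_add, ← Complex.exp_nat_mul, Complex.ofReal_exp]
  congr 1
  push_cast at h ⊢
  linear_combination (-2 * (z : ℂ)) * h

/-- With `u = 2pz - log k`, `k²e^{-4pz} = e^{-2u}`, and `e^{-2u}/(1 + e^{-2u})² = 1/(4cosh²u)`. -/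
theorem one_add_sq_mul_exp_eq_cosh {k p : ℝ} (hk : 0 < k) (hp : 0 < p) (z : ℝ) :
    k ^ 2 * Real.exp (-4 * p * z) / (1 + k ^ 2 * Real.exp (-4 * p * z)) ^ 2 =
      1 / (4 * Real.cosh (2 * p * (z - Real.log k / (2 * p))) ^ 2) := by
  have hu : 2 * p * (z - Real.log k / (2 * p)) = 2 * p * z - Real.log k := by field_simp
  have h1 : k ^ 2 * Real.exp (-4 * p * z) = Real.exp (-(2 * p * z - Real.log k)) ^ 2 := by
    rw [neg_sub, Real.exp_sub, Real.exp_log hk, div_pow, div_eq_mul_inv, ← Real.exp_nat_mul,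
      ← Real.exp_neg]
    congr 2
    push_cast
    ring
  rw [h1, hu, Real.cosh_eq, Real.exp_neg]
  have := Real.exp_pos (2 * p * z - Real.log k)
  field_simp
  ring

theorem oneSoliton_apply {a c : ℂ} (ha : 0 < a.re) (hc : c ≠ 0) {m : Fin 3 → ℝ} {t z : ℝ}
    (hm : pauliDot m = (1 + tildeL !![a] !![1] (evolvedC !![a] !![c] t) z)⁻¹ * pauli3 *
      (1 + tildeL !![a] !![1] (evolvedC !![a] !![c] t) z)) {ct : ℂ}
    (hct : ct = c * Complex.exp (-4 * Complex.I * t * a ^ 2)) :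
    m 2 = 1 - 2 * (‖ct‖ ^ 2 / ‖a‖ ^ 2) * (Real.exp (-4 * a.re * z) /
        (1 + ‖ct‖ ^ 2 / (4 * a.re ^ 2) * Real.exp (-4 * a.re * z)) ^ 2) ∧
      (m 0 : ℂ) + Complex.I * (m 1 : ℂ) = -2 * (conj ct / conj a) *
        (Complex.exp (-2 * conj a * z) /
          (1 + (‖ct‖ : ℂ) ^ 2 / (4 * (a.re : ℂ) ^ 2) * Complex.exp (-4 * a.re * z))) *
        (1 - (‖ct‖ : ℂ) ^ 2 / (2 * a.re * conj a) * (Complex.exp (-4 * a.re * z) /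
          (1 + (‖ct‖ : ℂ) ^ 2 / (4 * (a.re : ℂ) ^ 2) * Complex.exp (-4 * a.re * z)))) := by
  have h := isMinimalTriplet_fin_one ha hc
  have hW := h.waveW_conjTranspose_mul z t
  rw [h.one_add_tildeL, h.waveW_inv] at hm
  obtain ⟨h1, h2⟩ := pauliDot_apply_of_unitary hW hm
  set D : ℝ := 1 + ‖ct‖ ^ 2 / (4 * a.re ^ 2) * Real.exp (-4 * a.re * z) with hD
  have hD0 : 0 < D := by positivity
  have hE : Complex.exp (-4 * a.re * z) = (Real.exp (-4 * a.re * z) : ℂ) := by push_cast; rfl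
  have hDc : 1 + (‖ct‖ : ℂ) ^ 2 / (4 * (a.re : ℂ) ^ 2) * Complex.exp (-4 * a.re * z) = (D : ℂ) := by
    rw [hD]
    push_cast
    rfl
  have hD' : (D : ℂ) = 1 + ct * conj ct / (2 * a.re) ^ 2 *
      (Complex.exp (-a * z) * Complex.exp (-conj a * z)) ^ 2 := by
    rw [exp_neg_mul_exp_neg_conj, ← hDc, Complex.mul_conj', hE]
    ring
  have hw := one_add_tildeL_fin_one ha ct z (Complex.ofReal_ne_zero.2 hD0.ne') hD'
  rw [hct, ← evolvedC_fin_one, h.one_add_tildeL, ← hct, exp_neg_mul_exp_neg_conj] at hw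
  have hx : ∀ b : ℂ, Complex.exp (-b * z) ^ 2 = Complex.exp (-2 * b * z) := fun b => by
    rw [← Complex.exp_nat_mul]
    congr 1
    push_cast
    ring
  have hxc : ∀ b : ℂ, conj (Complex.exp (-b * z)) = Complex.exp (-conj b * z) := fun b => by
    rw [← Complex.exp_conj]
    simp
  have ha0 : a ≠ 0 := fun h => by simp [h] at ha
  have ha' : conj a ≠ 0 := (map_ne_zero _).2 ha0
  have hDne : (D : ℂ) ≠ 0 := Complex.ofReal_ne_zero.2 hD0.ne'
  constructor
  · rw [hw] at h1
    simp only [Matrix.of_apply, Matrix.cons_val', Matrix.cons_val_zero, Matrix.cons_val_one,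
      Matrix.cons_val_fin_one, map_mul, map_div₀, map_pow, hxc, Complex.conj_conj,
      Complex.conj_ofReal] at h1
    apply Complex.ofReal_injective
    rw [h1]
    push_cast
    rw [hE, ← exp_neg_mul_exp_neg_conj, ← Complex.mul_conj', ← Complex.mul_conj']
    field_simp
  · rw [h2, hw, hDc, hE, ← Complex.mul_conj' ct, ← hx]
    simp only [Matrix.of_apply, Matrix.cons_val', Matrix.cons_val_zero, Matrix.cons_val_one,
      Matrix.cons_val_fin_one, map_mul, map_div₀, map_pow, map_neg, hxc, Complex.conj_ofReal]
    ring

end OneSoliton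

end HeisenbergChain

/-! ### The four parts of the theorem. -/

theorem mainTheorem1 :
    -- every reflectionless kernel is represented by a minimal triplet
    (∀ (N : ℕ) (a : Fin N → ℂ) (n : Fin N → ℕ) (c : Fin N → ℕ → ℂ), (∀ j, 0 < (a j).re) →
      ∃ (q : ℕ) (A : Matrix (Fin q) (Fin q) ℂ) (B : Matrix (Fin q) (Fin 1) ℂ)
        (C : Matrix (Fin 1) (Fin q) ℂ), IsMinimalTriplet A B C ∧
        (∀ w : ℝ, scalarKernel A B C w = reflectionlessKernel a n c w) ∧
        ∀ w : ℝ, matrixKernel (reflectionlessKernel a n c) w =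
          calC B C * expNeg (calA A) w * calB B C) ∧
    -- solution of the Marchenko equation for a minimal triplet
    (∀ (q : ℕ) (A : Matrix (Fin q) (Fin q) ℂ) (B : Matrix (Fin q) (Fin 1) ℂ)
      (C : Matrix (Fin 1) (Fin q) ℂ), IsMinimalTriplet A B C →
      (∀ w : ℝ, matrixKernel (scalarKernel A B C) w =
        calC B C * expNeg (calA A) w * calB B C) ∧
      EntriesIntegrableOn (integrandP A B C) (Ioi 0) ∧
      EntriesIntegrableOn (integrandN A B) (Ioi 0) ∧
      EntriesIntegrableOn (integrandQ A C) (Ioi 0) ∧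
      calP A B C = Matrix.fromBlocks 0 (gramN A B) (-gramQ A C) 0 ∧
      (∀ X : Matrix (Fin q ⊕ Fin q) (Fin q ⊕ Fin q) ℂ,
        calA A * X + X * calA A = calB B C * calC B C ↔ X = calP A B C) ∧
      (gramN A B).PosDef ∧ (gramQ A C).PosDef ∧ IsUnit (calP A B C).det ∧
      (calP A B C)⁻¹ = Matrix.fromBlocks 0 (-(gramQ A C)⁻¹) (gramN A B)⁻¹ 0 ∧
      ∀ z : ℝ,
        IsUnit (gammaMatrix A B C z).det ∧
        EntriesIntegrableOn (kernelL A B C z) (Ioi z) ∧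
        (∀ y : ℝ, EntriesIntegrableOn
          (fun u => kernelL A B C z u * matrixKernel (scalarKernel A B C) (u + y)) (Ioi z)) ∧
        (∀ y : ℝ, MarchenkoAt (matrixKernel (scalarKernel A B C)) z (kernelL A B C z) y) ∧
        (∀ ℓ : ℝ → Matrix (Fin 2) (Fin 2) ℂ, EntriesIntegrableOn ℓ (Ioi z) →
          (∀ᵐ y ∂(volume.restrict (Ioi z)),
            MarchenkoAt (matrixKernel (scalarKernel A B C)) z ℓ y) →
          ∀ᵐ y ∂(volume.restrict (Ioi z)), ℓ y = kernelL A B C z y) ∧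
        tildeL A B C z =
          -(calC B C * expNeg (calA A) z * (gammaMatrix A B C z)⁻¹ * expNeg (calA A) z *
            (calA A)⁻¹ * calB B C)) ∧
    -- time dependence and the solution of the Heisenberg ferromagnet equation
    (∀ (q : ℕ) (A : Matrix (Fin q) (Fin q) ℂ) (B : Matrix (Fin q) (Fin 1) ℂ)
      (C : Matrix (Fin 1) (Fin q) ℂ), IsMinimalTriplet A B C →
      (∀ t : ℝ, IsMinimalTriplet A B (evolvedC A C t) ∧
        (∀ w : ℝ, scalarKernel A B (evolvedC A C t) w =
          (C * expNeg A w * NormedSpace.exp ((-4 * Complex.I * (t : ℂ)) • A ^ 2) * B) 0 0) ∧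
        (∀ (N : ℕ) (a c : Fin N → ℂ),
          (∀ w : ℝ, scalarKernel A B C w = ∑ j, c j * Complex.exp (-a j * w)) →
          ∀ w : ℝ, scalarKernel A B (evolvedC A C t) w =
            ∑ j, Complex.exp (-4 * Complex.I * a j ^ 2 * t) * c j * Complex.exp (-a j * w)) ∧
        ∀ z : ℝ,
          tildeL A B (evolvedC A C t) z =
            -(calC B (evolvedC A C t) * expNeg (calA A) z *
              (1 + expNeg (calA A) z *
                Matrix.fromBlocks 0 (gramN A B) (-gramQ A (evolvedC A C t)) 0 *
                expNeg (calA A) z)⁻¹ *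
              expNeg (calA A) z * (calA A)⁻¹ * calB B (evolvedC A C t)) ∧
          IsUnit (1 + tildeL A B (evolvedC A C t) z).det) ∧
      ∃ m : ℝ → ℝ → Fin 3 → ℝ,
        (∀ z t : ℝ, pauliDot (m z t) =
          (1 + tildeL A B (evolvedC A C t) z)⁻¹ * pauli3 *
            (1 + tildeL A B (evolvedC A C t) z)) ∧
        IsHFSolution m ∧
        ∀ t : ℝ, HasScatteringCoefficients (fun z => m z t)
          (fun κ => blaschke A κ / blaschke A 0) (fun _ => 0)) ∧
    -- the one-soliton solution
    (∀ (a c : ℂ) (p : ℝ), p = a.re → 0 < p → c ≠ 0 →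
      IsMinimalTriplet !![a] !![1] !![c] ∧
      gramQ !![a] !![c] = !![((‖c‖ ^ 2 / (2 * p) : ℝ) : ℂ)] ∧
      gramN !![a] !![1] = !![((1 / (2 * p) : ℝ) : ℂ)] ∧
      ∀ m : ℝ → ℝ → Fin 3 → ℝ,
        (∀ z t : ℝ, pauliDot (m z t) =
          (1 + tildeL !![a] !![1] (evolvedC !![a] !![c] t) z)⁻¹ * pauli3 *
            (1 + tildeL !![a] !![1] (evolvedC !![a] !![c] t) z)) →
        ∀ (z t : ℝ) (ct : ℂ), ct = c * Complex.exp (-4 * Complex.I * t * a ^ 2) →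
          m z t 2 = 1 - 2 * (‖ct‖ ^ 2 / ‖a‖ ^ 2) *
            (Real.exp (-4 * p * z) /
              (1 + ‖ct‖ ^ 2 / (4 * p ^ 2) * Real.exp (-4 * p * z)) ^ 2) ∧
          m z t 2 = 1 - 2 * p ^ 2 / ‖a‖ ^ 2 /
            Real.cosh (2 * p * (z - Real.log (‖ct‖ / (2 * p)) / (2 * p))) ^ 2 ∧
          (m z t 0 : ℂ) + Complex.I * (m z t 1 : ℂ) =
            -2 * (conj ct / conj a) *
              (Complex.exp (-2 * conj a * z) /
                (1 + (‖ct‖ : ℂ) ^ 2 / (4 * (p : ℂ) ^ 2) * Complex.exp (-4 * p * z))) *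
              (1 - (‖ct‖ : ℂ) ^ 2 / (2 * p * conj a) *
                (Complex.exp (-4 * p * z) /
                  (1 + (‖ct‖ : ℂ) ^ 2 / (4 * (p : ℂ) ^ 2) * Complex.exp (-4 * p * z)))) ∧
          (m z t 0 : ℂ) - Complex.I * (m z t 1 : ℂ) =
            -2 * (ct / a) *
              (Complex.exp (-2 * a * z) /
                (1 + (‖ct‖ : ℂ) ^ 2 / (4 * (p : ℂ) ^ 2) * Complex.exp (-4 * p * z))) *
              (1 - (‖ct‖ : ℂ) ^ 2 / (2 * p * a) *
                (Complex.exp (-4 * p * z) /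
                  (1 + (‖ct‖ : ℂ) ^ 2 / (4 * (p : ℂ) ^ 2) * Complex.exp (-4 * p * z))))) := by
  refine ⟨fun N a n c ha => ?_, fun q A B C h => ?_, fun q A B C h => ⟨fun t => ?_, ?_⟩,
    fun a c p hp hp0 hc => ?_⟩
  · obtain ⟨q, A, B, C, h, hk⟩ := (representable_reflectionlessKernel a n c ha).exists_minimal
    refine ⟨q, A, B, C, h, hk, fun w => ?_⟩
    rw [← funext hk, matrixKernel_eq]
  · refine ⟨matrixKernel_eq A B C, entriesIntegrableOn_integrandP h.eigenvalues B C, ?_,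
      entriesIntegrableOn_integrandQ h.eigenvalues C, calP_eq A B C,
      sylvester_calP h.eigenvalues B C, h.posDef_gramN, h.posDef_gramQ, h.isUnit_det_calP,
      h.calP_inv, fun z => ⟨h.isUnit_det_gammaMatrix z,
        entriesIntegrableOn_kernelL h.eigenvalues B C z,
        entriesIntegrableOn_mul_matrixKernel h.eigenvalues
          (entriesIntegrableOn_kernelL h.eigenvalues B C z),
        marchenkoAt_kernelL h z, fun ℓ hℓ hm => eq_kernelL_of_marchenko h hℓ hm,
        tildeL_eq h.eigenvalues B C z⟩⟩
    rw [integrandN_eq]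
    exact entriesIntegrableOn_integrandQ h.eigenvalues.conjTranspose Bᴴ
  · refine ⟨h.evolvedC t, fun w => ?_, fun N a c hk w => scalarKernel_evolvedC_of_sum hk t w,
      fun z => ⟨?_, ?_⟩⟩
    · rw [scalarKernel, evolvedC_eq, exp_eq_propagator, Matrix.mul_assoc C, Matrix.mul_assoc C,
        (commute_propagator_expNeg A t w).eq]
      simp only [Matrix.mul_assoc]
    · rw [tildeL_eq h.eigenvalues, gammaMatrix, calP_eq]
    · rw [h.one_add_tildeL]
      exact h.isUnit_det_waveW rfl z t
  · refine ⟨fun z t => spinVec (spinM A B C z t), fun z t => ?_, h.isHFSolution,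
      h.hasScatteringCoefficients⟩
    rw [h.pauliDot_spinM, h.one_add_tildeL, spinM]
  · subst hp
    refine ⟨isMinimalTriplet_fin_one hp0 hc, gramQ_fin_one hp0 c, gramN_fin_one hp0,
      fun m hm z t ct hct => ?_⟩
    obtain ⟨h1, h2⟩ := oneSoliton_apply hp0 hc (hm z t) hct
    have hct0 : 0 < ‖ct‖ := by
      rw [hct]
      exact norm_pos_iff.2 (mul_ne_zero hc (Complex.exp_ne_zero _))
    refine ⟨h1, ?_, h2, ?_⟩
    -- The choice `k = |c_t|/(2p)` makes `k²E` the second term of `D` and puts the centre at `z₀ =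
    -- log k/(2p)`.
    · have h3 := one_add_sq_mul_exp_eq_cosh (k := ‖ct‖ / (2 * a.re)) (by positivity) hp0 z
      have h4 : (‖ct‖ / (2 * a.re)) ^ 2 = ‖ct‖ ^ 2 / (4 * a.re ^ 2) := by ring
      rw [h4] at h3
      have h5 : ∀ x y : ℝ, 2 * (‖ct‖ ^ 2 / ‖a‖ ^ 2) * (x / y) =
          8 * a.re ^ 2 / ‖a‖ ^ 2 * (‖ct‖ ^ 2 / (4 * a.re ^ 2) * x / y) := by
        intro x y
        field_simp
        ring
      rw [h1, h5, h3]
      ring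
    -- Since `m` is real, the last formula is the complex conjugate of the previous one.
    · have h3 := congrArg conj h2
      simpa [← Complex.exp_conj, sub_eq_add_neg, map_ofNat] using h3
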